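/- Let $d\ge 1$, $\mathbb T^d=\mathbb R^d/2\pi\mathbb Z^d$, $\nu>0$, $T>0$, $J_T=[0,T]$ and $s>d/2$. For $r\in\mathbb R$ let $H^r=H^r(\mathbb T^d)$ be the Sobolev space of real-valued functions (distributions if $r<0$), with norm $\|u\|_r=\big(\sum_{k\in\mathbb Z^d}(1+|k|^2)^r|\hat u_k|^2\big)^{1/2}$. Consider the problem $$\partial_t u-\nu\Delta u+f(u)=h+\eta \quad\text{in }(0,T)\times\mathbb T^d,\qquad u(0)=u_0, \tag{1}$$ where $h\in L^2(J_T,H^{s-1})$ and $f=P_p+g$, with $P_p$ a real polynomial of degree $p\ge 2$ and $g:\mathbb R\to\mathbb R$ a $C^\infty$ function which is bounded together with each of its derivatives. A solution of (1) on $J_T$ is a function $u\in C(J_T,H^s)\cap L^2(J_T,H^{s+1})$ satisfying (1) in the sense of distributions. Let $I\subset\mathbb Z^d$ be a finite set with $I=-I$ and $0\in I$, and let $\mathcal H(I)=\mathrm{span}\{\sin\langle x,k\rangle,\cos\langle x,k\rangle : k\in I\}$. **Theorem.** Assume that either (a) $g=0$, or (b) $p>s>d/2$. If $I$ is a generator of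 $\mathbb Z^d$ (i.e. every element of $\mathbb Z^d$ is a linear combination of elements of $I$ with integer coefficients), then the equation is approximately controllable at time $T$ by $\mathcal H(I)$-valued control: for all $u_0,u_1\in H^s$ and every $\varepsilon>0$ there is a control $\eta\in L^2(J_T,\mathcal H(I))$ for which problem (1) has a unique solution $u$ on $J_T$, and this solution satisfies $$\|u(T)-u_1\|_{s}<\varepsilon .$$ -/

import Mathlib

open MeasureTheory
open scoped ContDiff

namespace ParabolicControl

/-- The squared Euclidean length `|k|² = ∑ kᵢ²` of a frequency `k ∈ ℤ^d`. -/
noncomputable def freqSq {d : ℕ} (k : Fin d → ℤ) : ℝ := ∑ i, (k i : ℝ) ^ 2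

/-- The Euclidean scalar product `⟨x, k⟩` of `x ∈ ℝ^d` and `k ∈ ℤ^d`. -/
noncomputable def pairing {d : ℕ} (x : Fin d → ℝ) (k : Fin d → ℤ) : ℝ := ∑ i, x i * (k i : ℝ)

theorem freqSq_nonneg {d : ℕ} (k : Fin d → ℤ) : 0 ≤ freqSq k :=
  Finset.sum_nonneg fun _ _ => sq_nonneg _

/-- The Sobolev weight `(1 + |k|²)^(r/2)`. -/
noncomputable def weight {d : ℕ} (r : ℝ) (k : Fin d → ℤ) : ℝ := (1 + freqSq k) ^ (r / 2)

theorem weight_pos {d : ℕ} (r : ℝ) (k : Fin d → ℤ) : 0 < weight r k :=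
  Real.rpow_pos_of_pos (by have := freqSq_nonneg k; linarith) _

/-- Multiplication of a family of Fourier coefficients by the Sobolev weight. -/
noncomputable def weighted {d : ℕ} (r : ℝ) :
    ((Fin d → ℤ) → ℂ) →ₗ[ℝ] ((Fin d → ℤ) → ℂ) where
  toFun c := fun k => (weight r k : ℂ) * c k
  map_add' a b := by funext k; simp [mul_add]
  map_smul' a b := by funext k; simp; ring

/-- The Fourier coefficients of the real-valued elements of `H^r(𝕋^d)`, `𝕋^d = ℝ^d / 2πℤ^d`:
families `(c_k)` with `c_{-k} = conj c_k` and `∑ (1 + |k|²)^r |c_k|² < ∞`. -/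
noncomputable def sobolevCoeffs (d : ℕ) (r : ℝ) : Submodule ℝ ((Fin d → ℤ) → ℂ) where
  carrier := {c | (∀ k, c (-k) = (starRingEnd ℂ) (c k)) ∧ Memℓp (weighted r c) 2}
  add_mem' := by
    rintro a b ⟨ha, ha'⟩ ⟨hb, hb'⟩
    refine ⟨fun k => by simp [ha k, hb k], ?_⟩
    rw [map_add]
    exact ha'.add hb'
  zero_mem' := ⟨fun k => by simp, by rw [map_zero]; exact zero_memℓp⟩
  smul_mem' := by
    rintro x a ⟨ha, ha'⟩
    refine ⟨fun k => by simp [ha k], ?_⟩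
    rw [map_smul]
    exact ha'.const_smul x

/-- The Sobolev space `H^r = H^r(𝕋^d)` of real-valued functions (periodic distributions if `r < 0`)
of order `r ∈ ℝ` on the torus `𝕋^d = ℝ^d / 2πℤ^d`; an element is given by its Fourier coefficients. -/
def Sobolev (d : ℕ) (r : ℝ) : Type := ↥(sobolevCoeffs d r)

namespace Sobolev

variable {d : ℕ} {r : ℝ}

noncomputable instance : AddCommGroup (Sobolev d r) :=
  inferInstanceAs (AddCommGroup ↥(sobolevCoeffs d r))

noncomputable instance : Module ℝ (Sobolev d r) :=
  inferInstanceAs (Module ℝ ↥(sobolevCoeffs d r))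

/-- The Fourier coefficients of an element of `H^r`. -/
noncomputable def coeff : Sobolev d r →ₗ[ℝ] ((Fin d → ℤ) → ℂ) := (sobolevCoeffs d r).subtype

/-- The isometry `u ↦ ((1 + |k|²)^(r/2) û_k)_k` of `H^r` into `ℓ²(ℤ^d)`. -/
noncomputable def toLp : Sobolev d r →ₗ[ℝ] lp (fun _ : Fin d → ℤ => ℂ) 2 where
  toFun u := ⟨weighted r (coeff u), u.2.2⟩
  map_add' a b := by apply Subtype.ext; simp; rfl
  map_smul' a b := by apply Subtype.ext; simp; rfl

theorem toLp_injective : Function.Injective (toLp : Sobolev d r → _) := by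
  intro a b hab
  apply Subtype.ext
  funext k
  have h := congrFun (congrArg Subtype.val hab) k
  exact mul_left_cancel₀ (Complex.ofReal_ne_zero.mpr (weight_pos r k).ne') h

/-- The norm `‖u‖_r = (∑ (1 + |k|²)^r |û_k|²)^(1/2)` of `H^r`; see `norm_sq_eq`. -/
noncomputable instance : NormedAddCommGroup (Sobolev d r) :=
  NormedAddCommGroup.induced (Sobolev d r) (lp (fun _ : Fin d → ℤ => ℂ) 2) toLp toLp_injective

noncomputable instance : NormedSpace ℝ (Sobolev d r) :=
  NormedSpace.induced ℝ (Sobolev d r) (lp (fun _ : Fin d → ℤ => ℂ) 2) toLp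

theorem norm_sq_eq (u : Sobolev d r) :
    ‖u‖ ^ 2 = ∑' k, (1 + freqSq k) ^ r * ‖coeff u k‖ ^ 2 := by
  have h : ‖u‖ = ‖toLp u‖ := rfl
  have h2 := lp.norm_rpow_eq_tsum (p := 2) (by norm_num) (toLp u)
  rw [h]
  norm_num at h2
  rw [h2]
  refine tsum_congr fun k => ?_
  have hk : (toLp u : (Fin d → ℤ) → ℂ) k = (weight r k : ℂ) * coeff u k := rfl
  rw [hk, norm_mul, mul_pow, Complex.norm_real, Real.norm_of_nonneg (weight_pos r k).le, weight,
    ← Real.rpow_natCast, ← Real.rpow_mul (by have := freqSq_nonneg k; linarith)]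
  norm_num

/-- The `2π`-periodic function `x ↦ ∑ û_k e^{i⟨x,k⟩}` of an element of `H^r`. The series converges
absolutely when `r > d/2`, and its sum is real. -/
noncomputable def toFun (u : Sobolev d r) (x : Fin d → ℝ) : ℝ :=
  (∑' k, coeff u k * Complex.exp (Complex.I * (pairing x k : ℂ))).re

end Sobolev

/-- The Fourier coefficient `(2π)^{-d} ∫_{[0,2π]^d} φ(x) e^{-i⟨x,k⟩} dx` of a `2π`-periodic
function `φ : ℝ^d → ℝ`. -/
noncomputable def fourierCoefficient {d : ℕ} (φ : (Fin d → ℝ) → ℝ) (k : Fin d → ℤ) : ℂ :=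
  ((2 * Real.pi : ℂ) ^ d)⁻¹ *
    ∫ x in Set.Icc (0 : Fin d → ℝ) (fun _ => 2 * Real.pi),
      (φ x : ℂ) * Complex.exp (-(Complex.I * (pairing x k : ℂ)))

/-- The space `ℋ(I) = span {sin⟨x,k⟩, cos⟨x,k⟩ : k ∈ I}`, as a subspace of `H^r`. -/
noncomputable def trigSpace {d : ℕ} (r : ℝ) (I : Finset (Fin d → ℤ)) :
    Submodule ℝ (Sobolev d r) :=
  Submodule.span ℝ {w | ∃ k ∈ I,
    Sobolev.coeff w = fourierCoefficient (fun x => Real.sin (pairing x k)) ∨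
    Sobolev.coeff w = fourierCoefficient (fun x => Real.cos (pairing x k))}

/-- `u` is a solution on `J_T = [0,T]`, in the class `C(J_T, H^s) ∩ L²(J_T, H^{s+1})`, of
`∂ₜu - νΔu + f(u) = φ`, `u(0) = u₀`. The equation is meant in the sense of distributions: it is
tested against every exponential `e^{-i⟨x,k⟩}` and integrated in time from `0` to `t`. -/
structure IsSolution {d : ℕ} {s : ℝ} (T ν : ℝ) (f : ℝ → ℝ) (u₀ : Sobolev d s)
    (φ : ℝ → Sobolev d (s - 1)) (u : ℝ → Sobolev d s) : Prop where
  continuousOn : ContinuousOn u (Set.Icc 0 T)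
  memL2 : ∃ v : ℝ → Sobolev d (s + 1), MemLp v 2 (volume.restrict (Set.Icc 0 T)) ∧
    ∀ᵐ t ∂(volume.restrict (Set.Icc 0 T)), Sobolev.coeff (v t) = Sobolev.coeff (u t)
  initial : u 0 = u₀
  equation : ∀ t ∈ Set.Icc 0 T, ∀ k : Fin d → ℤ,
    Sobolev.coeff (u t) k - Sobolev.coeff u₀ k
      = ∫ τ in (0 : ℝ)..t, (-((ν * freqSq k : ℝ) : ℂ) * Sobolev.coeff (u τ) k
          - fourierCoefficient (fun x => f (Sobolev.toFun (u τ) x)) k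
          + Sobolev.coeff (φ τ) k)

/-- Approximate controllability in `H^s` at time `T` of `∂ₜu - νΔu + f(u) = h + η` by controls
`η ∈ L²(J_T, ℋ)`: for all `u₀, u₁ ∈ H^s` and `ε > 0` there are a control `η` and a unique solution
`u` on `J_T` issued from `u₀` such that `‖u(T) - u₁‖_s < ε`. -/
def ApproximatelyControllable {d : ℕ} {s : ℝ} (T ν : ℝ) (f : ℝ → ℝ)
    (h : ℝ → Sobolev d (s - 1)) (H : Submodule ℝ (Sobolev d (s - 1))) : Prop :=
  ∀ u₀ u₁ : Sobolev d s, ∀ ε : ℝ, 0 < ε →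
    ∃ η : ℝ → Sobolev d (s - 1),
      MemLp η 2 (volume.restrict (Set.Icc 0 T)) ∧ (∀ t ∈ Set.Icc 0 T, η t ∈ H) ∧
      ∃ u : ℝ → Sobolev d s,
        IsSolution T ν f u₀ (fun t => h t + η t) u ∧
        (∀ v : ℝ → Sobolev d s, IsSolution T ν f u₀ (fun t => h t + η t) v →
          Set.EqOn v u (Set.Icc 0 T)) ∧
        ‖u T - u₁‖ < ε

end ParabolicControl

/-! The control can act only on the finitely many modes in `I`, and the other directions of `H^s` are
obtained from the nonlinearity. Let `c yᵖ` be the leading term of `f`, and let `ζ` be a trigonometric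
polynomial. Over a short time `δ`, started near `u₀ + λζ` with `λ = δ^{-1/p}` and driven by the
constant control `δ⁻¹η`, the equation reduces to leading order to `∂ₜu = δ⁻¹(η - cζᵖ)`: the term `cλᵖζᵖ`
of `f(u)` has exactly the size `δ⁻¹`, and everything else (heat flow, source `h`, lower-order part of
`f`) contributes `o(1)`. The state at time `δ` is therefore close to `u₀ + λζ + η - cζᵖ`. This is
`IsNonlinearity.exists_reach_near`, proved by a contraction in a small tube about an explicit path
(`exists_isMild_near`). A bounded smooth perturbation `g` is harmless, since on `H^s` the superposition
`u ↦ g(u)` grows at most like `‖u‖ˢ` with `s < p` when `s ≥ 1` (`exists_compCoeff_bound`), and is bounded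
from `H^s` to `L² ⊂ H^{s-1}` when `s ≤ 1`. These bounds are collected in `IsNonlinearity`.

Say that `q` can be steered if from any state `u₀` one can approach `u₀ + q` in an arbitrarily short
time. Such `q` form a closed set, stable under addition. With `ζ = 0` the asymptotics show that it
contains `ℋ(I)`. If all multiples of `ζ` can be steered, then one goes to `u₀ + λζ`, waits for the time
`δ`, and returns by `-λζ`: this steers `-cζᵖ`. Taking `1 + eζ` in the place of `ζ`, and using that
multiples of `1` and `ζ` are free, the terms of order `e²` give `±ζ²` with one sign. As `cos² + sin² = 1`,
both signs are available for the squares of the modes, then for the products of modes by polarization,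
and the addition formulas show that the frequencies `k` for which all multiples of `cos⟨x,k⟩` and
`sin⟨x,k⟩` can be steered form a subgroup of `ℤ^d` (`eq_univ_of_saturation`). It contains `I`, so it is
everything, and by density every `q ∈ H^s` can be steered.

It remains to arrive at time `T` exactly. A state near `u₁` stays near `u₁` during a short time `κ`, and
may then be steered back towards `u₁`; repeating this fills `[0, T]` and also prevents blow-up
(`IsNonlinearity.exists_reach_final`). The paths are mild solutions, given by the variation of constants
formula. Maximal regularity of the heat equation, checked mode by mode, shows that they are solutions in
the required class (`exists_memLp_of_mild`, `IsNonlinearity.isSolution_iff_isMild`), and uniqueness follows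
from Gronwall's lemma (`IsMild.eqOn`). -/

namespace ParabolicControl

open scoped ENNReal
open Filter Topology

variable {d : ℕ}

/-! ### Sequence norms and products of Fourier series -/

/-- The squared `H^r` norm `∑ (1 + |k|²)^r |c_k|²` of an arbitrary family of Fourier coefficients,
with values in `[0, ∞]`. -/
noncomputable def sqNorm (r : ℝ) (c : (Fin d → ℤ) → ℂ) : ℝ≥0∞ :=
  ∑' k, ENNReal.ofReal ((1 + freqSq k) ^ r) * ‖c k‖ₑ ^ 2

theorem one_le_one_add_freqSq (k : Fin d → ℤ) : 1 ≤ 1 + freqSq k := by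
  linarith [freqSq_nonneg k]

theorem one_add_freqSq_pos (k : Fin d → ℤ) : 0 < 1 + freqSq k := by
  linarith [freqSq_nonneg k]

theorem enorm_coeff_sq (u : Fin d → ℤ) (r : ℝ) (z : ℂ) :
    ENNReal.ofReal ((1 + freqSq u) ^ r) * ‖z‖ₑ ^ 2
      = ENNReal.ofReal ((1 + freqSq u) ^ r * ‖z‖ ^ 2) := by
  rw [ENNReal.ofReal_mul (Real.rpow_nonneg (one_add_freqSq_pos u).le _),
    ENNReal.ofReal_pow (norm_nonneg _), ofReal_norm]

theorem norm_weighted_sq (r : ℝ) (c : (Fin d → ℤ) → ℂ) (k : Fin d → ℤ) :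
    ‖weighted r c k‖ ^ 2 = (1 + freqSq k) ^ r * ‖c k‖ ^ 2 := by
  have : weighted r c k = (weight r k : ℂ) * c k := rfl
  rw [this, norm_mul, mul_pow, Complex.norm_real, Real.norm_of_nonneg (weight_pos r k).le, weight,
    ← Real.rpow_natCast, ← Real.rpow_mul (one_add_freqSq_pos k).le]
  norm_num

theorem memℓp_weighted_iff (r : ℝ) (c : (Fin d → ℤ) → ℂ) :
    Memℓp (weighted r c) 2 ↔ Summable fun k => (1 + freqSq k) ^ r * ‖c k‖ ^ 2 := by
  rw [memℓp_gen_iff (by norm_num)]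
  refine summable_congr fun k => ?_
  rw [← norm_weighted_sq]
  norm_num

theorem sqNorm_eq_tsum_ofReal (r : ℝ) (c : (Fin d → ℤ) → ℂ) :
    sqNorm r c = ∑' k, ENNReal.ofReal ((1 + freqSq k) ^ r * ‖c k‖ ^ 2) :=
  tsum_congr fun k => enorm_coeff_sq k r (c k)

theorem sobolev_term_nonneg (r : ℝ) (c : (Fin d → ℤ) → ℂ) (k : Fin d → ℤ) :
    0 ≤ (1 + freqSq k) ^ r * ‖c k‖ ^ 2 :=
  mul_nonneg (Real.rpow_nonneg (one_add_freqSq_pos k).le _) (sq_nonneg _)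

theorem summable_iff_sqNorm_ne_top (r : ℝ) (c : (Fin d → ℤ) → ℂ) :
    (Summable fun k => (1 + freqSq k) ^ r * ‖c k‖ ^ 2) ↔ sqNorm r c ≠ ⊤ := by
  rw [sqNorm_eq_tsum_ofReal]
  constructor
  · intro h
    exact h.tsum_ofReal_ne_top
  · intro h
    have := ENNReal.summable_toReal h
    refine this.congr fun k => ?_
    rw [ENNReal.toReal_ofReal (sobolev_term_nonneg r c k)]

namespace Sobolev

variable {r : ℝ}

theorem coeff_neg (u : Sobolev d r) (k : Fin d → ℤ) :
    coeff u (-k) = (starRingEnd ℂ) (coeff u k) := u.2.1 k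

theorem summable_coeff (u : Sobolev d r) :
    Summable fun k => (1 + freqSq k) ^ r * ‖coeff u k‖ ^ 2 :=
  (memℓp_weighted_iff r _).1 u.2.2

theorem coeff_injective : Function.Injective (coeff : Sobolev d r → _) :=
  Subtype.coe_injective

@[ext] theorem ext {u v : Sobolev d r} (h : ∀ k, coeff u k = coeff v k) : u = v :=
  coeff_injective (funext h)

theorem sqNorm_coeff (u : Sobolev d r) : sqNorm r (coeff u) = ‖u‖ₑ ^ 2 := by
  rw [sqNorm_eq_tsum_ofReal, ← ofReal_norm, ← ENNReal.ofReal_pow (norm_nonneg _), norm_sq_eq,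
    ENNReal.ofReal_tsum_of_nonneg (fun k => sobolev_term_nonneg r _ k) (summable_coeff u)]

theorem sqNorm_coeff_ne_top (u : Sobolev d r) : sqNorm r (coeff u) ≠ ⊤ :=
  (summable_iff_sqNorm_ne_top r _).1 (summable_coeff u)

/-- The element of `H^r` with prescribed Fourier coefficients. -/
noncomputable def ofCoeff (c : (Fin d → ℤ) → ℂ) (hc : ∀ k, c (-k) = (starRingEnd ℂ) (c k))
    (h : sqNorm r c ≠ ⊤) : Sobolev d r :=
  ⟨c, hc, (memℓp_weighted_iff r c).2 ((summable_iff_sqNorm_ne_top r c).2 h)⟩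

@[simp] theorem coeff_ofCoeff (c : (Fin d → ℤ) → ℂ) (hc : ∀ k, c (-k) = (starRingEnd ℂ) (c k))
    (h : sqNorm r c ≠ ⊤) : coeff (ofCoeff c hc h) = c := rfl

theorem norm_le_of_sqNorm_le {u : Sobolev d r} {B : ℝ} (hB : 0 ≤ B)
    (h : sqNorm r (coeff u) ≤ ENNReal.ofReal (B ^ 2)) : ‖u‖ ≤ B := by
  rw [sqNorm_coeff, ← ofReal_norm, ← ENNReal.ofReal_pow (norm_nonneg _),
    ENNReal.ofReal_le_ofReal_iff (sq_nonneg _)] at h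
  exact (pow_le_pow_iff_left₀ (norm_nonneg _) hB two_ne_zero).1 h

theorem sqNorm_coeff_eq_ofReal (u : Sobolev d r) :
    sqNorm r (coeff u) = ENNReal.ofReal (‖u‖ ^ 2) := by
  rw [sqNorm_coeff, ← ofReal_norm, ← ENNReal.ofReal_pow (norm_nonneg _)]

end Sobolev

theorem sqNorm_mono {r : ℝ} {a b : (Fin d → ℤ) → ℂ} (h : ∀ k, ‖a k‖ ≤ ‖b k‖) :
    sqNorm r a ≤ sqNorm r b := by
  rw [sqNorm_eq_tsum_ofReal, sqNorm_eq_tsum_ofReal]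
  refine ENNReal.tsum_le_tsum fun k => ENNReal.ofReal_le_ofReal ?_
  have := Real.rpow_nonneg (one_add_freqSq_pos k).le r
  gcongr
  exact h k

theorem sqNorm_mono_exp {r r' : ℝ} (h : r ≤ r') (c : (Fin d → ℤ) → ℂ) :
    sqNorm r c ≤ sqNorm r' c := by
  refine ENNReal.tsum_le_tsum fun k => ?_
  gcongr
  exact one_le_one_add_freqSq k

theorem sqNorm_add_le (r : ℝ) (a b : (Fin d → ℤ) → ℂ) :
    sqNorm r (a + b) ≤ 2 * sqNorm r a + 2 * sqNorm r b := by
  simp only [sqNorm_eq_tsum_ofReal]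
  rw [← ENNReal.tsum_mul_left, ← ENNReal.tsum_mul_left, ← ENNReal.tsum_add]
  refine ENNReal.tsum_le_tsum fun k => ?_
  have e : (2 : ℝ≥0∞) = ENNReal.ofReal 2 := by norm_num
  rw [e, ← ENNReal.ofReal_mul (by norm_num), ← ENNReal.ofReal_mul (by norm_num),
    ← ENNReal.ofReal_add (mul_nonneg (by norm_num) (sobolev_term_nonneg r a k))
      (mul_nonneg (by norm_num) (sobolev_term_nonneg r b k))]
  refine ENNReal.ofReal_le_ofReal ?_
  have h1 : ‖(a + b) k‖ ^ 2 ≤ 2 * ‖a k‖ ^ 2 + 2 * ‖b k‖ ^ 2 := by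
    have := norm_add_le (a k) (b k)
    have h0 := norm_nonneg ((a + b) k)
    simp only [Pi.add_apply] at *
    nlinarith [sq_nonneg (‖a k‖ - ‖b k‖)]
  have h2 := Real.rpow_nonneg (one_add_freqSq_pos k).le r
  nlinarith

theorem sqNorm_smul (r : ℝ) (z : ℂ) (a : (Fin d → ℤ) → ℂ) :
    sqNorm r (z • a) = ‖z‖ₑ ^ 2 * sqNorm r a := by
  simp only [sqNorm, ← ENNReal.tsum_mul_left]
  refine tsum_congr fun k => ?_
  rw [Pi.smul_apply, smul_eq_mul, enorm_mul]
  ring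

@[simp] theorem sqNorm_zero (r : ℝ) : sqNorm r (0 : (Fin d → ℤ) → ℂ) = 0 := by
  simp [sqNorm]

theorem sqNorm_ne_top_of_finite {r : ℝ} {c : (Fin d → ℤ) → ℂ} (h : c.support.Finite) :
    sqNorm r c ≠ ⊤ := by
  rw [← summable_iff_sqNorm_ne_top]
  refine summable_of_ne_finset_zero (s := h.toFinset) fun k hk => ?_
  have : c k = 0 := by simpa using hk
  simp [this]

/-- Lower semicontinuity of the Sobolev norms for pointwise convergence of the coefficients. -/
theorem sqNorm_le_of_tendsto {ι : Type*} {l : Filter ι} [l.NeBot] {r : ℝ}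
    {a : ι → (Fin d → ℤ) → ℂ} {b : (Fin d → ℤ) → ℂ} {C : ℝ≥0∞}
    (hlim : ∀ k, Tendsto (fun i => a i k) l (𝓝 (b k))) (hC : ∀ᶠ i in l, sqNorm r (a i) ≤ C) :
    sqNorm r b ≤ C := by
  rw [sqNorm, ENNReal.tsum_eq_iSup_sum]
  refine iSup_le fun F => ?_
  have ht : Tendsto (fun i => ∑ k ∈ F, ENNReal.ofReal ((1 + freqSq k) ^ r) * ‖a i k‖ₑ ^ 2) l
      (𝓝 (∑ k ∈ F, ENNReal.ofReal ((1 + freqSq k) ^ r) * ‖b k‖ₑ ^ 2)) := by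
    refine tendsto_finsetSum _ fun k _ => ?_
    refine ENNReal.Tendsto.const_mul ?_ (Or.inr ENNReal.ofReal_ne_top)
    exact ((ENNReal.continuous_pow 2).tendsto _).comp (((continuous_enorm).tendsto _).comp (hlim k))
  refine le_of_tendsto ht (hC.mono fun i hi => le_trans ?_ hi)
  exact ENNReal.sum_le_tsum F

/-- Cauchy–Schwarz for sums in `[0, ∞]`. -/
theorem tsum_mul_sq_le {ι : Type*} (f g : ι → ℝ≥0∞) :
    (∑' i, f i * g i) ^ 2 ≤ (∑' i, f i ^ 2) * ∑' i, g i ^ 2 := by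
  let _ : MeasurableSpace ι := ⊤
  have h := ENNReal.lintegral_mul_le_Lp_mul_Lq (Measure.count : Measure ι)
    (p := 2) (q := 2) Real.HolderConjugate.two_two
    (f := f) (g := g) measurable_from_top.aemeasurable measurable_from_top.aemeasurable
  simp only [lintegral_count, Pi.mul_apply] at h
  have h2 := pow_le_pow_left' h 2
  refine h2.trans_eq ?_
  rw [mul_pow, ← ENNReal.rpow_natCast, ← ENNReal.rpow_mul, ← ENNReal.rpow_natCast,
    ← ENNReal.rpow_mul]
  norm_num

/-- Young's inequality `ℓ¹ * ℓ² ⊂ ℓ²`. -/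
theorem tsum_conv_sq_le (f g : (Fin d → ℤ) → ℝ≥0∞) :
    ∑' k, (∑' l, f l * g (k - l)) ^ 2 ≤ (∑' l, f l) ^ 2 * ∑' m, g m ^ 2 := by
  have key : ∀ k, (∑' l, f l * g (k - l)) ^ 2 ≤ (∑' l, f l) * ∑' l, f l * g (k - l) ^ 2 := by
    intro k
    have h := tsum_mul_sq_le (fun l => f l ^ (1 / 2 : ℝ)) (fun l => f l ^ (1 / 2 : ℝ) * g (k - l))
    have e : ∀ x : ℝ≥0∞, (x ^ (1 / 2 : ℝ)) ^ 2 = x := fun x => by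
      rw [← ENNReal.rpow_natCast, ← ENNReal.rpow_mul]; norm_num
    simp only [mul_pow, e, ← mul_assoc, ← pow_two] at h
    exact h
  refine (ENNReal.tsum_le_tsum key).trans_eq ?_
  rw [ENNReal.tsum_mul_left, ENNReal.tsum_comm, pow_two, mul_assoc]
  congr 1
  simp only [ENNReal.tsum_mul_left]
  rw [← ENNReal.tsum_mul_right]
  refine tsum_congr fun l => ?_
  congr 1
  exact (Equiv.subRight l).tsum_eq (fun m => g m ^ 2)

theorem tsum_conv_sq_le' (f g : (Fin d → ℤ) → ℝ≥0∞) :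
    ∑' k, (∑' l, f l * g (k - l)) ^ 2 ≤ (∑' l, f l ^ 2) * (∑' m, g m) ^ 2 := by
  refine le_trans (le_of_eq ?_) ((tsum_conv_sq_le g f).trans_eq (mul_comm _ _))
  refine tsum_congr fun k => ?_
  congr 1
  rw [← (Equiv.subLeft k).tsum_eq]
  refine tsum_congr fun l => ?_
  simp [mul_comm]

open Submodule in
/-- The lattice sum `∑ (1 + |k|²)^{-γ}` converges exactly in the range needed for `H^γ ⊂ C(𝕋^d)`. -/
theorem summable_one_add_freqSq_rpow {γ : ℝ} (hγ : (d : ℝ) / 2 < γ) :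
    Summable fun k : Fin d → ℤ => (1 + freqSq k) ^ (-γ) := by
  let L : Submodule ℤ (Fin d → ℝ) := span ℤ (Set.range (Pi.basisFun ℝ (Fin d)))
  have hrank : Module.finrank ℤ L = d := by
    have := ZLattice.rank ℝ (span ℤ (Set.range (Pi.basisFun ℝ (Fin d))))
    simpa using this
  have hs := ZLattice.summable_norm_rpow L (-2 * γ) (by rw [hrank]; linarith)
  have hmem : ∀ k : Fin d → ℤ, (fun i => (k i : ℝ)) ∈ L := by
    intro k
    have : (fun i => (k i : ℝ)) = ∑ i, k i • Pi.basisFun ℝ (Fin d) i := by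
      funext j
      simp [Finset.sum_apply, Pi.single_apply]
    rw [this]
    exact sum_mem fun i _ => smul_mem _ _ (subset_span ⟨i, rfl⟩)
  let φ : (Fin d → ℤ) → L := fun k => ⟨_, hmem k⟩
  have hφ : Function.Injective φ := by
    intro k l hkl
    funext i
    have : ((k i : ℤ) : ℝ) = (l i : ℤ) := congrFun (congrArg Subtype.val hkl) i
    exact_mod_cast this
  refine Summable.of_norm_bounded_eventually (hs.comp_injective hφ) ?_
  filter_upwards [(Set.finite_singleton (0 : Fin d → ℤ)).compl_mem_cofinite] with k hk
  have hk0 : k ≠ 0 := by simpa using hk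
  have hd : 0 ≤ (d : ℝ) / 2 := by positivity
  have hle : ‖φ k‖ ^ 2 ≤ 1 + freqSq k := by
    have h1 : ‖φ k‖ ≤ Real.sqrt (freqSq k) := by
      refine (pi_norm_le_iff_of_nonneg (Real.sqrt_nonneg _)).2 fun i => ?_
      refine Real.le_sqrt_of_sq_le ?_
      have : ‖((k i : ℤ) : ℝ)‖ ^ 2 = (k i : ℝ) ^ 2 := by simp
      change ‖((k i : ℤ) : ℝ)‖ ^ 2 ≤ _
      rw [this]
      exact Finset.single_le_sum (f := fun i => (k i : ℝ) ^ 2) (fun i _ => sq_nonneg _)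
        (Finset.mem_univ i)
    calc ‖φ k‖ ^ 2 ≤ Real.sqrt (freqSq k) ^ 2 := by gcongr
      _ = freqSq k := Real.sq_sqrt (freqSq_nonneg k)
      _ ≤ _ := by linarith
  have hpos : 0 < ‖φ k‖ := by
    rw [norm_pos_iff]
    intro h0
    apply hk0
    apply hφ
    rw [h0]
    apply Subtype.ext
    funext i
    simp [φ]
  rw [Real.norm_of_nonneg (Real.rpow_nonneg (one_add_freqSq_pos k).le _)]
  calc (1 + freqSq k) ^ (-γ) ≤ (‖φ k‖ ^ 2) ^ (-γ) :=
        Real.rpow_le_rpow_of_nonpos (by positivity) hle (by linarith)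
    _ = ‖φ k‖ ^ (-2 * γ) := by
        rw [← Real.rpow_natCast, ← Real.rpow_mul hpos.le]; congr 1; push_cast; ring

theorem tsum_one_add_freqSq_rpow_ne_top {γ : ℝ} (hγ : (d : ℝ) / 2 < γ) :
    ∑' k : Fin d → ℤ, ENNReal.ofReal ((1 + freqSq k) ^ (-γ)) ≠ ⊤ :=
  (summable_one_add_freqSq_rpow hγ).tsum_ofReal_ne_top

/-- The convolution of two families of Fourier coefficients, i.e. the coefficients of a product. -/
noncomputable def conv (a b : (Fin d → ℤ) → ℂ) (k : Fin d → ℤ) : ℂ := ∑' l, a l * b (k - l)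

theorem one_add_freqSq_le (k l : Fin d → ℤ) :
    1 + freqSq k ≤ 2 * (1 + freqSq l) + 2 * (1 + freqSq (k - l)) := by
  have : freqSq k ≤ 2 * freqSq l + 2 * freqSq (k - l) := by
    simp only [freqSq, Finset.mul_sum, ← Finset.sum_add_distrib]
    refine Finset.sum_le_sum fun i _ => ?_
    simp only [Pi.sub_apply, Int.cast_sub]
    nlinarith [sq_nonneg ((k i : ℝ) - 2 * l i)]
  linarith

/-- The Peetre-type weight inequality behind the product estimate: with `γ = a + b - c`, one of the
two factors can absorb the output weight while the other one keeps a decay of order `γ`. -/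
theorem weight_product_le {c a b : ℝ} (hc : 0 ≤ c) (hca : c ≤ a) (hcb : c ≤ b)
    (k l : Fin d → ℤ) :
    (1 + freqSq k) ^ (c / 2) ≤
      2 * 4 ^ (c / 2) * ((1 + freqSq l) ^ (-((a + b - c) / 2))
        + (1 + freqSq (k - l)) ^ (-((a + b - c) / 2)))
      * ((1 + freqSq l) ^ (a / 2) * (1 + freqSq (k - l)) ^ (b / 2)) := by
  set x := 1 + freqSq l
  set y := 1 + freqSq (k - l)
  have hx : 1 ≤ x := one_le_one_add_freqSq _
  have hy : 1 ≤ y := one_le_one_add_freqSq _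
  have hx0 : 0 < x := by linarith
  have hy0 : 0 < y := by linarith
  have hk := one_add_freqSq_le k l
  have hk0 := one_add_freqSq_pos k
  have main : ∀ x y a b : ℝ, 1 ≤ x → 1 ≤ y → c ≤ a → c ≤ b → x ≤ y →
      y ^ (c / 2) ≤ 2 * (x ^ (-((a + b - c) / 2)) + y ^ (-((a + b - c) / 2)))
        * (x ^ (a / 2) * y ^ (b / 2)) := by
    intro x y a b hx hy hca hcb hxy
    have hx0 : 0 < x := by linarith
    have hy0 : 0 < y := by linarith
    have h1 : y ^ (c / 2) ≤ x ^ (-((a + b - c) / 2)) * (x ^ (a / 2) * y ^ (b / 2)) := by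
      have e1 : x ^ (-((a + b - c) / 2)) * (x ^ (a / 2) * y ^ (b / 2))
          = x ^ (-((b - c) / 2)) * y ^ ((b - c) / 2) * y ^ (c / 2) := by
        rw [← mul_assoc, ← Real.rpow_add hx0, mul_assoc, ← Real.rpow_add hy0]
        congr 2 <;> ring
      rw [e1, Real.rpow_neg hx0.le]
      have h2 : x ^ ((b - c) / 2) ≤ y ^ ((b - c) / 2) :=
        Real.rpow_le_rpow hx0.le hxy (by linarith)
      have h3 : 0 < x ^ ((b - c) / 2) := Real.rpow_pos_of_pos hx0 _
      have h4 : 1 ≤ (x ^ ((b - c) / 2))⁻¹ * y ^ ((b - c) / 2) := by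
        rw [le_inv_mul_iff₀ h3]; simpa using h2
      exact le_mul_of_one_le_left (Real.rpow_nonneg hy0.le _) h4
    have h5 : 0 ≤ x ^ (a / 2) * y ^ (b / 2) := by positivity
    have h6 : 0 ≤ x ^ (-((a + b - c) / 2)) := by positivity
    have h7 : 0 ≤ y ^ (-((a + b - c) / 2)) := by positivity
    nlinarith [mul_nonneg h6 h5, mul_nonneg h7 h5]
  have hmul : ∀ z : ℝ, 0 ≤ z → (4 * z) ^ (c / 2) = 4 ^ (c / 2) * z ^ (c / 2) := fun z hz =>
    Real.mul_rpow (by norm_num) hz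
  have h4 : (0 : ℝ) < 4 ^ (c / 2) := by positivity
  rcases le_total x y with hxy | hxy
  · calc (1 + freqSq k) ^ (c / 2) ≤ (4 * y) ^ (c / 2) :=
          Real.rpow_le_rpow hk0.le (by linarith) (by linarith)
      _ = 4 ^ (c / 2) * y ^ (c / 2) := hmul y hy0.le
      _ ≤ 4 ^ (c / 2) * _ := mul_le_mul_of_nonneg_left (main x y a b hx hy hca hcb hxy) h4.le
      _ = _ := by ring
  · calc (1 + freqSq k) ^ (c / 2) ≤ (4 * x) ^ (c / 2) :=
          Real.rpow_le_rpow hk0.le (by linarith) (by linarith)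
      _ = 4 ^ (c / 2) * x ^ (c / 2) := hmul x hx0.le
      _ ≤ 4 ^ (c / 2) * _ := mul_le_mul_of_nonneg_left (main y x b a hy hx hcb hca hxy) h4.le
      _ = _ := by rw [add_comm b a]; ring

theorem sqNorm_eq_tsum_sq (r : ℝ) (c : (Fin d → ℤ) → ℂ) :
    sqNorm r c = ∑' k, (ENNReal.ofReal ((1 + freqSq k) ^ (r / 2)) * ‖c k‖ₑ) ^ 2 := by
  refine tsum_congr fun k => ?_
  rw [mul_pow, ← ENNReal.ofReal_pow (Real.rpow_nonneg (one_add_freqSq_pos k).le _),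
    ← Real.rpow_natCast, ← Real.rpow_mul (one_add_freqSq_pos k).le]
  norm_num

/-- The weighted `ℓ¹` bound behind the Sobolev embedding. -/
theorem tsum_weight_sq_le (γ r : ℝ) (a : (Fin d → ℤ) → ℂ) :
    (∑' l, ENNReal.ofReal ((1 + freqSq l) ^ (-(γ / 2)))
        * (ENNReal.ofReal ((1 + freqSq l) ^ (r / 2)) * ‖a l‖ₑ)) ^ 2
      ≤ (∑' k : Fin d → ℤ, ENNReal.ofReal ((1 + freqSq k) ^ (-γ))) * sqNorm r a := by
  refine (tsum_mul_sq_le _ _).trans_eq ?_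
  rw [← sqNorm_eq_tsum_sq]
  congr 1
  refine tsum_congr fun k => ?_
  rw [← ENNReal.ofReal_pow (Real.rpow_nonneg (one_add_freqSq_pos k).le _),
    ← Real.rpow_natCast, ← Real.rpow_mul (one_add_freqSq_pos k).le]
  congr 2
  push_cast
  ring

/-- `H^s ⊂ A(𝕋^d)` for `s > d/2`: the Fourier coefficients are absolutely summable. -/
theorem tsum_enorm_sq_le (s : ℝ) (a : (Fin d → ℤ) → ℂ) :
    (∑' l, ‖a l‖ₑ) ^ 2
      ≤ (∑' k : Fin d → ℤ, ENNReal.ofReal ((1 + freqSq k) ^ (-s))) * sqNorm s a := by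
  refine le_trans (le_of_eq ?_) (tsum_weight_sq_le s s a)
  congr 1
  refine tsum_congr fun k => ?_
  rw [← mul_assoc, ← ENNReal.ofReal_mul (Real.rpow_nonneg (one_add_freqSq_pos k).le _),
    ← Real.rpow_add (one_add_freqSq_pos k)]
  simp

/-- The product estimate `H^a · H^b ⊂ H^c` for `0 ≤ c ≤ min a b`, `a + b - c > d/2`. -/
theorem exists_sqNorm_conv_le {c a b : ℝ} (hc : 0 ≤ c) (hca : c ≤ a) (hcb : c ≤ b)
    (hγ : (d : ℝ) / 2 < a + b - c) :
    ∃ C : ℝ, 0 ≤ C ∧ ∀ u v : (Fin d → ℤ) → ℂ,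
      sqNorm c (conv u v) ≤ ENNReal.ofReal C * (sqNorm a u * sqNorm b v) := by
  set γ := a + b - c with hγd
  set S : ℝ≥0∞ := ∑' k : Fin d → ℤ, ENNReal.ofReal ((1 + freqSq k) ^ (-γ)) with hS
  have hStop : S ≠ ⊤ := tsum_one_add_freqSq_rpow_ne_top hγ
  set M : ℝ≥0∞ := ENNReal.ofReal (2 * 4 ^ (c / 2)) with hM
  have hC : M ^ 2 * (2 * S + 2 * S) ≠ ⊤ := by
    refine ENNReal.mul_ne_top (ENNReal.pow_ne_top ENNReal.ofReal_ne_top) ?_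
    simp [ENNReal.mul_eq_top, hStop]
  refine ⟨(M ^ 2 * (2 * S + 2 * S)).toReal, ENNReal.toReal_nonneg, fun u v => ?_⟩
  rw [ENNReal.ofReal_toReal hC]
  set X : (Fin d → ℤ) → ℝ≥0∞ := fun l => ENNReal.ofReal ((1 + freqSq l) ^ (a / 2)) * ‖u l‖ₑ
  set Y : (Fin d → ℤ) → ℝ≥0∞ := fun l => ENNReal.ofReal ((1 + freqSq l) ^ (b / 2)) * ‖v l‖ₑ
  set w : (Fin d → ℤ) → ℝ≥0∞ := fun l => ENNReal.ofReal ((1 + freqSq l) ^ (-(γ / 2)))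
  have hX : ∑' l, X l ^ 2 = sqNorm a u := (sqNorm_eq_tsum_sq a u).symm
  have hY : ∑' l, Y l ^ 2 = sqNorm b v := (sqNorm_eq_tsum_sq b v).symm
  have hwX : (∑' l, w l * X l) ^ 2 ≤ S * sqNorm a u := tsum_weight_sq_le γ a u
  have hwY : (∑' l, w l * Y l) ^ 2 ≤ S * sqNorm b v := tsum_weight_sq_le γ b v
  have hpt : ∀ k, ENNReal.ofReal ((1 + freqSq k) ^ (c / 2)) * ‖conv u v k‖ₑ
      ≤ M * (∑' l, (w l * X l) * Y (k - l) + ∑' l, X l * (w (k - l) * Y (k - l))) := by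
    intro k
    have h1 : ‖conv u v k‖ₑ ≤ ∑' l, ‖u l‖ₑ * ‖v (k - l)‖ₑ := by
      refine enorm_tsum_le_tsum_enorm.trans_eq ?_
      simp only [enorm_mul]
    refine (mul_le_mul_right h1 _).trans ?_
    rw [← ENNReal.tsum_add, ← ENNReal.tsum_mul_left, ← ENNReal.tsum_mul_left]
    refine ENNReal.tsum_le_tsum fun l => ?_
    have h2 := ENNReal.ofReal_le_ofReal (weight_product_le hc hca hcb k l)
    have n1 := Real.rpow_nonneg (one_add_freqSq_pos l).le (-(γ / 2))
    have n2 := Real.rpow_nonneg (one_add_freqSq_pos (k - l)).le (-(γ / 2))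
    have n3 := Real.rpow_nonneg (one_add_freqSq_pos l).le (a / 2)
    have n4 := Real.rpow_nonneg (one_add_freqSq_pos (k - l)).le (b / 2)
    have n5 : (0 : ℝ) ≤ 2 * 4 ^ (c / 2) := by positivity
    rw [ENNReal.ofReal_mul (mul_nonneg n5 (add_nonneg n1 n2)), ENNReal.ofReal_mul n5,
      ENNReal.ofReal_add n1 n2, ENNReal.ofReal_mul n3] at h2
    refine (mul_le_mul_left h2 _).trans_eq ?_
    simp only [X, Y, w, M]
    ring
  rw [sqNorm_eq_tsum_sq]
  have e2 : ∀ x y : ℝ≥0∞, (x + y) ^ 2 ≤ 2 * x ^ 2 + 2 * y ^ 2 := by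
    intro x y
    have := ENNReal.rpow_add_le_mul_rpow_add_rpow x y (p := 2) (by norm_num)
    norm_num at this
    rw [← mul_add]
    exact this
  calc ∑' k, (ENNReal.ofReal ((1 + freqSq k) ^ (c / 2)) * ‖conv u v k‖ₑ) ^ 2
      ≤ ∑' k, (M ^ 2 * (2 * (∑' l, (w l * X l) * Y (k - l)) ^ 2
          + 2 * (∑' l, X l * (w (k - l) * Y (k - l))) ^ 2)) := by
        refine ENNReal.tsum_le_tsum fun k => (pow_le_pow_left' (hpt k) 2).trans ?_
        rw [mul_pow]
        gcongr
        exact e2 _ _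
    _ = M ^ 2 * (2 * ∑' k, (∑' l, (w l * X l) * Y (k - l)) ^ 2
          + 2 * ∑' k, (∑' l, X l * (w (k - l) * Y (k - l))) ^ 2) := by
        rw [ENNReal.tsum_mul_left, ENNReal.tsum_add, ENNReal.tsum_mul_left, ENNReal.tsum_mul_left]
    _ ≤ M ^ 2 * (2 * (S * sqNorm a u * sqNorm b v) + 2 * (sqNorm a u * (S * sqNorm b v))) := by
        gcongr
        · refine (tsum_conv_sq_le (fun l => w l * X l) Y).trans ?_
          rw [hY]
          gcongr
        · refine (tsum_conv_sq_le' X (fun l => w l * Y l)).trans ?_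
          rw [hX]
          gcongr
    _ = M ^ 2 * (2 * S + 2 * S) * (sqNorm a u * sqNorm b v) := by ring

/-! ### Fourier coefficients of continuous periodic functions -/

/-- The character `x ↦ e^{i⟨x,k⟩}`. -/
noncomputable def expMode (k : Fin d → ℤ) (x : Fin d → ℝ) : ℂ :=
  Complex.exp (Complex.I * (pairing x k : ℂ))

theorem pairing_add_right (x : Fin d → ℝ) (k l : Fin d → ℤ) :
    pairing x (k + l) = pairing x k + pairing x l := by
  simp [pairing, mul_add, Finset.sum_add_distrib]

@[simp] theorem pairing_zero_right (x : Fin d → ℝ) : pairing x (0 : Fin d → ℤ) = 0 := by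
  simp [pairing]

theorem pairing_neg_right (x : Fin d → ℝ) (k : Fin d → ℤ) : pairing x (-k) = -pairing x k := by
  simp [pairing]

theorem expMode_add (k l : Fin d → ℤ) (x : Fin d → ℝ) :
    expMode (k + l) x = expMode k x * expMode l x := by
  rw [expMode, expMode, expMode, ← Complex.exp_add, pairing_add_right]
  push_cast
  ring_nf

@[simp] theorem expMode_zero (x : Fin d → ℝ) : expMode (0 : Fin d → ℤ) x = 1 := by
  simp [expMode]

@[simp] theorem norm_expMode (k : Fin d → ℤ) (x : Fin d → ℝ) : ‖expMode k x‖ = 1 := by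
  rw [expMode, mul_comm, Complex.norm_exp_ofReal_mul_I]

theorem expMode_neg (k : Fin d → ℤ) (x : Fin d → ℝ) :
    expMode (-k) x = (starRingEnd ℂ) (expMode k x) := by
  rw [expMode, expMode, ← Complex.exp_conj, pairing_neg_right]
  simp

theorem continuous_pairing (k : Fin d → ℤ) : Continuous fun x : Fin d → ℝ => pairing x k := by
  unfold pairing
  fun_prop

theorem continuous_expMode (k : Fin d → ℤ) : Continuous (expMode k : (Fin d → ℝ) → ℂ) := by
  unfold expMode
  exact Complex.continuous_exp.comp
    (continuous_const.mul (Complex.continuous_ofReal.comp (continuous_pairing k)))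

/-- The normalized Lebesgue measure of the period cell `[0,2π]^d`. -/
noncomputable def cellMeasure (d : ℕ) : Measure (Fin d → ℝ) :=
  (ENNReal.ofReal (2 * Real.pi) ^ d)⁻¹ •
    volume.restrict (Set.Icc (0 : Fin d → ℝ) (fun _ => 2 * Real.pi))

theorem volume_cell : volume (Set.Icc (0 : Fin d → ℝ) (fun _ => 2 * Real.pi))
    = ENNReal.ofReal (2 * Real.pi) ^ d := by
  rw [Real.volume_Icc_pi]
  simp

instance : IsProbabilityMeasure (cellMeasure d) := by
  constructor
  rw [cellMeasure, Measure.smul_apply, Measure.restrict_apply_univ, volume_cell, smul_eq_mul]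
  refine ENNReal.inv_mul_cancel ?_ ?_
  · refine pow_ne_zero _ ?_
    simp [Real.pi_pos]
  · exact ENNReal.pow_ne_top ENNReal.ofReal_ne_top

theorem integral_cellMeasure (φ : (Fin d → ℝ) → ℂ) :
    ∫ x, φ x ∂cellMeasure d = ((2 * Real.pi : ℂ) ^ d)⁻¹ *
      ∫ x in Set.Icc (0 : Fin d → ℝ) (fun _ => 2 * Real.pi), φ x := by
  rw [cellMeasure, integral_smul_measure, ENNReal.toReal_inv, ENNReal.toReal_pow,
    ENNReal.toReal_ofReal (by positivity), Complex.real_smul]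
  push_cast
  rfl

/-- The Fourier coefficient `(2π)^{-d} ∫ φ(x) e^{-i⟨x,k⟩} dx` of a complex function. -/
noncomputable def fcoef (φ : (Fin d → ℝ) → ℂ) (k : Fin d → ℤ) : ℂ :=
  ∫ x, φ x * expMode (-k) x ∂cellMeasure d

theorem fourierCoefficient_eq_fcoef (φ : (Fin d → ℝ) → ℝ) :
    fourierCoefficient φ = fcoef fun x => (φ x : ℂ) := by
  funext k
  rw [fcoef, integral_cellMeasure, fourierCoefficient]
  congr 1
  refine integral_congr_ae (Eventually.of_forall fun x => ?_)
  simp only [expMode, pairing_neg_right]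
  push_cast
  rw [mul_neg]

theorem Continuous.integrable_cellMeasure {E : Type*} [NormedAddCommGroup E]
    {φ : (Fin d → ℝ) → E} (h : Continuous φ) : Integrable φ (cellMeasure d) := by
  refine Integrable.smul_measure (h.integrableOn_Icc) ?_
  refine ENNReal.inv_ne_top.2 (pow_ne_zero _ ?_)
  simp [Real.pi_pos]

theorem integral_cell_exp (n : ℤ) :
    ∫ x in Set.Icc (0 : ℝ) (2 * Real.pi), Complex.exp (Complex.I * ((x * (n : ℝ) : ℝ) : ℂ))
      = if n = 0 then 2 * Real.pi else 0 := by
  rw [integral_Icc_eq_integral_Ioc, ← intervalIntegral.integral_of_le (by positivity)]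
  split_ifs with h
  · subst h
    simp
  · have hc : (Complex.I * n : ℂ) ≠ 0 := by
      simp [h]
    have h1 := integral_exp_mul_complex (a := 0) (b := 2 * Real.pi) hc
    have e : ∀ x : ℝ, Complex.exp (Complex.I * ((x * (n : ℝ) : ℝ) : ℂ))
        = Complex.exp (Complex.I * n * x) := fun x => by
      push_cast; ring_nf
    simp only [e]
    rw [h1]
    have h2 : Complex.exp (Complex.I * n * ((2 * Real.pi : ℝ) : ℂ)) = 1 := by
      rw [Complex.exp_eq_one_iff]
      exact ⟨n, by push_cast; ring⟩
    rw [h2]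
    simp

theorem integral_expMode (k : Fin d → ℤ) :
    ∫ x, expMode k x ∂cellMeasure d = if k = 0 then 1 else 0 := by
  rw [integral_cellMeasure]
  have h1 : ∀ x : Fin d → ℝ, expMode k x
      = ∏ i, Complex.exp (Complex.I * ((x i * ((k i : ℤ) : ℝ) : ℝ) : ℂ)) := by
    intro x
    rw [expMode, ← Complex.exp_sum, pairing]
    push_cast
    rw [Finset.mul_sum]
  have h2 : Set.Icc (0 : Fin d → ℝ) (fun _ => 2 * Real.pi)
      = Set.univ.pi fun _ => Set.Icc (0 : ℝ) (2 * Real.pi) := by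
    rw [Set.pi_univ_Icc]; rfl
  simp only [h1]
  rw [h2, volume_pi, Measure.restrict_pi_pi,
    integral_fintype_prod_eq_prod
      (f := fun i (y : ℝ) => Complex.exp (Complex.I * ((y * ((k i : ℤ) : ℝ) : ℝ) : ℂ)))]
  simp only [integral_cell_exp]
  split_ifs with h
  · subst h
    have hpi : (2 * Real.pi : ℂ) ^ d ≠ 0 := pow_ne_zero _ (by simp [Real.pi_ne_zero])
    simp only [Pi.zero_apply, if_true, Finset.prod_const, Finset.card_univ, Fintype.card_fin]
    push_cast
    exact inv_mul_cancel₀ hpi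
  · obtain ⟨i, hi⟩ : ∃ i, k i ≠ 0 := by
      by_contra! hcon
      exact h (funext hcon)
    rw [Finset.prod_eq_zero (Finset.mem_univ i) (by simp [hi]), mul_zero]

theorem fcoef_expMode (l k : Fin d → ℤ) : fcoef (expMode l) k = if k = l then 1 else 0 := by
  simp only [fcoef, ← expMode_add]
  rw [integral_expMode]
  congr 1
  rw [← sub_eq_add_neg, sub_eq_zero]
  exact propext eq_comm

theorem fcoef_add {φ ψ : (Fin d → ℝ) → ℂ} (hφ : Continuous φ) (hψ : Continuous ψ) :
    fcoef (fun x => φ x + ψ x) = fcoef φ + fcoef ψ := by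
  funext k
  simp only [fcoef, Pi.add_apply, add_mul]
  exact integral_add (Continuous.integrable_cellMeasure (hφ.mul (continuous_expMode _)))
    (Continuous.integrable_cellMeasure (hψ.mul (continuous_expMode _)))

theorem fcoef_sub {φ ψ : (Fin d → ℝ) → ℂ} (hφ : Continuous φ) (hψ : Continuous ψ) :
    fcoef (fun x => φ x - ψ x) = fcoef φ - fcoef ψ := by
  funext k
  simp only [fcoef, Pi.sub_apply, sub_mul]
  exact integral_sub (Continuous.integrable_cellMeasure (hφ.mul (continuous_expMode _)))
    (Continuous.integrable_cellMeasure (hψ.mul (continuous_expMode _)))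

theorem fcoef_conj (φ : (Fin d → ℝ) → ℂ) (k : Fin d → ℤ) :
    fcoef (fun x => (starRingEnd ℂ) (φ x)) k = (starRingEnd ℂ) (fcoef φ (-k)) := by
  rw [fcoef, fcoef, ← integral_conj]
  refine integral_congr_ae (Eventually.of_forall fun x => ?_)
  simp only [map_mul, neg_neg, expMode_neg]

theorem fcoef_ofReal_neg (φ : (Fin d → ℝ) → ℝ) (k : Fin d → ℤ) :
    fcoef (fun x => (φ x : ℂ)) (-k) = (starRingEnd ℂ) (fcoef (fun x => (φ x : ℂ)) k) := by
  have := fcoef_conj (fun x => (φ x : ℂ)) (-k)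
  simpa using this

/-- The sum `∑ c_k e^{i⟨x,k⟩}` of a Fourier series. -/
noncomputable def ser (c : (Fin d → ℤ) → ℂ) (x : Fin d → ℝ) : ℂ := ∑' k, c k * expMode k x

section ser

variable {a b c : (Fin d → ℤ) → ℂ}

theorem summable_ser (hc : Summable fun k => ‖c k‖) (x : Fin d → ℝ) :
    Summable fun k => c k * expMode k x := by
  refine Summable.of_norm ?_
  simpa using hc

theorem continuous_ser (hc : Summable fun k => ‖c k‖) : Continuous (ser c) := by
  refine continuous_tsum (fun k => continuous_const.mul (continuous_expMode k)) hc fun k x => ?_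
  simp

theorem norm_ser_le (hc : Summable fun k => ‖c k‖) (x : Fin d → ℝ) :
    ‖ser c x‖ ≤ ∑' k, ‖c k‖ := by
  have h : Summable fun k => ‖c k * expMode k x‖ := by simpa using hc
  refine (norm_tsum_le_tsum_norm h).trans_eq ?_
  simp

theorem ser_add (ha : Summable fun k => ‖a k‖) (hb : Summable fun k => ‖b k‖) (x : Fin d → ℝ) :
    ser (a + b) x = ser a x + ser b x := by
  rw [ser, ser, ser, ← (summable_ser ha x).tsum_add (summable_ser hb x)]
  exact tsum_congr fun k => by simp [add_mul]

theorem ser_sub (ha : Summable fun k => ‖a k‖) (hb : Summable fun k => ‖b k‖) (x : Fin d → ℝ) :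
    ser (a - b) x = ser a x - ser b x := by
  rw [ser, ser, ser, ← (summable_ser ha x).tsum_sub (summable_ser hb x)]
  exact tsum_congr fun k => by simp [sub_mul]

theorem ser_smul (z : ℂ) (x : Fin d → ℝ) : ser (z • c) x = z * ser c x := by
  rw [ser, ser, ← tsum_mul_left]
  exact tsum_congr fun k => by simp [mul_assoc]

/-- The Fourier coefficients of the product with an absolutely convergent Fourier series. -/
theorem fcoef_ser_mul {φ : (Fin d → ℝ) → ℂ} (hφ : Continuous φ) (hc : Summable fun k => ‖c k‖) :
    fcoef (fun x => ser c x * φ x) = conv c (fcoef φ) := by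
  funext k
  have hcont : ∀ l, Continuous fun x => c l * expMode l x * (φ x * expMode (-k) x) := fun l =>
    (continuous_const.mul (continuous_expMode l)).mul (hφ.mul (continuous_expMode _))
  have hn : ∀ l x, ‖c l * expMode l x * (φ x * expMode (-k) x)‖ = ‖c l‖ * ‖φ x‖ := by
    intro l x; simp
  have h := hasSum_integral_of_summable_integral_norm (μ := cellMeasure d)
    (F := fun l x => c l * expMode l x * (φ x * expMode (-k) x))
    (fun l => Continuous.integrable_cellMeasure (hcont l)) (by
      simp only [hn]
      simp_rw [integral_const_mul]
      exact hc.mul_right _)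
  have e : ∀ l, ∫ x, c l * expMode l x * (φ x * expMode (-k) x) ∂cellMeasure d
      = c l * fcoef φ (k - l) := by
    intro l
    rw [fcoef, ← integral_const_mul]
    refine integral_congr_ae (Eventually.of_forall fun x => ?_)
    have : expMode (-(k - l)) x = expMode l x * expMode (-k) x := by
      rw [← expMode_add]; congr 1; abel
    simp only [this]
    ring
  rw [conv, ← tsum_congr e, h.tsum_eq, fcoef]
  refine integral_congr_ae (Eventually.of_forall fun x => ?_)
  simp only [ser]
  rw [tsum_mul_right, mul_assoc]

theorem fcoef_ser (hc : Summable fun k => ‖c k‖) : fcoef (ser c) = c := by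
  have h := fcoef_ser_mul (φ := fun _ => 1) continuous_const hc
  simp only [mul_one] at h
  rw [h]
  funext k
  have h0 : ∀ m : Fin d → ℤ, fcoef (fun _ => (1 : ℂ)) m = if m = 0 then 1 else 0 := by
    intro m
    have := fcoef_expMode (0 : Fin d → ℤ) m
    rw [← this]
    congr 1
    funext x
    simp
  rw [conv, tsum_eq_single k]
  · simp [h0]
  · intro l hl
    rw [h0, if_neg (sub_ne_zero.2 hl.symm), mul_zero]

theorem summable_norm_conv_prod (ha : Summable fun k => ‖a k‖) (hb : Summable fun k => ‖b k‖) :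
    Summable fun p : (Fin d → ℤ) × (Fin d → ℤ) => ‖a p.2 * b (p.1 - p.2)‖ := by
  have h := ha.mul_norm hb
  let e : (Fin d → ℤ) × (Fin d → ℤ) ≃ (Fin d → ℤ) × (Fin d → ℤ) :=
    { toFun := fun p => (p.2, p.1 - p.2)
      invFun := fun q => (q.1 + q.2, q.1)
      left_inv := fun p => by simp
      right_inv := fun q => by simp }
  exact (e.summable_iff.2 h)

theorem ser_conv (ha : Summable fun k => ‖a k‖) (hb : Summable fun k => ‖b k‖) :
    ser (conv a b) = fun x => ser a x * ser b x := by
  funext x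
  have ha' : Summable fun k => ‖a k * expMode k x‖ := by simpa using ha
  have hb' : Summable fun k => ‖b k * expMode k x‖ := by simpa using hb
  have hs := summable_norm_conv_prod ha' hb'
  rw [ser, ser, ser, tsum_mul_tsum_of_summable_norm ha' hb']
  let e : (Fin d → ℤ) × (Fin d → ℤ) ≃ (Fin d → ℤ) × (Fin d → ℤ) :=
    { toFun := fun p => (p.2, p.1 - p.2)
      invFun := fun q => (q.1 + q.2, q.1)
      left_inv := fun p => by simp
      right_inv := fun q => by simp }
  rw [← e.tsum_eq]
  refine Eq.trans ?_ hs.of_norm.tsum_prod.symm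
  refine tsum_congr fun k => ?_
  rw [conv, ← tsum_mul_right]
  refine tsum_congr fun l => ?_
  change _ = a l * expMode l x * (b (k - l) * expMode (k - l) x)
  have : expMode k x = expMode l x * expMode (k - l) x := by
    rw [← expMode_add]; congr 1; abel
  rw [this]
  ring

end ser

theorem sqNorm_zero_exp (c : (Fin d → ℤ) → ℂ) : sqNorm 0 c = ∑' k, ‖c k‖ₑ ^ 2 := by
  simp [sqNorm]

theorem memLp_two_of_continuous {φ : (Fin d → ℝ) → ℂ} (hφ : Continuous φ) :
    MemLp φ 2 (cellMeasure d) := by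
  rw [memLp_two_iff_integrable_sq_norm hφ.aestronglyMeasurable]
  exact Continuous.integrable_cellMeasure (hφ.norm.pow 2)

/-- Bessel's inequality. -/
theorem sqNorm_fcoef_le {φ : (Fin d → ℝ) → ℂ} (hφ : Continuous φ) :
    sqNorm 0 (fcoef φ) ≤ ∫⁻ x, ‖φ x‖ₑ ^ 2 ∂cellMeasure d := by
  have hm : ∀ k : Fin d → ℤ, MemLp (expMode k) 2 (cellMeasure d) := fun k =>
    memLp_two_of_continuous (continuous_expMode k)
  set v : (Fin d → ℤ) → Lp ℂ 2 (cellMeasure d) := fun k => (hm k).toLp _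
  have hinner : ∀ (k : Fin d → ℤ) (ψ : (Fin d → ℝ) → ℂ) (hψ : MemLp ψ 2 (cellMeasure d)),
      inner ℂ (v k) (hψ.toLp ψ) = fcoef ψ k := by
    intro k ψ hψ
    rw [L2.inner_def, fcoef]
    refine integral_congr_ae ?_
    filter_upwards [(hm k).coeFn_toLp, hψ.coeFn_toLp] with x h1 h2
    rw [h1, h2, expMode_neg]
    simp
  have hv : Orthonormal ℂ v := by
    rw [orthonormal_iff_ite]
    intro i j
    rw [hinner, fcoef_expMode]
  have hφ2 := memLp_two_of_continuous hφ
  have hnorm : ENNReal.ofReal (‖hφ2.toLp φ‖ ^ 2) = ∫⁻ x, ‖φ x‖ₑ ^ 2 ∂cellMeasure d := by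
    rw [ENNReal.ofReal_pow (norm_nonneg _), Lp.norm_toLp, ENNReal.ofReal_toReal hφ2.2.ne,
      eLpNorm_eq_lintegral_rpow_enorm_toReal (by norm_num) (by norm_num), ← ENNReal.rpow_natCast,
      ← ENNReal.rpow_mul]
    norm_num
  rw [sqNorm_zero_exp, ENNReal.tsum_eq_iSup_sum, ← hnorm]
  refine iSup_le fun F => ?_
  have h := hv.sum_inner_products_le (hφ2.toLp φ) (s := F)
  simp only [hinner] at h
  refine le_trans (le_of_eq ?_) (ENNReal.ofReal_le_ofReal h)
  rw [ENNReal.ofReal_sum_of_nonneg fun i _ => sq_nonneg _]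
  refine Finset.sum_congr rfl fun k _ => ?_
  rw [ENNReal.ofReal_pow (norm_nonneg _), ofReal_norm]

/-- Parseval's identity for absolutely convergent series. -/
theorem lintegral_ser_sq {c : (Fin d → ℤ) → ℂ} (hc : Summable fun k => ‖c k‖) :
    ∫⁻ x, ‖ser c x‖ₑ ^ 2 ∂cellMeasure d = sqNorm 0 c := by
  have hcont := continuous_ser hc
  have h1 : fcoef (fun x => ser c x * (starRingEnd ℂ) (ser c x)) 0
      = ∑' k, ((‖c k‖ ^ 2 : ℝ) : ℂ) := by
    rw [fcoef_ser_mul (φ := fun x => (starRingEnd ℂ) (ser c x))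
      (Complex.continuous_conj.comp hcont) hc, conv]
    refine tsum_congr fun l => ?_
    have := fcoef_conj (ser c) (0 - l)
    rw [this, fcoef_ser hc]
    simp [Complex.mul_conj, Complex.normSq_eq_norm_sq]
  have h2 : fcoef (fun x => ser c x * (starRingEnd ℂ) (ser c x)) 0
      = ((∫ x, ‖ser c x‖ ^ 2 ∂cellMeasure d : ℝ) : ℂ) := by
    rw [fcoef, ← integral_complex_ofReal]
    refine integral_congr_ae (Eventually.of_forall fun x => ?_)
    simp [Complex.mul_conj, Complex.normSq_eq_norm_sq]
  rw [h1, ← Complex.ofReal_tsum] at h2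
  have h3 : ∑' k, ‖c k‖ ^ 2 = ∫ x, ‖ser c x‖ ^ 2 ∂cellMeasure d := by exact_mod_cast h2
  have hs : Summable fun k => ‖c k‖ ^ 2 := by
    refine Summable.of_norm_bounded_eventually hc ?_
    have := hc.tendsto_cofinite_zero.eventually (gt_mem_nhds one_pos)
    filter_upwards [this] with k hk
    rw [Real.norm_of_nonneg (sq_nonneg _)]
    nlinarith [norm_nonneg (c k)]
  have e : ∀ z : ℂ, ‖z‖ₑ ^ 2 = ENNReal.ofReal (‖z‖ ^ 2) := fun z => by
    rw [ENNReal.ofReal_pow (norm_nonneg _), ofReal_norm]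
  rw [sqNorm_zero_exp]
  simp only [e]
  rw [← ENNReal.ofReal_tsum_of_nonneg (fun _ => sq_nonneg _) hs, h3,
    ofReal_integral_eq_lintegral_ofReal (f := fun x => ‖ser c x‖ ^ 2)
      (Continuous.integrable_cellMeasure (hcont.norm.pow 2))
      (Eventually.of_forall fun _ => sq_nonneg _)]

/-- Multiplication by a bounded function is bounded in `L²`. -/
theorem sqNorm_zero_fcoef_mul_le {c : (Fin d → ℤ) → ℂ} (hc : Summable fun k => ‖c k‖)
    {φ : (Fin d → ℝ) → ℂ} (hφ : Continuous φ) {M : ℝ} (hM : ∀ x, ‖φ x‖ ≤ M) :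
    sqNorm 0 (fcoef fun x => ser c x * φ x) ≤ ENNReal.ofReal (M ^ 2) * sqNorm 0 c := by
  refine (sqNorm_fcoef_le ((continuous_ser hc).mul hφ)).trans ?_
  rw [← lintegral_ser_sq hc, ← lintegral_const_mul' _ _ ENNReal.ofReal_ne_top]
  refine lintegral_mono fun x => ?_
  rw [Pi.mul_apply, enorm_mul, mul_pow, mul_comm]
  gcongr
  rw [← ofReal_norm, ← ENNReal.ofReal_pow (norm_nonneg _)]
  refine ENNReal.ofReal_le_ofReal ?_
  gcongr
  exact hM x

theorem sqNorm_zero_fcoef_le_of_bound {φ : (Fin d → ℝ) → ℂ} (hφ : Continuous φ) {M : ℝ}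
    (hM : ∀ x, ‖φ x‖ ≤ M) : sqNorm 0 (fcoef φ) ≤ ENNReal.ofReal (M ^ 2) := by
  refine (sqNorm_fcoef_le hφ).trans ?_
  have : ∀ x, ‖φ x‖ₑ ^ 2 ≤ ENNReal.ofReal (M ^ 2) := fun x => by
    rw [← ofReal_norm, ← ENNReal.ofReal_pow (norm_nonneg _)]
    refine ENNReal.ofReal_le_ofReal ?_
    gcongr
    exact hM x
  refine (lintegral_mono this).trans ?_
  simp

/-! ### The Sobolev spaces: embeddings, convergence, products -/

namespace Sobolev

variable {r r' s : ℝ}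

/-- Dominated convergence in `H^r`, coefficient by coefficient. -/
theorem tendsto_of_dominated {ι : Type*} {l : Filter ι} {u : ι → Sobolev d r} {v : Sobolev d r}
    {b : (Fin d → ℤ) → ℝ} (hb : Summable b)
    (hlim : ∀ k, Tendsto (fun i => coeff (u i) k) l (𝓝 (coeff v k)))
    (hdom : ∀ᶠ i in l, ∀ k, (1 + freqSq k) ^ r * ‖coeff (u i) k - coeff v k‖ ^ 2 ≤ b k) :
    Tendsto u l (𝓝 v) := by
  rw [tendsto_iff_norm_sub_tendsto_zero]
  have h2 : Tendsto (fun i => ‖u i - v‖ ^ 2) l (𝓝 0) := by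
    simp only [norm_sq_eq]
    have := tendsto_tsum_of_dominated_convergence (𝓕 := l)
      (f := fun i k => (1 + freqSq k) ^ r * ‖coeff (u i - v) k‖ ^ 2) (g := fun _ => (0 : ℝ))
      hb (fun k => ?_) ?_
    · simpa using this
    · have h1 : Tendsto (fun i => coeff (u i) k - coeff v k) l (𝓝 0) := by
        simpa using (hlim k).sub_const (coeff v k)
      have h2 := (h1.norm.pow 2).const_mul ((1 + freqSq k) ^ r)
      simpa using h2
    · filter_upwards [hdom] with i hi k
      rw [Real.norm_of_nonneg (sobolev_term_nonneg r _ k)]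
      simpa using hi k
  have h3 := h2.sqrt
  simpa [Real.sqrt_sq (norm_nonneg _)] using h3

theorem norm_coeff_le (u : Sobolev d r) (k : Fin d → ℤ) :
    (1 + freqSq k) ^ r * ‖coeff u k‖ ^ 2 ≤ ‖u‖ ^ 2 := by
  rw [norm_sq_eq]
  exact (summable_coeff u).le_tsum k fun j _ => sobolev_term_nonneg r _ j

/-- The Fourier coefficients are continuous linear functionals. -/
noncomputable def coeffCLM (k : Fin d → ℤ) : Sobolev d r →L[ℝ] ℂ :=
  LinearMap.mkContinuous ((LinearMap.proj k).comp coeff)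
    (Real.sqrt ((1 + freqSq k) ^ (-r))) (by
      intro u
      have h := norm_coeff_le u k
      have hp := Real.rpow_pos_of_pos (one_add_freqSq_pos k) r
      rw [← Real.sqrt_sq (norm_nonneg u), ← Real.sqrt_mul (Real.rpow_nonneg
        (one_add_freqSq_pos k).le _)]
      refine Real.le_sqrt_of_sq_le ?_
      rw [Real.rpow_neg (one_add_freqSq_pos k).le, le_inv_mul_iff₀ hp]
      exact h)

theorem continuous_coeff (k : Fin d → ℤ) : Continuous fun u : Sobolev d r => coeff u k :=
  (coeffCLM k).continuous

instance : CompleteSpace (Sobolev d r) := by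
  have hiso : Isometry (toLp : Sobolev d r → lp (fun _ : Fin d → ℤ => ℂ) 2) :=
    AddMonoidHomClass.isometry_of_norm _ fun _ => rfl
  refine (completeSpace_iff_isComplete_range hiso.isUniformInducing).2 ?_
  have hr : Set.range (toLp : Sobolev d r → lp (fun _ : Fin d → ℤ => ℂ) 2)
      = ⋂ k : Fin d → ℤ, {x | x (-k) = (starRingEnd ℂ) (x k)} := by
    ext x
    simp only [Set.mem_range, Set.mem_iInter, Set.mem_ofPred_eq]
    have hneg : ∀ k : Fin d → ℤ, weight r (-k) = weight r k := fun k => by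
      simp [weight, freqSq]
    constructor
    · rintro ⟨u, rfl⟩ k
      change (weight r (-k) : ℂ) * coeff u (-k) = (starRingEnd ℂ) ((weight r k : ℂ) * coeff u k)
      rw [coeff_neg, hneg]
      simp
    · intro hx
      have hw : weighted r (fun k => ((weight r k : ℂ))⁻¹ * x k) = x := by
        funext k
        change (weight r k : ℂ) * (((weight r k : ℂ))⁻¹ * x k) = x k
        rw [mul_inv_cancel_left₀]
        exact Complex.ofReal_ne_zero.2 (weight_pos r k).ne'
      refine ⟨⟨fun k => ((weight r k : ℂ))⁻¹ * x k, fun k => ?_, ?_⟩, ?_⟩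
      · simp [hx k, hneg]
      · rw [hw]; exact lp.memℓp x
      · exact Subtype.ext hw
  rw [hr]
  refine IsClosed.isComplete (isClosed_iInter fun k => ?_)
  have hev : ∀ k : Fin d → ℤ, Continuous fun x : lp (fun _ : Fin d → ℤ => ℂ) 2 => x k := fun k =>
    (lp.uniformContinuous_coe.continuous).comp' continuous_id |> (continuous_apply k).comp
  exact isClosed_eq (hev (-k)) (Complex.continuous_conj.comp (hev k))

/-- The linear map underlying the embedding `H^r ⊂ H^{r'}` for `r' ≤ r`. -/
noncomputable def inclLin (h : r' ≤ r) : Sobolev d r →ₗ[ℝ] Sobolev d r' where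
  toFun u := ofCoeff (coeff u) (coeff_neg u)
    (ne_top_of_le_ne_top (sqNorm_coeff_ne_top u) (sqNorm_mono_exp h (coeff u)))
  map_add' u v := by
    apply coeff_injective
    simp only [coeff_ofCoeff, map_add]
  map_smul' a u := by
    apply coeff_injective
    simp only [coeff_ofCoeff, map_smul, RingHom.id_apply]

theorem coeff_inclLin (h : r' ≤ r) (u : Sobolev d r) : coeff (inclLin h u) = coeff u :=
  coeff_ofCoeff (coeff u) (coeff_neg u)
    (ne_top_of_le_ne_top (sqNorm_coeff_ne_top u) (sqNorm_mono_exp h (coeff u)))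

theorem norm_inclLin_le (h : r' ≤ r) (u : Sobolev d r) : ‖inclLin h u‖ ≤ ‖u‖ := by
  refine norm_le_of_sqNorm_le (norm_nonneg _) ?_
  rw [← sqNorm_coeff_eq_ofReal, coeff_inclLin]
  exact sqNorm_mono_exp h (coeff u)

/-- The embedding `H^r ⊂ H^{r'}` for `r' ≤ r`. -/
noncomputable def incl (h : r' ≤ r) : Sobolev d r →L[ℝ] Sobolev d r' :=
  LinearMap.mkContinuous (inclLin h) 1 fun u => by
    rw [one_mul]
    exact norm_inclLin_le h u

@[simp] theorem coeff_incl (h : r' ≤ r) (u : Sobolev d r) : coeff (incl h u) = coeff u := by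
  rw [incl, LinearMap.mkContinuous_apply, coeff_inclLin]

theorem norm_incl_le (h : r' ≤ r) (u : Sobolev d r) : ‖incl h u‖ ≤ ‖u‖ := by
  rw [incl, LinearMap.mkContinuous_apply]
  exact norm_inclLin_le h u

section Embedding

variable (d) in
/-- The constant of the embedding of `H^s` into the space of absolutely convergent Fourier
series. -/
noncomputable def embConst (s : ℝ) : ℝ :=
  Real.sqrt (∑' k : Fin d → ℤ, ENNReal.ofReal ((1 + freqSq k) ^ (-s))).toReal

theorem embConst_nonneg : 0 ≤ embConst d s := Real.sqrt_nonneg _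

theorem tsum_enorm_coeff_le (hs : (d : ℝ) / 2 < s) (u : Sobolev d s) :
    ∑' k, ‖coeff u k‖ₑ ≤ ENNReal.ofReal (embConst d s * ‖u‖) := by
  have h := tsum_enorm_sq_le s (coeff u)
  have ht := tsum_one_add_freqSq_rpow_ne_top hs
  rw [sqNorm_coeff_eq_ofReal, ← ENNReal.ofReal_toReal ht, ← ENNReal.ofReal_mul
    ENNReal.toReal_nonneg] at h
  rw [← ENNReal.pow_le_pow_left_iff (n := 2) two_ne_zero, ← ENNReal.ofReal_pow
    (mul_nonneg embConst_nonneg (norm_nonneg _))]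
  convert h using 2
  rw [mul_pow, embConst, Real.sq_sqrt ENNReal.toReal_nonneg]

theorem summable_norm_coeff (hs : (d : ℝ) / 2 < s) (u : Sobolev d s) :
    Summable fun k => ‖coeff u k‖ := by
  have h : ∑' k, ‖coeff u k‖ₑ ≠ ⊤ :=
    ne_top_of_le_ne_top ENNReal.ofReal_ne_top (tsum_enorm_coeff_le hs u)
  have := ENNReal.summable_toReal h
  simpa using this

theorem tsum_norm_coeff_le (hs : (d : ℝ) / 2 < s) (u : Sobolev d s) :
    ∑' k, ‖coeff u k‖ ≤ embConst d s * ‖u‖ := by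
  have h := tsum_enorm_coeff_le hs u
  rw [← ENNReal.ofReal_le_ofReal_iff (mul_nonneg embConst_nonneg (norm_nonneg _)),
    ENNReal.ofReal_tsum_of_nonneg (fun _ => norm_nonneg _) (summable_norm_coeff hs u)]
  simpa using h

theorem toFun_eq_re (u : Sobolev d s) (x : Fin d → ℝ) : toFun u x = (ser (coeff u) x).re := rfl

theorem ser_coeff_eq (u : Sobolev d s) (x : Fin d → ℝ) : ser (coeff u) x = (toFun u x : ℂ) := by
  have : (starRingEnd ℂ) (ser (coeff u) x) = ser (coeff u) x := by
    rw [ser, Complex.conj_tsum, ← (Equiv.neg _).tsum_eq]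
    refine tsum_congr fun k => ?_
    simp only [Equiv.neg_apply, map_mul, coeff_neg, Complex.conj_conj, expMode_neg]
  rw [toFun_eq_re]
  exact (Complex.conj_eq_iff_re.1 this).symm

theorem fourierCoefficient_toFun (hs : (d : ℝ) / 2 < s) (u : Sobolev d s) :
    fourierCoefficient (toFun u) = coeff u := by
  rw [fourierCoefficient_eq_fcoef]
  simp only [← ser_coeff_eq]
  exact fcoef_ser (summable_norm_coeff hs u)

theorem toFun_injective (hs : (d : ℝ) / 2 < s) :
    Function.Injective (toFun : Sobolev d s → _) := by
  intro u v h
  apply coeff_injective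
  rw [← fourierCoefficient_toFun hs, h, fourierCoefficient_toFun hs]

theorem continuous_toFun (hs : (d : ℝ) / 2 < s) (u : Sobolev d s) : Continuous (toFun u) :=
  Complex.continuous_re.comp (continuous_ser (summable_norm_coeff hs u))

theorem abs_toFun_le (hs : (d : ℝ) / 2 < s) (u : Sobolev d s) (x : Fin d → ℝ) :
    |toFun u x| ≤ embConst d s * ‖u‖ :=
  (Complex.abs_re_le_norm _).trans
    ((norm_ser_le (summable_norm_coeff hs u) x).trans (tsum_norm_coeff_le hs u))

theorem toFun_add (hs : (d : ℝ) / 2 < s) (u v : Sobolev d s) (x : Fin d → ℝ) :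
    toFun (u + v) x = toFun u x + toFun v x := by
  simp only [toFun_eq_re, map_add]
  rw [ser_add (summable_norm_coeff hs u) (summable_norm_coeff hs v), Complex.add_re]

theorem toFun_sub (hs : (d : ℝ) / 2 < s) (u v : Sobolev d s) (x : Fin d → ℝ) :
    toFun (u - v) x = toFun u x - toFun v x := by
  simp only [toFun_eq_re, map_sub]
  rw [ser_sub (summable_norm_coeff hs u) (summable_norm_coeff hs v), Complex.sub_re]

theorem toFun_smul (a : ℝ) (u : Sobolev d s) (x : Fin d → ℝ) :
    toFun (a • u) x = a * toFun u x := by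
  have : coeff (a • u) = (a : ℂ) • coeff u := by
    funext k; simp
  rw [toFun_eq_re, this, ser_smul, toFun_eq_re]
  simp

@[simp] theorem toFun_zero (x : Fin d → ℝ) : toFun (0 : Sobolev d s) x = 0 := by
  simp [toFun_eq_re, ser]

theorem sqNorm_conv_ne_top (hs : (d : ℝ) / 2 < s) (u v : Sobolev d s) :
    sqNorm s (conv (coeff u) (coeff v)) ≠ ⊤ := by
  have h0 : (0 : ℝ) ≤ (d : ℝ) / 2 := by positivity
  obtain ⟨C, -, hC⟩ := exists_sqNorm_conv_le (d := d) (c := s) (a := s) (b := s) (by linarith)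
    le_rfl le_rfl (by linarith)
  exact ne_top_of_le_ne_top (ENNReal.mul_ne_top ENNReal.ofReal_ne_top
    (ENNReal.mul_ne_top (sqNorm_coeff_ne_top u) (sqNorm_coeff_ne_top v))) (hC _ _)

theorem conv_coeff_neg (u v : Sobolev d s) (k : Fin d → ℤ) :
    conv (coeff u) (coeff v) (-k) = (starRingEnd ℂ) (conv (coeff u) (coeff v) k) := by
  rw [conv, conv, Complex.conj_tsum, ← (Equiv.neg _).tsum_eq]
  refine tsum_congr fun l => ?_
  have : -k - -l = -(k - l) := by abel
  simp only [Equiv.neg_apply, map_mul, coeff_neg, this]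

/-- The product of two elements of `H^s`, `s > d/2`. -/
noncomputable def mul (hs : (d : ℝ) / 2 < s) (u v : Sobolev d s) : Sobolev d s :=
  ofCoeff (conv (coeff u) (coeff v)) (conv_coeff_neg u v) (sqNorm_conv_ne_top hs u v)

theorem toFun_mul (hs : (d : ℝ) / 2 < s) (u v : Sobolev d s) (x : Fin d → ℝ) :
    toFun (mul hs u v) x = toFun u x * toFun v x := by
  have h := congrFun (ser_conv (summable_norm_coeff hs u) (summable_norm_coeff hs v)) x
  have e : coeff (mul hs u v) = conv (coeff u) (coeff v) := rfl
  rw [← e] at h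
  simp only [ser_coeff_eq] at h
  exact_mod_cast h

/-- `H^s` is an algebra for `s > d/2`: pointwise multiplication is bounded. -/
theorem exists_norm_mul_le (hs : (d : ℝ) / 2 < s) :
    ∃ K : ℝ, 0 ≤ K ∧ ∀ u v : Sobolev d s, ‖mul hs u v‖ ≤ K * ‖u‖ * ‖v‖ := by
  have h0 : (0 : ℝ) ≤ (d : ℝ) / 2 := by positivity
  obtain ⟨C, hC0, hC⟩ := exists_sqNorm_conv_le (d := d) (c := s) (a := s) (b := s) (by linarith)
    le_rfl le_rfl (by linarith)
  refine ⟨Real.sqrt C, Real.sqrt_nonneg _, fun u v => ?_⟩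
  refine norm_le_of_sqNorm_le (by positivity) ((hC _ _).trans_eq ?_)
  rw [sqNorm_coeff_eq_ofReal, sqNorm_coeff_eq_ofReal, ← ENNReal.ofReal_mul (sq_nonneg _),
    ← ENNReal.ofReal_mul hC0, mul_pow, mul_pow, Real.sq_sqrt hC0, mul_assoc]

end Embedding

end Sobolev

/-! ### Trigonometric polynomials and powers -/

namespace Sobolev

variable {r s : ℝ}

/-- The function `cos⟨x,k⟩` as an element of `H^r`. -/
noncomputable def cosMode (r : ℝ) (k : Fin d → ℤ) : Sobolev d r :=
  ofCoeff (fun m => ((if m = k then 1 else 0) + (if m = -k then 1 else 0)) / 2)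
    (fun m => by
      have h1 : (-m = k) = (m = -k) := propext neg_eq_iff_eq_neg
      have h2 : (-m = -k) = (m = k) := propext neg_inj
      simp only [h1, h2, map_div₀, map_add, apply_ite (starRingEnd ℂ), map_one, map_zero,
        Complex.conj_ofNat]
      rw [add_comm])
    (sqNorm_ne_top_of_finite (Set.Finite.subset (Set.toFinite {k, -k}) fun m hm => by
      by_contra hcon
      simp only [Set.mem_insert_iff, Set.mem_singleton_iff, not_or] at hcon
      simp [hcon.1, hcon.2] at hm))

/-- The function `sin⟨x,k⟩` as an element of `H^r`. -/
noncomputable def sinMode (r : ℝ) (k : Fin d → ℤ) : Sobolev d r :=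
  ofCoeff (fun m => ((if m = k then 1 else 0) - (if m = -k then 1 else 0)) / (2 * Complex.I))
    (fun m => by
      have h1 : (-m = k) = (m = -k) := propext neg_eq_iff_eq_neg
      have h2 : (-m = -k) = (m = k) := propext neg_inj
      simp only [h1, h2, map_div₀, map_sub, apply_ite (starRingEnd ℂ), map_one, map_zero,
        Complex.conj_ofNat, map_mul, Complex.conj_I]
      rw [mul_neg, div_neg, ← neg_div, neg_sub])
    (sqNorm_ne_top_of_finite (Set.Finite.subset (Set.toFinite {k, -k}) fun m hm => by
      by_contra hcon
      simp only [Set.mem_insert_iff, Set.mem_singleton_iff, not_or] at hcon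
      simp [hcon.1, hcon.2] at hm))

theorem coeff_cosMode (k m : Fin d → ℤ) : coeff (cosMode r k) m
    = ((if m = k then 1 else 0) + (if m = -k then 1 else 0)) / 2 := by
  rw [cosMode, coeff_ofCoeff]

theorem coeff_sinMode (k m : Fin d → ℤ) : coeff (sinMode r k) m
    = ((if m = k then 1 else 0) - (if m = -k then 1 else 0)) / (2 * Complex.I) := by
  rw [sinMode, coeff_ofCoeff]

theorem cos_eq_expMode (x : Fin d → ℝ) (k : Fin d → ℤ) :
    (Real.cos (pairing x k) : ℂ) = (expMode k x + expMode (-k) x) / 2 := by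
  rw [Complex.ofReal_cos, Complex.cos, expMode, expMode, pairing_neg_right]
  push_cast
  ring_nf

theorem sin_eq_expMode (x : Fin d → ℝ) (k : Fin d → ℤ) :
    (Real.sin (pairing x k) : ℂ) = (expMode k x - expMode (-k) x) / (2 * Complex.I) := by
  rw [Complex.ofReal_sin, Complex.sin, expMode, expMode, pairing_neg_right]
  field_simp
  push_cast
  rw [Complex.I_sq]
  ring_nf

theorem ser_ite (k : Fin d → ℤ) (x : Fin d → ℝ) :
    ser (fun m => if m = k then 1 else 0) x = expMode k x := by
  rw [ser, tsum_eq_single k]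
  · simp
  · intro m hm; simp [hm]

theorem summable_norm_ite (k : Fin d → ℤ) :
    Summable fun m : Fin d → ℤ => ‖(if m = k then 1 else 0 : ℂ)‖ :=
  summable_of_ne_finset_zero (s := {k}) fun m hm => by
    have : m ≠ k := by simpa using hm
    simp [this]

theorem toFun_cosMode (k : Fin d → ℤ) (x : Fin d → ℝ) :
    toFun (cosMode r k) x = Real.cos (pairing x k) := by
  have h : coeff (cosMode r k) = (1 / 2 : ℂ) • ((fun m : Fin d → ℤ => if m = k then (1 : ℂ) else 0)
      + fun m => if m = -k then 1 else 0) := by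
    funext m
    rw [coeff_cosMode, Pi.smul_apply, Pi.add_apply, smul_eq_mul]
    ring
  have : (toFun (cosMode r k) x : ℂ) = (Real.cos (pairing x k) : ℂ) := by
    rw [← ser_coeff_eq, h, ser_smul, ser_add (summable_norm_ite k) (summable_norm_ite (-k)),
      ser_ite, ser_ite, cos_eq_expMode]
    ring
  exact_mod_cast this

theorem toFun_sinMode (k : Fin d → ℤ) (x : Fin d → ℝ) :
    toFun (sinMode r k) x = Real.sin (pairing x k) := by
  have h : coeff (sinMode r k)
      = (1 / (2 * Complex.I) : ℂ) • ((fun m : Fin d → ℤ => if m = k then (1 : ℂ) else 0)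
      - fun m => if m = -k then 1 else 0) := by
    funext m
    rw [coeff_sinMode, Pi.smul_apply, Pi.sub_apply, smul_eq_mul]
    ring
  have : (toFun (sinMode r k) x : ℂ) = (Real.sin (pairing x k) : ℂ) := by
    rw [← ser_coeff_eq, h, ser_smul, ser_sub (summable_norm_ite k) (summable_norm_ite (-k)),
      ser_ite, ser_ite, sin_eq_expMode]
    ring
  exact_mod_cast this

theorem coeff_cosMode_eq_fourierCoefficient (k : Fin d → ℤ) :
    coeff (cosMode r k) = fourierCoefficient fun x => Real.cos (pairing x k) := by
  have hs : (d : ℝ) / 2 < (d : ℝ) / 2 + 1 := by linarith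
  have h : coeff (cosMode r k) = coeff (cosMode ((d : ℝ) / 2 + 1) k) := by
    funext m; rw [coeff_cosMode, coeff_cosMode]
  rw [h, ← fourierCoefficient_toFun hs]
  congr 1
  funext x
  exact toFun_cosMode k x

theorem coeff_sinMode_eq_fourierCoefficient (k : Fin d → ℤ) :
    coeff (sinMode r k) = fourierCoefficient fun x => Real.sin (pairing x k) := by
  have hs : (d : ℝ) / 2 < (d : ℝ) / 2 + 1 := by linarith
  have h : coeff (sinMode r k) = coeff (sinMode ((d : ℝ) / 2 + 1) k) := by
    funext m; rw [coeff_sinMode, coeff_sinMode]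
  rw [h, ← fourierCoefficient_toFun hs]
  congr 1
  funext x
  exact toFun_sinMode k x

/-- A trigonometric polynomial: finitely many nonzero Fourier coefficients. -/
def IsTrig (u : Sobolev d r) : Prop := (coeff u).support.Finite

theorem IsTrig.add {u v : Sobolev d r} (hu : IsTrig u) (hv : IsTrig v) : IsTrig (u + v) := by
  refine (hu.union hv).subset ?_
  rw [map_add]
  exact Function.support_add _ _

theorem IsTrig.smul {u : Sobolev d r} (a : ℝ) (hu : IsTrig u) : IsTrig (a • u) := by
  refine hu.subset fun k hk => ?_
  rw [map_smul] at hk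
  simp only [Function.mem_support, Pi.smul_apply] at hk ⊢
  intro h0
  simp [h0] at hk

theorem isTrig_zero : IsTrig (0 : Sobolev d r) := by
  simp [IsTrig]

theorem IsTrig.neg {u : Sobolev d r} (hu : IsTrig u) : IsTrig (-u) := by
  simpa using hu.smul (-1)

theorem IsTrig.sub {u v : Sobolev d r} (hu : IsTrig u) (hv : IsTrig v) : IsTrig (u - v) := by
  rw [sub_eq_add_neg]
  exact hu.add hv.neg

theorem isTrig_cosMode (k : Fin d → ℤ) : IsTrig (cosMode r k) := by
  refine Set.Finite.subset (Set.toFinite {k, -k}) fun m hm => ?_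
  by_contra hcon
  simp only [Set.mem_insert_iff, Set.mem_singleton_iff, not_or] at hcon
  simp [coeff_cosMode, hcon.1, hcon.2] at hm

theorem isTrig_sinMode (k : Fin d → ℤ) : IsTrig (sinMode r k) := by
  refine Set.Finite.subset (Set.toFinite {k, -k}) fun m hm => ?_
  by_contra hcon
  simp only [Set.mem_insert_iff, Set.mem_singleton_iff, not_or] at hcon
  simp [coeff_sinMode, hcon.1, hcon.2] at hm

theorem IsTrig.summable {u : Sobolev d r} (hu : IsTrig u) : Summable fun k => ‖coeff u k‖ :=
  summable_of_ne_finset_zero (s := hu.toFinset) fun k hk => by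
    have : coeff u k = 0 := by
      by_contra hcon
      exact hk (hu.mem_toFinset.2 hcon)
    simp [this]

theorem IsTrig.mul {u v : Sobolev d s} (hs : (d : ℝ) / 2 < s) (hu : IsTrig u) (hv : IsTrig v) :
    IsTrig (mul hs u v) := by
  refine (Set.Finite.add hu hv).subset fun k hk => ?_
  have hk' : conv (coeff u) (coeff v) k ≠ 0 := hk
  rw [conv] at hk'
  obtain ⟨l, hl⟩ : ∃ l, coeff u l * coeff v (k - l) ≠ 0 := by
    by_contra! hcon
    exact hk' (by simp [hcon])
  exact ⟨l, left_ne_zero_of_mul hl, k - l, right_ne_zero_of_mul hl, by simp⟩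

theorem finite_abs_le (n : ℕ) : {k : Fin d → ℤ | ∀ i, |k i| ≤ (n : ℤ)}.Finite :=
  (Set.finite_Icc (fun _ => -(n : ℤ)) (fun _ => (n : ℤ))).subset fun _ hk =>
    ⟨fun i => (abs_le.1 (hk i)).1, fun i => (abs_le.1 (hk i)).2⟩

/-- Truncation of the Fourier series of `u` to the finite set `{|k_i| ≤ n}` of frequencies. -/
noncomputable def truncate (n : ℕ) (u : Sobolev d r) : Sobolev d r :=
  ofCoeff (fun k => if ∀ i, |k i| ≤ (n : ℤ) then coeff u k else 0)
    (fun k => by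
      simp only [Pi.neg_apply, abs_neg, coeff_neg]
      split_ifs <;> simp)
    (sqNorm_ne_top_of_finite ((finite_abs_le n).subset fun k hk => by
      by_contra hcon
      exact hk (if_neg hcon)))

theorem coeff_truncate (n : ℕ) (u : Sobolev d r) (k : Fin d → ℤ) : coeff (truncate n u) k
    = if ∀ i, |k i| ≤ (n : ℤ) then coeff u k else 0 := by
  rw [truncate, coeff_ofCoeff]

theorem isTrig_truncate (n : ℕ) (u : Sobolev d r) : IsTrig (truncate n u) := by
  refine (finite_abs_le n).subset fun k hk => ?_
  by_contra hcon
  exact hk ((coeff_truncate n u k).trans (if_neg hcon))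

theorem norm_truncate_le (n : ℕ) (u : Sobolev d r) : ‖truncate n u‖ ≤ ‖u‖ := by
  refine norm_le_of_sqNorm_le (norm_nonneg _) ?_
  rw [← sqNorm_coeff_eq_ofReal]
  refine sqNorm_mono fun k => ?_
  rw [coeff_truncate]
  split_ifs <;> simp

theorem truncate_sub (n : ℕ) (u v : Sobolev d r) :
    truncate n (u - v) = truncate n u - truncate n v := by
  ext k
  simp only [map_sub, Pi.sub_apply, coeff_truncate]
  split_ifs <;> simp

theorem tendsto_truncate (u : Sobolev d r) : Tendsto (fun n => truncate n u) atTop (𝓝 u) := by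
  refine tendsto_of_dominated (summable_coeff u) (fun k => ?_) (Eventually.of_forall fun n k => ?_)
  · refine tendsto_const_nhds.congr' ?_
    have : ∀ᶠ n : ℕ in atTop, ∀ i, |k i| ≤ (n : ℤ) := by
      rw [eventually_all]
      intro i
      filter_upwards [eventually_ge_atTop (k i).natAbs] with n hn
      rw [Int.abs_eq_natAbs]
      exact_mod_cast hn
    filter_upwards [this] with n hn
    rw [coeff_truncate, if_pos hn]
  · have hp := Real.rpow_nonneg (one_add_freqSq_pos k).le r
    rw [coeff_truncate]
    gcongr
    split_ifs <;> simp

/-- The powers of an element of `H^s`, `s > d/2`. -/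
noncomputable def pow (hs : (d : ℝ) / 2 < s) : ℕ → Sobolev d s → Sobolev d s
  | 0, _ => cosMode s 0
  | n + 1, u => mul hs u (pow hs n u)

theorem toFun_one (x : Fin d → ℝ) : toFun (cosMode s 0) x = 1 := by
  rw [toFun_cosMode]; simp

theorem toFun_pow (hs : (d : ℝ) / 2 < s) (n : ℕ) (u : Sobolev d s) (x : Fin d → ℝ) :
    toFun (pow hs n u) x = toFun u x ^ n := by
  induction n with
  | zero => rw [pow, toFun_one, pow_zero]
  | succ n ih => rw [pow, toFun_mul, ih, pow_succ']

theorem IsTrig.pow {u : Sobolev d s} (hs : (d : ℝ) / 2 < s) (hu : IsTrig u) (n : ℕ) :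
    IsTrig (pow hs n u) := by
  induction n with
  | zero => exact isTrig_cosMode 0
  | succ n ih => exact hu.mul hs ih

theorem toFun_sum (hs : (d : ℝ) / 2 < s) {ι : Type*} (F : Finset ι) (u : ι → Sobolev d s)
    (x : Fin d → ℝ) : toFun (∑ i ∈ F, u i) x = ∑ i ∈ F, toFun (u i) x := by
  classical
  induction F using Finset.induction_on with
  | empty => simp
  | insert a F ha ih => rw [Finset.sum_insert ha, toFun_add hs, ih, Finset.sum_insert ha]

/-- Growth and Lipschitz bounds of the power `u ↦ uⁿ` on the ball of radius `R` about a large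
multiple `λζ`. -/
theorem exists_pow_bound (hs : (d : ℝ) / 2 < s) (ζ : Sobolev d s) (R : ℝ) (n : ℕ) :
    ∃ C : ℝ, 0 ≤ C ∧ ∀ l : ℝ, 1 ≤ l → ∀ w w' : Sobolev d s, ‖w‖ ≤ R → ‖w'‖ ≤ R →
      ‖pow hs n (l • ζ + w)‖ ≤ C * l ^ n ∧
      l * ‖pow hs n (l • ζ + w) - pow hs n (l • ζ + w')‖ ≤ C * l ^ n * ‖w - w'‖ := by
  obtain ⟨K, hK0, hK⟩ := exists_norm_mul_le hs
  induction n with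
  | zero =>
    refine ⟨‖(cosMode s 0 : Sobolev d s)‖, norm_nonneg _, fun l _ w w' _ _ => ⟨by simp [pow], ?_⟩⟩
    simp only [pow, sub_self, norm_zero, mul_zero]
    positivity
  | succ n ih =>
    obtain ⟨C, hC0, hC⟩ := ih
    set D := ‖ζ‖ + |R|
    have hD0 : 0 ≤ D := by positivity
    refine ⟨K * D * C + K * C, by positivity, fun l hl w w' hw hw' => ?_⟩
    obtain ⟨h1, h2⟩ := hC l hl w w' hw hw'
    obtain ⟨h1', -⟩ := hC l hl w' w hw' hw
    have hl0 : 0 ≤ l := by linarith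
    have hx : ‖l • ζ + w‖ ≤ D * l := by
      calc ‖l • ζ + w‖ ≤ ‖l • ζ‖ + ‖w‖ := norm_add_le _ _
        _ ≤ l * ‖ζ‖ + |R| * l := by
            rw [norm_smul, Real.norm_of_nonneg hl0]
            have := le_abs_self R
            have := mul_le_mul_of_nonneg_left hl (abs_nonneg R)
            linarith
        _ = D * l := by ring
    constructor
    · calc ‖pow hs (n + 1) (l • ζ + w)‖ ≤ K * ‖l • ζ + w‖ * ‖pow hs n (l • ζ + w)‖ := hK _ _
        _ ≤ K * (D * l) * (C * l ^ n) := by gcongr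
        _ = K * D * C * l ^ (n + 1) := by ring
        _ ≤ (K * D * C + K * C) * l ^ (n + 1) := by
            gcongr
            have : 0 ≤ K * C := by positivity
            linarith
    · have e : pow hs (n + 1) (l • ζ + w) - pow hs (n + 1) (l • ζ + w')
          = mul hs (l • ζ + w) (pow hs n (l • ζ + w) - pow hs n (l • ζ + w'))
            + mul hs (w - w') (pow hs n (l • ζ + w')) := by
        apply toFun_injective hs
        funext x
        simp only [pow, toFun_sub hs, toFun_add hs, toFun_mul hs]
        ring
      rw [e]
      calc l * ‖_ + _‖ ≤ l * (K * ‖l • ζ + w‖ * ‖pow hs n (l • ζ + w) - pow hs n (l • ζ + w')‖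
              + K * ‖w - w'‖ * ‖pow hs n (l • ζ + w')‖) := by
            gcongr
            exact (norm_add_le _ _).trans (add_le_add (hK _ _) (hK _ _))
        _ = K * ‖l • ζ + w‖ * (l * ‖pow hs n (l • ζ + w) - pow hs n (l • ζ + w')‖)
              + l * K * ‖w - w'‖ * ‖pow hs n (l • ζ + w')‖ := by ring
        _ ≤ K * (D * l) * (C * l ^ n * ‖w - w'‖) + l * K * ‖w - w'‖ * (C * l ^ n) := by gcongr
        _ = (K * D * C + K * C) * l ^ (n + 1) * ‖w - w'‖ := by ring

/-- The composition `P(u)` of a real polynomial with an element of `H^s`, `s > d/2`. -/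
noncomputable def polyComp (hs : (d : ℝ) / 2 < s) (P : Polynomial ℝ) (u : Sobolev d s) :
    Sobolev d s :=
  ∑ n ∈ Finset.range (P.natDegree + 1), P.coeff n • pow hs n u

theorem toFun_polyComp (hs : (d : ℝ) / 2 < s) (P : Polynomial ℝ) (u : Sobolev d s)
    (x : Fin d → ℝ) : toFun (polyComp hs P u) x = P.eval (toFun u x) := by
  rw [polyComp, toFun_sum hs, Polynomial.eval_eq_sum_range]
  simp only [toFun_smul, toFun_pow]

/-- On the ball of radius `R` about `λζ` the polynomial is Lipschitz with constant `O(λ^{p-1})`. -/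
theorem exists_polyComp_lipschitz (hs : (d : ℝ) / 2 < s) (P : Polynomial ℝ)
    (hP : 1 ≤ P.natDegree) (ζ : Sobolev d s) (R : ℝ) :
    ∃ C : ℝ, 0 ≤ C ∧ ∀ l : ℝ, 1 ≤ l → ∀ w w' : Sobolev d s, ‖w‖ ≤ R → ‖w'‖ ≤ R →
      ‖polyComp hs P (l • ζ + w) - polyComp hs P (l • ζ + w')‖
        ≤ C * l ^ (P.natDegree - 1) * ‖w - w'‖ := by
  choose C hC0 hC using exists_pow_bound hs ζ R
  refine ⟨∑ n ∈ Finset.range (P.natDegree + 1), |P.coeff n| * C n,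
    Finset.sum_nonneg fun n _ => mul_nonneg (abs_nonneg _) (hC0 n), fun l hl w w' hw hw' => ?_⟩
  have hl0 : 0 < l := by linarith
  rw [polyComp, polyComp, ← Finset.sum_sub_distrib, Finset.sum_mul, Finset.sum_mul]
  refine norm_sum_le_of_le _ fun n hn => ?_
  rw [← smul_sub, norm_smul, Real.norm_eq_abs, mul_assoc, mul_assoc]
  gcongr
  rw [← mul_assoc]
  have h2 := ((hC n) l hl w w' hw hw').2
  have hn' : n ≤ P.natDegree := by
    have := Finset.mem_range.1 hn; omega
  have h3 : l ^ n ≤ l * l ^ (P.natDegree - 1) := by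
    rw [← pow_succ']
    exact pow_le_pow_right₀ hl (by omega)
  refine le_of_mul_le_mul_left (h2.trans ?_) hl0
  calc C n * l ^ n * ‖w - w'‖ ≤ C n * (l * l ^ (P.natDegree - 1)) * ‖w - w'‖ := by
        have := hC0 n
        gcongr
    _ = _ := by ring

/-- The leading behaviour of `P(λζ)` as `λ → ∞`. -/
theorem exists_polyComp_leading (hs : (d : ℝ) / 2 < s) (P : Polynomial ℝ)
    (hP : 1 ≤ P.natDegree) (ζ : Sobolev d s) :
    ∃ C : ℝ, 0 ≤ C ∧ ∀ l : ℝ, 1 ≤ l →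
      ‖polyComp hs P (l • ζ) - (P.leadingCoeff * l ^ P.natDegree) • pow hs P.natDegree ζ‖
        ≤ C * l ^ (P.natDegree - 1) := by
  have hpow : ∀ (n : ℕ) (l : ℝ), pow hs n (l • ζ) = l ^ n • pow hs n ζ := by
    intro n l
    apply toFun_injective hs
    funext x
    simp only [toFun_pow, toFun_smul, mul_pow]
  refine ⟨∑ n ∈ Finset.range P.natDegree, |P.coeff n| * ‖pow hs n ζ‖,
    Finset.sum_nonneg fun n _ => by positivity, fun l hl => ?_⟩
  rw [polyComp, Finset.sum_range_succ, hpow P.natDegree, smul_smul, Polynomial.coeff_natDegree,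
    add_sub_cancel_right, Finset.sum_mul]
  refine norm_sum_le_of_le _ fun n hn => ?_
  have hl0 : 0 < l := by linarith
  rw [hpow, norm_smul, norm_smul, Real.norm_eq_abs, Real.norm_of_nonneg (by positivity),
    mul_comm (l ^ n), ← mul_assoc]
  have h1 : l ^ n ≤ l ^ (P.natDegree - 1) :=
    pow_le_pow_right₀ hl (by have := Finset.mem_range.1 hn; omega)
  gcongr

end Sobolev

/-! ### Composition with a smooth function -/

/-- The Fourier coefficients of the partial derivative `∂_j`. -/
noncomputable def derivSeq (j : Fin d) (c : (Fin d → ℤ) → ℂ) (k : Fin d → ℤ) : ℂ :=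
  Complex.I * (k j : ℂ) * c k

theorem derivSeq_add (j : Fin d) (a b : (Fin d → ℤ) → ℂ) :
    derivSeq j (a + b) = derivSeq j a + derivSeq j b := by
  funext k; simp [derivSeq, mul_add]

theorem derivSeq_sub (j : Fin d) (a b : (Fin d → ℤ) → ℂ) :
    derivSeq j (a - b) = derivSeq j a - derivSeq j b := by
  funext k; simp [derivSeq, mul_sub]

theorem derivSeq_smul (j : Fin d) (z : ℂ) (a : (Fin d → ℤ) → ℂ) :
    derivSeq j (z • a) = z • derivSeq j a := by
  funext k; simp [derivSeq]; ring

theorem support_derivSeq_subset (j : Fin d) (c : (Fin d → ℤ) → ℂ) :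
    (derivSeq j c).support ⊆ c.support := by
  intro k hk h0
  exact hk (by simp [derivSeq, h0])

/-- `‖c‖_ρ² = ‖c‖_{ρ-1}² + ∑_j ‖∂_j c‖_{ρ-1}²`. -/
theorem sqNorm_eq_add_sum_derivSeq (ρ : ℝ) (c : (Fin d → ℤ) → ℂ) :
    sqNorm ρ c = sqNorm (ρ - 1) c + ∑ j, sqNorm (ρ - 1) (derivSeq j c) := by
  simp only [sqNorm_eq_tsum_ofReal]
  rw [← Summable.tsum_finsetSum fun _ _ => ENNReal.summable, ← ENNReal.tsum_add]
  refine tsum_congr fun k => ?_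
  rw [← ENNReal.ofReal_sum_of_nonneg fun j _ => sobolev_term_nonneg _ _ _,
    ← ENNReal.ofReal_add (sobolev_term_nonneg _ _ _)
      (Finset.sum_nonneg fun j _ => sobolev_term_nonneg _ _ _)]
  congr 1
  have h1 : ∀ j, ‖derivSeq j c k‖ ^ 2 = (k j : ℝ) ^ 2 * ‖c k‖ ^ 2 := by
    intro j
    rw [derivSeq, norm_mul, norm_mul, Complex.norm_I, one_mul, mul_pow, Complex.norm_intCast,
      sq_abs]
  simp only [h1]
  rw [← Finset.mul_sum, ← Finset.sum_mul]
  have h2 : (1 + freqSq k) ^ ρ = (1 + freqSq k) ^ (ρ - 1) * (1 + freqSq k) := by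
    rw [← Real.rpow_add_one (one_add_freqSq_pos k).ne']
    congr 1; ring
  rw [h2]
  simp only [freqSq]
  ring

theorem sqNorm_derivSeq_le (j : Fin d) (ρ : ℝ) (c : (Fin d → ℤ) → ℂ) :
    sqNorm (ρ - 1) (derivSeq j c) ≤ sqNorm ρ c := by
  rw [sqNorm_eq_add_sum_derivSeq ρ c]
  exact (Finset.single_le_sum (f := fun j => sqNorm (ρ - 1) (derivSeq j c))
    (fun _ _ => zero_le) (Finset.mem_univ j)).trans le_add_self

theorem conv_add_left {a b : (Fin d → ℤ) → ℂ} (ha : a.support.Finite) (hb : b.support.Finite)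
    (c : (Fin d → ℤ) → ℂ) : conv (a + b) c = conv a c + conv b c := by
  funext k
  have h : ∀ {a : (Fin d → ℤ) → ℂ}, a.support.Finite → Summable fun l => a l * c (k - l) :=
    fun ha => summable_of_hasFiniteSupport (ha.subset (Function.support_mul_subset_left _ _))
  rw [Pi.add_apply, conv, conv, conv, ← (h ha).tsum_add (h hb)]
  exact tsum_congr fun l => by simp [add_mul]

theorem conv_sub_right {a : (Fin d → ℤ) → ℂ} (ha : a.support.Finite)
    (b c : (Fin d → ℤ) → ℂ) : conv a (b - c) = conv a b - conv a c := by
  funext k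
  have h : ∀ c : (Fin d → ℤ) → ℂ, Summable fun l => a l * c (k - l) :=
    fun c => summable_of_hasFiniteSupport (ha.subset (Function.support_mul_subset_left _ _))
  rw [Pi.sub_apply, conv, conv, conv, ← (h b).tsum_sub (h c)]
  exact tsum_congr fun l => by simp [mul_sub]

theorem conv_smul_left (z : ℂ) (a c : (Fin d → ℤ) → ℂ) : conv (z • a) c = z • conv a c := by
  funext k
  rw [Pi.smul_apply, conv, conv, smul_eq_mul, ← tsum_mul_left]
  exact tsum_congr fun l => by simp [mul_assoc]

/-- The linear functional `x ↦ ⟨x,k⟩`. -/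
noncomputable def pairingCLM (k : Fin d → ℤ) : (Fin d → ℝ) →L[ℝ] ℝ :=
  ∑ i, (k i : ℝ) • ContinuousLinearMap.proj i

theorem pairingCLM_apply (k : Fin d → ℤ) (x : Fin d → ℝ) : pairingCLM k x = pairing x k := by
  simp [pairingCLM, pairing, mul_comm]

theorem pairingCLM_single (k : Fin d → ℤ) (j : Fin d) :
    pairingCLM k (Pi.single j 1) = k j := by
  rw [pairingCLM_apply, pairing, Finset.sum_eq_single j]
  · simp
  · intro i _ hi; simp [hi]
  · simp

theorem hasFDerivAt_expMode (k : Fin d → ℤ) (x : Fin d → ℝ) :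
    HasFDerivAt (expMode k)
      ((Complex.I * expMode k x) • (Complex.ofRealCLM.comp (pairingCLM k))) x := by
  have h1 : HasFDerivAt (fun x : Fin d → ℝ => (pairing x k : ℂ))
      (Complex.ofRealCLM.comp (pairingCLM k)) x := by
    have : (fun x : Fin d → ℝ => (pairing x k : ℂ)) = (Complex.ofRealCLM.comp (pairingCLM k)) := by
      funext y
      simp [pairingCLM_apply]
    rw [this]
    exact ContinuousLinearMap.hasFDerivAt _
  have h2 := (h1.const_mul Complex.I).cexp
  refine h2.congr_fderiv ?_
  rw [smul_smul, mul_comm, expMode]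

theorem ser_eq_sum {c : (Fin d → ℤ) → ℂ} (hc : c.support.Finite) (x : Fin d → ℝ) :
    ser c x = ∑ k ∈ hc.toFinset, c k * expMode k x :=
  tsum_eq_sum fun k hk => by
    have : c k = 0 := by
      by_contra hcon
      exact hk (hc.mem_toFinset.2 hcon)
    simp [this]

theorem hasFDerivAt_ser {c : (Fin d → ℤ) → ℂ} (hc : c.support.Finite) (x : Fin d → ℝ) :
    ∃ L : (Fin d → ℝ) →L[ℝ] ℂ, HasFDerivAt (ser c) L x ∧
      ∀ j, L (Pi.single j 1) = ser (derivSeq j c) x := by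
  have e : ser c = fun x => ∑ k ∈ hc.toFinset, c k * expMode k x := funext (ser_eq_sum hc)
  refine ⟨∑ k ∈ hc.toFinset, c k • ((Complex.I * expMode k x) •
    (Complex.ofRealCLM.comp (pairingCLM k))), ?_, fun j => ?_⟩
  · rw [e]
    exact HasFDerivAt.fun_sum fun k _ => (hasFDerivAt_expMode k x).const_mul (c k)
  · rw [ser, tsum_eq_sum (s := hc.toFinset) (fun k hk => ?_), sum_apply]
    · refine Finset.sum_congr rfl fun k _ => ?_
      simp only [smul_apply, ContinuousLinearMap.comp_apply,
        pairingCLM_single, Complex.ofRealCLM_apply, smul_eq_mul, derivSeq]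
      push_cast
      ring
    · have : c k = 0 := by
        by_contra hcon
        exact hk (hc.mem_toFinset.2 hcon)
      simp [this, derivSeq]

theorem expMode_periodic {n : ℕ} (k : Fin (n + 1) → ℤ) (j : Fin (n + 1)) (y : Fin n → ℝ) :
    expMode k (j.insertNth (2 * Real.pi) y) = expMode k (j.insertNth (0 : ℝ) y) := by
  have h : pairing (j.insertNth (2 * Real.pi) y) k
      = pairing (j.insertNth (0 : ℝ) y) k + 2 * Real.pi * k j := by
    simp only [pairing]
    rw [Fin.sum_univ_succAbove _ j, Fin.sum_univ_succAbove _ j]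
    simp
    ring
  rw [expMode, expMode, h, Complex.exp_eq_exp_iff_exists_int]
  exact ⟨k j, by push_cast; ring⟩

theorem ser_periodic {n : ℕ} (c : (Fin (n + 1) → ℤ) → ℂ) (j : Fin (n + 1)) (y : Fin n → ℝ) :
    ser c (j.insertNth (2 * Real.pi) y) = ser c (j.insertNth (0 : ℝ) y) := by
  simp only [ser, expMode_periodic]

/-- The derivative of a periodic function has mean zero. -/
theorem integral_deriv_periodic {n : ℕ} (j : Fin (n + 1)) {ψ : (Fin (n + 1) → ℝ) → ℂ}
    {ψ' : (Fin (n + 1) → ℝ) → (Fin (n + 1) → ℝ) →L[ℝ] ℂ} (hψ : ∀ x, HasFDerivAt ψ (ψ' x) x)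
    (hc : Continuous fun x => ψ' x (Pi.single j 1))
    (hper : ∀ y : Fin n → ℝ, ψ (j.insertNth (2 * Real.pi) y) = ψ (j.insertNth (0 : ℝ) y)) :
    ∫ x, ψ' x (Pi.single j 1) ∂cellMeasure (n + 1) = 0 := by
  have hcont : Continuous ψ := continuous_iff_continuousAt.2 fun x => (hψ x).continuousAt
  have key := integral_divergence_of_hasFDerivAt_off_countable'
    (0 : Fin (n + 1) → ℝ) (fun _ => 2 * Real.pi)
    (fun _ => by simp only [Pi.zero_apply]; positivity)
    (fun i => if i = j then ψ else 0) (fun i => if i = j then ψ' else 0) ∅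
    Set.countable_empty
    (fun i => by
      split_ifs
      · exact hcont.continuousOn
      · exact continuousOn_const)
    (fun x _ i => by
      split_ifs
      · exact hψ x
      · exact hasFDerivAt_const (0 : ℂ) x)
    (by
      refine Continuous.integrableOn_Icc ?_
      refine continuous_finsetSum _ fun i _ => ?_
      by_cases hij : i = j
      · subst hij
        simpa using hc
      · simp only [if_neg hij]
        exact continuous_const)
  rw [integral_cellMeasure]
  have h1 : ∀ x : Fin (n + 1) → ℝ,
      ∑ i, (if i = j then ψ' else 0) x (Pi.single i 1) = ψ' x (Pi.single j 1) := by
    intro x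
    rw [Finset.sum_eq_single j]
    · simp
    · intro i _ hij; simp [hij]
    · simp
  simp only [h1] at key
  rw [key, Finset.sum_eq_zero, mul_zero]
  intro i _
  by_cases hij : i = j
  · subst hij
    simp only [if_true, hper, Pi.zero_apply, sub_self]
  · simp [hij]

namespace Sobolev

variable {s : ℝ}

/-- The Fourier coefficients of the superposition `g(u)`. -/
noncomputable def compCoeff (g : ℝ → ℝ) (u : Sobolev d s) : (Fin d → ℤ) → ℂ :=
  fcoef fun x => (g (toFun u x) : ℂ)

theorem continuous_toFun_of_isTrig {u : Sobolev d s} (hu : IsTrig u) : Continuous (toFun u) :=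
  Complex.continuous_re.comp (continuous_ser hu.summable)

/-- The chain rule `∂_j g(u) = ∂_j u · g'(u)` for trigonometric polynomials, in terms of Fourier
coefficients. -/
theorem derivSeq_compCoeff {g : ℝ → ℝ} (hg : ContDiff ℝ 1 g) {u : Sobolev d s} (hu : IsTrig u)
    (j : Fin d) :
    derivSeq j (compCoeff g u) = conv (derivSeq j (coeff u)) (compCoeff (deriv g) u) := by
  obtain _ | n := d
  · exact j.elim0
  have hsupp : (derivSeq j (coeff u)).support.Finite := hu.subset (support_derivSeq_subset _ _)
  have hds : Summable fun k => ‖derivSeq j (coeff u) k‖ :=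
    summable_of_hasFiniteSupport (hsupp.subset fun k hk => by simpa using hk)
  have hcu := continuous_toFun_of_isTrig hu
  have hcd : Continuous fun x => ((deriv g (toFun u x) : ℝ) : ℂ) :=
    Complex.continuous_ofReal.comp ((hg.continuous_deriv le_rfl).comp hcu)
  have hcg : Continuous fun x => ((g (toFun u x) : ℝ) : ℂ) :=
    Complex.continuous_ofReal.comp (hg.continuous.comp hcu)
  rw [compCoeff, compCoeff, ← fcoef_ser_mul hcd hds]
  funext k
  choose L hL hLj using fun x => hasFDerivAt_ser hu x
  have hU : ∀ x, HasFDerivAt (toFun u) (Complex.reCLM.comp (L x)) x := fun x =>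
    Complex.reCLM.hasFDerivAt.comp x (hL x)
  have hreal : ∀ x, ((Complex.reCLM.comp (L x) (Pi.single j 1) : ℝ) : ℂ)
      = ser (derivSeq j (coeff u)) x := by
    intro x
    have h1 : HasFDerivAt (ser (coeff u)) (Complex.ofRealCLM.comp (Complex.reCLM.comp (L x))) x := by
      have e : ser (coeff u) = Complex.ofRealCLM ∘ toFun u := funext fun y => ser_coeff_eq u y
      rw [e]
      exact Complex.ofRealCLM.hasFDerivAt.comp x (hU x)
    rw [← hLj x j, (hL x).unique h1]
    rfl
  have hG : ∀ x, HasFDerivAt (fun x => ((g (toFun u x) : ℝ) : ℂ))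
      (Complex.ofRealCLM.comp (deriv g (toFun u x) • Complex.reCLM.comp (L x))) x := by
    intro x
    have hgd : HasDerivAt g (deriv g (toFun u x)) (toFun u x) :=
      (hg.differentiable one_ne_zero _).hasDerivAt
    exact Complex.ofRealCLM.hasFDerivAt.comp x (hgd.comp_hasFDerivAt x (hU x))
  have hψ := fun x => (hG x).mul (hasFDerivAt_expMode (-k) x)
  have hval : ∀ x, ((((g (toFun u x) : ℝ) : ℂ) • ((Complex.I * expMode (-k) x) •
        (Complex.ofRealCLM.comp (pairingCLM (-k)))) + expMode (-k) x •
        (Complex.ofRealCLM.comp (deriv g (toFun u x) • Complex.reCLM.comp (L x)))) :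
        (Fin (n + 1) → ℝ) →L[ℝ] ℂ) (Pi.single j 1)
      = ser (derivSeq j (coeff u)) x * ((deriv g (toFun u x) : ℝ) : ℂ) * expMode (-k) x
        - Complex.I * (k j : ℂ) * (((g (toFun u x) : ℝ) : ℂ) * expMode (-k) x) := by
    intro x
    simp only [add_apply, smul_apply, smul_eq_mul]
    rw [ContinuousLinearMap.comp_apply, ContinuousLinearMap.comp_apply, pairingCLM_single,
      smul_apply, Complex.ofRealCLM_apply, Complex.ofRealCLM_apply,
      smul_eq_mul, Complex.ofReal_mul, hreal]
    simp only [Pi.neg_apply]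
    push_cast
    ring
  have hzero := integral_deriv_periodic j hψ (by
      simp only [hval]
      exact (((continuous_ser hds).mul hcd).mul (continuous_expMode _)).sub
        (continuous_const.mul (hcg.mul (continuous_expMode _))))
    (fun y => by simp only [Pi.mul_apply, expMode_periodic, toFun_eq_re, ser_periodic])
  simp only [hval] at hzero
  have i1 : Integrable (fun x => ser (derivSeq j (coeff u)) x
      * ((deriv g (toFun u x) : ℝ) : ℂ) * expMode (-k) x) (cellMeasure (n + 1)) :=
    Continuous.integrable_cellMeasure (((continuous_ser hds).mul hcd).mul (continuous_expMode _))
  have i2 : Integrable (fun x => Complex.I * (k j : ℂ)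
      * (((g (toFun u x) : ℝ) : ℂ) * expMode (-k) x)) (cellMeasure (n + 1)) :=
    Continuous.integrable_cellMeasure (continuous_const.mul (hcg.mul (continuous_expMode _)))
  rw [integral_sub i1 i2, sub_eq_zero, integral_const_mul] at hzero
  exact hzero.symm

end Sobolev

/-! ### Sobolev bounds for superpositions with bounded smooth functions -/

/-- `g` is smooth and bounded together with all its derivatives. -/
def BddSmooth (g : ℝ → ℝ) : Prop :=
  ContDiff ℝ ∞ g ∧ ∀ n : ℕ, ∃ C : ℝ, ∀ y : ℝ, |iteratedDeriv n g y| ≤ C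

namespace BddSmooth

variable {g : ℝ → ℝ}

protected theorem deriv (hg : BddSmooth g) : BddSmooth (deriv g) := by
  refine ⟨?_, fun n => ?_⟩
  · exact (contDiff_infty_iff_deriv.1 hg.1).2
  · obtain ⟨C, hC⟩ := hg.2 (n + 1)
    exact ⟨C, fun y => by rw [← iteratedDeriv_succ']; exact hC y⟩

theorem contDiff_one (hg : BddSmooth g) : ContDiff ℝ 1 g := hg.1.of_le (by exact_mod_cast le_top)

theorem exists_bound (hg : BddSmooth g) : ∃ M : ℝ, 0 ≤ M ∧ ∀ y, |g y| ≤ M := by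
  obtain ⟨C, hC⟩ := hg.2 0
  simp only [iteratedDeriv_zero] at hC
  exact ⟨C, (abs_nonneg _).trans (hC 0), hC⟩

theorem exists_lipschitz (hg : BddSmooth g) :
    ∃ M : ℝ, 0 ≤ M ∧ ∀ x y, |g x - g y| ≤ M * |x - y| := by
  obtain ⟨M, hM0, hM⟩ := hg.deriv.exists_bound
  refine ⟨M, hM0, fun x y => ?_⟩
  have := Convex.norm_image_sub_le_of_norm_deriv_le (𝕜 := ℝ) (f := g) (s := Set.univ) (x := y)
    (y := x) (C := M) (fun z _ => (hg.contDiff_one.differentiable one_ne_zero) z)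
    (fun z _ => hM z) convex_univ (Set.mem_univ _) (Set.mem_univ _)
  simpa using this

end BddSmooth

/-- Interpolation between `L²` and `H¹` at the frequency scale `l`. -/
theorem sqNorm_le_interpolate {θ l : ℝ} (h0 : 0 ≤ θ) (h1 : θ ≤ 1) (hl : 1 ≤ l)
    (c : (Fin d → ℤ) → ℂ) :
    sqNorm θ c ≤ ENNReal.ofReal (l ^ (2 * θ)) * sqNorm 0 c
      + ENNReal.ofReal (l ^ (2 * θ - 2)) * sqNorm 1 c := by
  have hl0 : 0 < l := by linarith
  simp only [sqNorm_eq_tsum_ofReal]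
  rw [← ENNReal.tsum_mul_left, ← ENNReal.tsum_mul_left, ← ENNReal.tsum_add]
  refine ENNReal.tsum_le_tsum fun k => ?_
  rw [← ENNReal.ofReal_mul (by positivity), ← ENNReal.ofReal_mul (by positivity),
    ← ENNReal.ofReal_add (mul_nonneg (by positivity) (sobolev_term_nonneg _ _ _))
      (mul_nonneg (by positivity) (sobolev_term_nonneg _ _ _))]
  refine ENNReal.ofReal_le_ofReal ?_
  set J := 1 + freqSq k
  have hJ : 1 ≤ J := one_le_one_add_freqSq k
  have hJ0 : 0 < J := by linarith
  have key : J ^ θ ≤ l ^ (2 * θ) + l ^ (2 * θ - 2) * J := by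
    have e : J ^ θ = l ^ (2 * θ) * (J / l ^ 2) ^ θ := by
      rw [Real.div_rpow hJ0.le (by positivity), ← Real.rpow_natCast, ← Real.rpow_mul hl0.le]
      push_cast
      field_simp
    have e2 : l ^ (2 * θ - 2) * J = l ^ (2 * θ) * (J / l ^ 2) := by
      rw [Real.rpow_sub hl0]
      norm_num
      ring
    rw [e, e2, ← mul_one_add]
    refine mul_le_mul_of_nonneg_left ?_ (by positivity)
    have ht : 0 < J / l ^ 2 := by positivity
    rcases le_total (J / l ^ 2) 1 with h | h
    · have := Real.rpow_le_one ht.le h h0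
      linarith
    · have := Real.rpow_le_rpow_of_exponent_le h h1
      rw [Real.rpow_one] at this
      linarith
  simp only [Real.rpow_zero, one_mul, Real.rpow_one]
  have := sq_nonneg ‖c k‖
  nlinarith

theorem norm_fcoef_le {φ : (Fin d → ℝ) → ℂ} {M : ℝ} (hM : ∀ x, ‖φ x‖ ≤ M) (k : Fin d → ℤ) :
    ‖fcoef φ k‖ ≤ M := by
  have := norm_integral_le_of_norm_le_const (μ := cellMeasure d)
    (f := fun x => φ x * expMode (-k) x) (C := M) (Eventually.of_forall fun x => by
      simpa using hM x)
  simpa [fcoef] using this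

namespace Sobolev

variable {s : ℝ}

section

variable {g : ℝ → ℝ}

theorem compCoeff_neg (u : Sobolev d s) (k : Fin d → ℤ) :
    compCoeff g u (-k) = (starRingEnd ℂ) (compCoeff g u k) :=
  fcoef_ofReal_neg (fun x => g (toFun u x)) k

theorem continuous_comp_toFun (hs : (d : ℝ) / 2 < s) (hg : BddSmooth g) (u : Sobolev d s) :
    Continuous fun x => ((g (toFun u x) : ℝ) : ℂ) :=
  Complex.continuous_ofReal.comp (hg.1.continuous.comp (continuous_toFun hs u))

theorem compCoeff_sub (hs : (d : ℝ) / 2 < s) (hg : BddSmooth g) (u v : Sobolev d s) :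
    compCoeff g u - compCoeff g v
      = fcoef fun x => ((g (toFun u x) : ℝ) : ℂ) - ((g (toFun v x) : ℝ) : ℂ) :=
  (fcoef_sub (continuous_comp_toFun hs hg u) (continuous_comp_toFun hs hg v)).symm

theorem exists_norm_comp_sub_le (hs : (d : ℝ) / 2 < s) (hg : BddSmooth g) :
    ∃ M : ℝ, 0 ≤ M ∧ ∀ (u v : Sobolev d s) (x : Fin d → ℝ),
      ‖((g (toFun u x) : ℝ) : ℂ) - ((g (toFun v x) : ℝ) : ℂ)‖ ≤ M * ‖u - v‖ := by
  obtain ⟨M, hM0, hM⟩ := hg.exists_lipschitz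
  refine ⟨M * embConst d s, mul_nonneg hM0 embConst_nonneg, fun u v x => ?_⟩
  rw [← Complex.ofReal_sub, Complex.norm_real, Real.norm_eq_abs, mul_assoc]
  refine (hM _ _).trans (mul_le_mul_of_nonneg_left ?_ hM0)
  rw [← toFun_sub hs]
  exact abs_toFun_le hs _ x

/-- `u ↦ g(u)` is bounded and Lipschitz from `H^s` to `L²`. -/
theorem exists_sqNorm_zero_compCoeff_le (hs : (d : ℝ) / 2 < s) (hg : BddSmooth g) :
    ∃ M : ℝ, 0 ≤ M ∧ (∀ u : Sobolev d s, sqNorm 0 (compCoeff g u) ≤ ENNReal.ofReal M) ∧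
      ∀ u v : Sobolev d s,
        sqNorm 0 (compCoeff g u - compCoeff g v) ≤ ENNReal.ofReal (M * ‖u - v‖ ^ 2) := by
  obtain ⟨M, hM0, hM⟩ := hg.exists_bound
  obtain ⟨M', hM0', hM'⟩ := exists_norm_comp_sub_le hs hg
  refine ⟨M ^ 2 + M' ^ 2, by positivity, fun u => ?_, fun u v => ?_⟩
  · refine (sqNorm_zero_fcoef_le_of_bound (continuous_comp_toFun hs hg u) (M := M) fun x => ?_).trans
      (ENNReal.ofReal_le_ofReal (by nlinarith))
    rw [Complex.norm_real]
    exact hM _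
  · rw [compCoeff_sub hs hg]
    refine (sqNorm_zero_fcoef_le_of_bound ((continuous_comp_toFun hs hg u).sub
      (continuous_comp_toFun hs hg v)) (hM' u v)).trans (ENNReal.ofReal_le_ofReal ?_)
    nlinarith [sq_nonneg (M * ‖u - v‖)]

theorem support_derivSeq_finite {u : Sobolev d s} (hu : IsTrig u) (j : Fin d) :
    (derivSeq j (coeff u)).support.Finite :=
  hu.subset (support_derivSeq_subset _ _)

theorem summable_norm_derivSeq {u : Sobolev d s} (hu : IsTrig u) (j : Fin d) :
    Summable fun k => ‖derivSeq j (coeff u) k‖ :=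
  summable_of_hasFiniteSupport ((support_derivSeq_finite hu j).subset fun k hk => by simpa using hk)

/-- The derivative of a difference of superpositions. -/
theorem derivSeq_compCoeff_sub (hg : BddSmooth g) {u v : Sobolev d s} (hu : IsTrig u)
    (hv : IsTrig v) (j : Fin d) :
    derivSeq j (compCoeff g u - compCoeff g v)
      = conv (derivSeq j (coeff u)) (compCoeff (deriv g) u - compCoeff (deriv g) v)
        + conv (derivSeq j (coeff (u - v))) (compCoeff (deriv g) v) := by
  rw [derivSeq_sub, derivSeq_compCoeff hg.contDiff_one hu, derivSeq_compCoeff hg.contDiff_one hv,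
    conv_sub_right (support_derivSeq_finite hu j)]
  have h : derivSeq j (coeff u) = derivSeq j (coeff v) + derivSeq j (coeff (u - v)) := by
    rw [← derivSeq_add, ← map_add]
    congr 2
    abel
  nth_rewrite 3 [h]
  rw [conv_add_left (support_derivSeq_finite hv j) (support_derivSeq_finite (hu.sub hv) j)]
  abel

/-- The bounds on `g(λζ + w)` in `H^ρ` which are propagated from `ρ ≤ 1` up to `ρ = s`: growth
`O(λ^ρ)` of the norm and of the Lipschitz constant. -/
def CompBound (ζ : Sobolev d s) (R ρ : ℝ) (g : ℝ → ℝ) : Prop :=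
  ∃ C : ℝ, 0 ≤ C ∧ ∀ l : ℝ, 1 ≤ l → ∀ w w' : Sobolev d s, IsTrig w → IsTrig w' →
    ‖w‖ ≤ R → ‖w'‖ ≤ R →
      sqNorm ρ (compCoeff g (l • ζ + w)) ≤ ENNReal.ofReal (C * l ^ (2 * ρ)) ∧
      sqNorm ρ (compCoeff g (l • ζ + w) - compCoeff g (l • ζ + w'))
        ≤ ENNReal.ofReal (C * l ^ (2 * ρ) * ‖w - w'‖ ^ 2)

theorem sqNorm_derivSeq_zero_le (h1 : 1 ≤ s) (u : Sobolev d s) (j : Fin d) :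
    sqNorm 0 (derivSeq j (coeff u)) ≤ ENNReal.ofReal (‖u‖ ^ 2) := by
  rw [← sqNorm_coeff_eq_ofReal]
  have := sqNorm_derivSeq_le j 1 (coeff u)
  rw [sub_self] at this
  exact this.trans (sqNorm_mono_exp h1 _)

theorem norm_smul_add_le {ζ w : Sobolev d s} {R l : ℝ} (hl : 1 ≤ l) (hw : ‖w‖ ≤ R) :
    ‖l • ζ + w‖ ≤ (‖ζ‖ + |R|) * l := by
  have hl0 : 0 ≤ l := by linarith
  calc ‖l • ζ + w‖ ≤ ‖l • ζ‖ + ‖w‖ := norm_add_le _ _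
    _ ≤ l * ‖ζ‖ + |R| * l := by
        rw [norm_smul, Real.norm_of_nonneg hl0]
        have := le_abs_self R
        have := mul_le_mul_of_nonneg_left hl (abs_nonneg R)
        linarith
    _ = _ := by ring

/-- The first-order composition bound comes from the chain rule `∂ᵢ g(u) = g'(u) ∂ᵢu`, in which `g'(u)` is
bounded uniformly in `u`. -/
theorem exists_sqNorm_one_compCoeff_le (hs : (d : ℝ) / 2 < s) (h1 : 1 ≤ s) {ζ : Sobolev d s}
    (hζ : IsTrig ζ) (R : ℝ) (hg : BddSmooth g) : CompBound ζ R 1 g := by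
  obtain ⟨M, hM0, hM, hM'⟩ := exists_sqNorm_zero_compCoeff_le hs hg
  obtain ⟨B, hB0, hB⟩ := hg.deriv.exists_bound
  obtain ⟨B', hB0', hB'⟩ := exists_norm_comp_sub_le hs hg.deriv
  set D := ‖ζ‖ + |R|
  have hD0 : 0 ≤ D := by positivity
  refine ⟨M + d * (B ^ 2 * D ^ 2) + d * (2 * (B' ^ 2 * D ^ 2) + 2 * B ^ 2), by positivity,
    fun l hl w w' ht ht' hw hw' => ?_⟩
  have hl0 : 0 < l := by linarith
  have hl2 : 1 ≤ l ^ 2 := one_le_pow₀ hl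
  have e2 : l ^ (2 * (1 : ℝ)) = l ^ 2 := by norm_num
  have hu : IsTrig (l • ζ + w) := (hζ.smul l).add ht
  have hu' : IsTrig (l • ζ + w') := (hζ.smul l).add ht'
  have hn := norm_smul_add_le (ζ := ζ) hl hw
  have hc : ∀ u : Sobolev d s, Continuous fun x => ((deriv g (toFun u x) : ℝ) : ℂ) := fun u =>
    continuous_comp_toFun hs hg.deriv u
  have hcb : ∀ (u : Sobolev d s) x, ‖((deriv g (toFun u x) : ℝ) : ℂ)‖ ≤ B := fun u x => by
    rw [Complex.norm_real]; exact hB _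
  rw [e2]
  constructor
  · rw [sqNorm_eq_add_sum_derivSeq, sub_self]
    have hj : ∀ j ∈ Finset.univ, sqNorm 0 (derivSeq j (compCoeff g (l • ζ + w)))
        ≤ ENNReal.ofReal (B ^ 2 * (D * l) ^ 2) := by
      intro j _
      rw [derivSeq_compCoeff hg.contDiff_one hu, compCoeff,
        ← fcoef_ser_mul (hc _) (summable_norm_derivSeq hu j)]
      refine (sqNorm_zero_fcoef_mul_le (summable_norm_derivSeq hu j) (hc _) (hcb _)).trans ?_
      rw [ENNReal.ofReal_mul (sq_nonneg B)]
      gcongr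
      refine (sqNorm_derivSeq_zero_le h1 _ j).trans (ENNReal.ofReal_le_ofReal ?_)
      gcongr
    refine (add_le_add (hM _) (Finset.sum_le_sum hj)).trans ?_
    rw [Finset.sum_const, Finset.card_univ, Fintype.card_fin, ← ENNReal.ofReal_nsmul,
      ← ENNReal.ofReal_add hM0 (by positivity)]
    refine ENNReal.ofReal_le_ofReal ?_
    rw [nsmul_eq_mul]
    have : 0 ≤ (d : ℝ) * (2 * (B' ^ 2 * D ^ 2) + 2 * B ^ 2) * l ^ 2 := by positivity
    nlinarith
  · rw [sqNorm_eq_add_sum_derivSeq, sub_self]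
    have hdw : l • ζ + w - (l • ζ + w') = w - w' := by abel
    have hM2 := hM' (l • ζ + w) (l • ζ + w')
    rw [hdw] at hM2
    have hj : ∀ j ∈ Finset.univ,
        sqNorm 0 (derivSeq j (compCoeff g (l • ζ + w) - compCoeff g (l • ζ + w')))
        ≤ ENNReal.ofReal (2 * ((B' * ‖w - w'‖) ^ 2 * (D * l) ^ 2) + 2 * (B ^ 2 * ‖w - w'‖ ^ 2)) := by
      intro j _
      have hcs : Continuous fun x => ((deriv g (toFun (l • ζ + w) x) : ℝ) : ℂ)
          - ((deriv g (toFun (l • ζ + w') x) : ℝ) : ℂ) := (hc _).sub (hc _)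
      rw [derivSeq_compCoeff_sub hg hu hu', hdw, compCoeff_sub hs hg.deriv, compCoeff,
        ← fcoef_ser_mul hcs (summable_norm_derivSeq hu j),
        ← fcoef_ser_mul (hc _) (summable_norm_derivSeq (ht.sub ht') j)]
      refine (sqNorm_add_le _ _ _).trans ?_
      rw [ENNReal.ofReal_add (by positivity) (by positivity), ENNReal.ofReal_mul (p := 2) (by norm_num),
        ENNReal.ofReal_mul (p := 2) (by norm_num), ENNReal.ofReal_ofNat]
      have a1 := sqNorm_zero_fcoef_mul_le (summable_norm_derivSeq hu j)
        hcs (M := B' * ‖w - w'‖)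
        (fun x => by have := hB' (l • ζ + w) (l • ζ + w') x; rwa [hdw] at this)
      have a2 := sqNorm_zero_fcoef_mul_le (summable_norm_derivSeq (ht.sub ht') j)
        (hc (l • ζ + w')) (hcb _)
      have b1 : sqNorm 0 (derivSeq j (coeff (l • ζ + w))) ≤ ENNReal.ofReal ((D * l) ^ 2) :=
        (sqNorm_derivSeq_zero_le h1 _ j).trans (ENNReal.ofReal_le_ofReal (by gcongr))
      have b2 := sqNorm_derivSeq_zero_le h1 (w - w') j
      rw [ENNReal.ofReal_mul (sq_nonneg _), ENNReal.ofReal_mul (sq_nonneg _)]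
      gcongr
      · exact a1.trans (by gcongr)
      · exact a2.trans (by gcongr)
    refine (add_le_add hM2 (Finset.sum_le_sum hj)).trans ?_
    rw [Finset.sum_const, Finset.card_univ, Fintype.card_fin, ← ENNReal.ofReal_nsmul,
      ← ENNReal.ofReal_add (by positivity) (by positivity)]
    refine ENNReal.ofReal_le_ofReal ?_
    rw [nsmul_eq_mul]
    have t0 : 0 ≤ ‖w - w'‖ ^ 2 := sq_nonneg _
    calc M * ‖w - w'‖ ^ 2 + d * (2 * ((B' * ‖w - w'‖) ^ 2 * (D * l) ^ 2)
            + 2 * (B ^ 2 * ‖w - w'‖ ^ 2))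
        = (M * 1 + d * (2 * (B' ^ 2 * D ^ 2) * l ^ 2 + 2 * B ^ 2 * 1)) * ‖w - w'‖ ^ 2 := by ring
      _ ≤ (M * l ^ 2 + d * (2 * (B' ^ 2 * D ^ 2) * l ^ 2 + 2 * B ^ 2 * l ^ 2)) * ‖w - w'‖ ^ 2 := by
          gcongr
      _ = (M + d * (2 * (B' ^ 2 * D ^ 2) + 2 * B ^ 2)) * l ^ 2 * ‖w - w'‖ ^ 2 := by ring
      _ ≤ _ := by
          gcongr
          have : 0 ≤ (d : ℝ) * (B ^ 2 * D ^ 2) := by positivity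
          linarith

/-- The range `0 ≤ ρ ≤ 1` follows from the endpoints. -/
theorem compBound_of_le_one (hs : (d : ℝ) / 2 < s) (h1 : 1 ≤ s) {ζ : Sobolev d s}
    (hζ : IsTrig ζ) (R : ℝ) (hg : BddSmooth g) {ρ : ℝ} (hρ0 : 0 ≤ ρ) (hρ1 : ρ ≤ 1) :
    CompBound ζ R ρ g := by
  obtain ⟨M, hM0, hM, hM'⟩ := exists_sqNorm_zero_compCoeff_le hs hg
  obtain ⟨C, hC0, hC⟩ := exists_sqNorm_one_compCoeff_le hs h1 hζ R hg
  refine ⟨M + C, by positivity, fun l hl w w' ht ht' hw hw' => ?_⟩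
  obtain ⟨c1, c2⟩ := hC l hl w w' ht ht' hw hw'
  have hl0 : 0 < l := by linarith
  have e : l ^ (2 * ρ - 2) * l ^ (2 * (1 : ℝ)) = l ^ (2 * ρ) := by
    rw [← Real.rpow_add hl0]; congr 1; ring
  constructor
  · refine (sqNorm_le_interpolate hρ0 hρ1 hl _).trans ?_
    refine (add_le_add (mul_le_mul_right (hM _) _) (mul_le_mul_right c1 _)).trans_eq ?_
    rw [← ENNReal.ofReal_mul (by positivity), ← ENNReal.ofReal_mul (by positivity),
      ← ENNReal.ofReal_add (by positivity) (by positivity)]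
    congr 1
    rw [← e]; ring
  · have hdw : l • ζ + w - (l • ζ + w') = w - w' := by abel
    have hM2 := hM' (l • ζ + w) (l • ζ + w')
    rw [hdw] at hM2
    refine (sqNorm_le_interpolate hρ0 hρ1 hl _).trans ?_
    refine (add_le_add (mul_le_mul_right hM2 _) (mul_le_mul_right c2 _)).trans_eq ?_
    rw [← ENNReal.ofReal_mul (by positivity), ← ENNReal.ofReal_mul (by positivity),
      ← ENNReal.ofReal_add (by positivity) (by positivity)]
    congr 1
    rw [← e]; ring

/-- One bootstrap step: the derivative costs a factor `λ` on the smooth part `λζ`, while for the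
part `w ∈ H^s` the product `∂w · g'(u)` of an `H^{s-1}` and an `H^r` function is estimated. -/
theorem compBound_step {ζ : Sobolev d s}
    (hζ : IsTrig ζ) (R : ℝ) (hg : BddSmooth g) {r ρ : ℝ} (hρ1 : 1 ≤ ρ) (hρs : ρ ≤ s)
    (hrρ : r ≤ ρ) (hρr : ρ - 1 ≤ r) (hgap : (d : ℝ) / 2 < s + r - ρ)
    (ih1 : CompBound ζ R (ρ - 1) g) (ih2 : CompBound ζ R (ρ - 1) (deriv g))
    (ih3 : CompBound ζ R r (deriv g)) : CompBound ζ R ρ g := by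
  obtain ⟨C1, hC10, hC1⟩ := ih1
  obtain ⟨C2, hC20, hC2⟩ := ih2
  obtain ⟨C3, hC30, hC3⟩ := ih3
  have hd0 : (0 : ℝ) ≤ d := Nat.cast_nonneg d
  obtain ⟨A, hA0, hA⟩ := exists_sqNorm_conv_le (d := d) (c := ρ - 1) (a := ρ + d) (b := ρ - 1)
    (by linarith) (by linarith) le_rfl (by linarith)
  obtain ⟨B, hB0, hB⟩ := exists_sqNorm_conv_le (d := d) (c := ρ - 1) (a := s - 1) (b := r)
    (by linarith) (by linarith) hρr (by linarith)
  set z : ℝ := ∑ j, (sqNorm (ρ + d) (derivSeq j (coeff ζ))).toReal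
  have hz0 : 0 ≤ z := Finset.sum_nonneg fun _ _ => ENNReal.toReal_nonneg
  have hz : ∀ j, sqNorm (ρ + d) (derivSeq j (coeff ζ)) ≤ ENNReal.ofReal z := fun j => by
    rw [← ENNReal.ofReal_toReal (sqNorm_ne_top_of_finite (support_derivSeq_finite hζ j))]
    exact ENNReal.ofReal_le_ofReal (Finset.single_le_sum
      (f := fun j => (sqNorm (ρ + d) (derivSeq j (coeff ζ))).toReal)
      (fun _ _ => ENNReal.toReal_nonneg) (Finset.mem_univ j))
  have hmulW : ∀ (v : Sobolev d s) (G : (Fin d → ℤ) → ℂ) (j : Fin d) (y : ℝ), 0 ≤ y →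
      sqNorm r G ≤ ENNReal.ofReal y → sqNorm (ρ - 1) (conv (derivSeq j (coeff v)) G)
        ≤ ENNReal.ofReal (B * (‖v‖ ^ 2 * y)) := by
    intro v G j y hy hG
    refine (hB _ _).trans ?_
    rw [ENNReal.ofReal_mul hB0, ENNReal.ofReal_mul (sq_nonneg _)]
    gcongr
    rw [← sqNorm_coeff_eq_ofReal]
    exact sqNorm_derivSeq_le j s _
  have hmul : ∀ (l : ℝ), 1 ≤ l → ∀ w : Sobolev d s, IsTrig w → ‖w‖ ≤ R →
      ∀ (G : (Fin d → ℤ) → ℂ) (j : Fin d) (x y : ℝ), 0 ≤ x → 0 ≤ y →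
      sqNorm (ρ - 1) G ≤ ENNReal.ofReal x → sqNorm r G ≤ ENNReal.ofReal y →
      sqNorm (ρ - 1) (conv (derivSeq j (coeff (l • ζ + w))) G)
        ≤ ENNReal.ofReal (2 * (l ^ 2 * (A * (z * x))) + 2 * (B * (R ^ 2 * y))) := by
    intro l hl w ht hw G j x y hx hy hGx hGy
    have hl0 : 0 ≤ l := by linarith
    have e : derivSeq j (coeff (l • ζ + w))
        = (l : ℂ) • derivSeq j (coeff ζ) + derivSeq j (coeff w) := by
      rw [map_add, derivSeq_add, ← derivSeq_smul]
      congr 2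
    have hfin : ((l : ℂ) • derivSeq j (coeff ζ)).support.Finite :=
      (support_derivSeq_finite hζ j).subset (Function.support_const_smul_subset _ _)
    rw [e, conv_add_left hfin (support_derivSeq_finite ht j), conv_smul_left]
    refine (sqNorm_add_le _ _ _).trans ?_
    rw [ENNReal.ofReal_add (by positivity) (by positivity), ENNReal.ofReal_mul (p := 2) (by norm_num),
      ENNReal.ofReal_mul (p := 2) (by norm_num), ENNReal.ofReal_ofNat]
    gcongr
    · rw [sqNorm_smul, ENNReal.ofReal_mul (sq_nonneg l), ENNReal.ofReal_mul hA0,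
        ENNReal.ofReal_mul hz0, ← ofReal_norm, ← ENNReal.ofReal_pow (norm_nonneg _),
        Complex.norm_real, Real.norm_of_nonneg hl0]
      gcongr
      refine (hA _ _).trans ?_
      gcongr
      exact hz j
    · refine (hmulW w G j y hy hGy).trans (ENNReal.ofReal_le_ofReal ?_)
      gcongr
  have hR2 : 0 ≤ R ^ 2 := sq_nonneg R
  set K : ℝ := 2 * (A * (z * C2)) + 2 * (B * (R ^ 2 * C3))
  have hK0 : 0 ≤ K := by positivity
  refine ⟨C1 + d * (2 * K + 2 * (B * C3)), by positivity, fun l hl w w' ht ht' hw hw' => ?_⟩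
  have hl0 : 0 < l := by linarith
  have p1 : l ^ (2 * (ρ - 1)) ≤ l ^ (2 * ρ) := Real.rpow_le_rpow_of_exponent_le hl (by linarith)
  have p2 : l ^ (2 * r) ≤ l ^ (2 * ρ) := Real.rpow_le_rpow_of_exponent_le hl (by linarith)
  have p3 : l ^ 2 * l ^ (2 * (ρ - 1)) = l ^ (2 * ρ) := by
    rw [← Real.rpow_natCast, ← Real.rpow_add hl0]; congr 1; push_cast; ring
  have p0 : 0 ≤ l ^ (2 * ρ) := by positivity
  have q0 : 0 ≤ l ^ (2 * r) := by positivity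
  have hu : IsTrig (l • ζ + w) := (hζ.smul l).add ht
  have hu' : IsTrig (l • ζ + w') := (hζ.smul l).add ht'
  have hdw : l • ζ + w - (l • ζ + w') = w - w' := by abel
  obtain ⟨a1, b1⟩ := hC1 l hl w w' ht ht' hw hw'
  obtain ⟨a2, b2⟩ := hC2 l hl w w' ht ht' hw hw'
  obtain ⟨a3, b3⟩ := hC3 l hl w w' ht ht' hw hw'
  obtain ⟨a3', -⟩ := hC3 l hl w' w ht' ht hw' hw
  constructor
  · rw [sqNorm_eq_add_sum_derivSeq]
    have hj : ∀ j ∈ Finset.univ, sqNorm (ρ - 1) (derivSeq j (compCoeff g (l • ζ + w)))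
        ≤ ENNReal.ofReal (K * l ^ (2 * ρ)) := by
      intro j _
      rw [derivSeq_compCoeff hg.contDiff_one hu]
      refine (hmul l hl w ht hw _ j _ _ (by positivity) (by positivity) a2 a3).trans
        (ENNReal.ofReal_le_ofReal ?_)
      calc _ = 2 * (A * (z * C2)) * (l ^ 2 * l ^ (2 * (ρ - 1)))
            + 2 * (B * (R ^ 2 * C3)) * l ^ (2 * r) := by ring
        _ ≤ 2 * (A * (z * C2)) * l ^ (2 * ρ) + 2 * (B * (R ^ 2 * C3)) * l ^ (2 * ρ) := by
            rw [p3]; gcongr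
        _ = _ := by ring
    refine (add_le_add a1 (Finset.sum_le_sum hj)).trans ?_
    rw [Finset.sum_const, Finset.card_univ, Fintype.card_fin, ← ENNReal.ofReal_nsmul,
      ← ENNReal.ofReal_add (by positivity) (by positivity)]
    refine ENNReal.ofReal_le_ofReal ?_
    rw [nsmul_eq_mul]
    calc _ ≤ C1 * l ^ (2 * ρ) + d * (K * l ^ (2 * ρ)) := by gcongr
      _ = (C1 + d * K) * l ^ (2 * ρ) := by ring
      _ ≤ _ := by
        gcongr
        have : 0 ≤ B * C3 := by positivity
        linarith
  · rw [sqNorm_eq_add_sum_derivSeq]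
    have t0 : 0 ≤ ‖w - w'‖ ^ 2 := sq_nonneg _
    have hj : ∀ j ∈ Finset.univ,
        sqNorm (ρ - 1) (derivSeq j (compCoeff g (l • ζ + w) - compCoeff g (l • ζ + w')))
        ≤ ENNReal.ofReal ((2 * K + 2 * (B * C3)) * l ^ (2 * ρ) * ‖w - w'‖ ^ 2) := by
      intro j _
      rw [derivSeq_compCoeff_sub hg hu hu', hdw]
      refine (sqNorm_add_le _ _ _).trans ?_
      refine (add_le_add (mul_le_mul_right (hmul l hl w ht hw _ j _ _ (by positivity)
        (by positivity) b2 b3) _) (mul_le_mul_right (hmulW (w - w') _ j _ (by positivity) a3')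
          _)).trans ?_
      rw [← ENNReal.ofReal_ofNat 2, ← ENNReal.ofReal_mul (by norm_num),
        ← ENNReal.ofReal_mul (by norm_num), ← ENNReal.ofReal_add (by positivity) (by positivity)]
      refine ENNReal.ofReal_le_ofReal ?_
      calc _ = (2 * (2 * (A * (z * C2)) * (l ^ 2 * l ^ (2 * (ρ - 1)))
            + 2 * (B * (R ^ 2 * C3)) * l ^ (2 * r)) + 2 * (B * C3) * l ^ (2 * r))
              * ‖w - w'‖ ^ 2 := by ring
        _ ≤ (2 * (2 * (A * (z * C2)) * l ^ (2 * ρ)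
            + 2 * (B * (R ^ 2 * C3)) * l ^ (2 * ρ)) + 2 * (B * C3) * l ^ (2 * ρ))
              * ‖w - w'‖ ^ 2 := by
            rw [p3]; gcongr
        _ = _ := by ring
    refine (add_le_add b1 (Finset.sum_le_sum hj)).trans ?_
    rw [Finset.sum_const, Finset.card_univ, Fintype.card_fin, ← ENNReal.ofReal_nsmul,
      ← ENNReal.ofReal_add (by positivity) (by positivity)]
    refine ENNReal.ofReal_le_ofReal ?_
    rw [nsmul_eq_mul]
    calc _ ≤ C1 * l ^ (2 * ρ) * ‖w - w'‖ ^ 2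
          + d * ((2 * K + 2 * (B * C3)) * l ^ (2 * ρ) * ‖w - w'‖ ^ 2) := by gcongr
      _ = _ := by ring

/-- The composition bound at order `s`, by a bootstrap: the chain rule and the product estimate raise the
Sobolev order of the bound for all bounded smooth `g` at once by a fixed `σ > 0`. -/
theorem compBound_self (hs : (d : ℝ) / 2 < s) (h1 : 1 ≤ s) {ζ : Sobolev d s}
    (hζ : IsTrig ζ) (R : ℝ) (hg : BddSmooth g) : CompBound ζ R s g := by
  set σ : ℝ := min 1 ((s - d / 2) / 2)
  have hσ0 : 0 < σ := lt_min one_pos (by linarith)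
  have hσ1 : σ ≤ 1 := min_le_left _ _
  have hσ2 : σ ≤ (s - d / 2) / 2 := min_le_right _ _
  have main : ∀ (n : ℕ) (g : ℝ → ℝ), BddSmooth g → ∀ ρ : ℝ, 0 ≤ ρ → ρ ≤ 1 + n * σ → ρ ≤ s →
      CompBound ζ R ρ g := by
    intro n
    induction n with
    | zero =>
      intro g hg ρ h0 hρ _
      exact compBound_of_le_one hs h1 hζ R hg h0 (by simpa using hρ)
    | succ n ih =>
      intro g hg ρ h0 hρ hρs
      push_cast at hρ
      by_cases hlt : ρ ≤ 1 + n * σ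
      · exact ih g hg ρ h0 hlt hρs
      · push Not at hlt
        have hnσ : 0 ≤ n * σ := by positivity
        refine compBound_step hζ R hg (r := 1 + n * σ) (ρ := ρ) (by linarith) hρs hlt.le
          (by linarith) (by linarith) (ih g hg _ (by linarith) (by linarith) (by linarith))
          (ih _ hg.deriv _ (by linarith) (by linarith) (by linarith))
          (ih _ hg.deriv _ (by linarith) le_rfl (by linarith))
  obtain ⟨n, hn⟩ := exists_nat_gt ((s - 1) / σ)
  refine main n g hg s (by linarith) ?_ le_rfl
  rw [div_lt_iff₀ hσ0] at hn
  linarith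

theorem tendsto_compCoeff (hs : (d : ℝ) / 2 < s) (hg : BddSmooth g) {u : ℕ → Sobolev d s}
    {v : Sobolev d s} (h : Tendsto u atTop (𝓝 v)) (k : Fin d → ℤ) :
    Tendsto (fun n => compCoeff g (u n) k) atTop (𝓝 (compCoeff g v k)) := by
  obtain ⟨M, hM0, hM⟩ := exists_norm_comp_sub_le (d := d) hs hg
  rw [tendsto_iff_norm_sub_tendsto_zero] at h ⊢
  refine squeeze_zero (fun _ => norm_nonneg _) (fun n => ?_) (by simpa using h.const_mul M)
  have e : compCoeff g (u n) k - compCoeff g v k = (compCoeff g (u n) - compCoeff g v) k := rfl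
  rw [e, compCoeff_sub hs hg]
  exact norm_fcoef_le (hM (u n) v) k

/-- `u ↦ g(u)` acts in `H^s`, `s ≥ 1`, `s > d/2`; on the ball of radius `R` about `λζ` both its norm
and its Lipschitz constant are `O(λ^s)`. -/
theorem exists_compCoeff_bound (hs : (d : ℝ) / 2 < s) (h1 : 1 ≤ s) {ζ : Sobolev d s}
    (hζ : IsTrig ζ) (R : ℝ) (hg : BddSmooth g) :
    ∃ C : ℝ, 0 ≤ C ∧ ∀ l : ℝ, 1 ≤ l → ∀ w w' : Sobolev d s, ‖w‖ ≤ R → ‖w'‖ ≤ R →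
      sqNorm s (compCoeff g (l • ζ + w)) ≤ ENNReal.ofReal ((C * l ^ s) ^ 2) ∧
      sqNorm s (compCoeff g (l • ζ + w) - compCoeff g (l • ζ + w'))
        ≤ ENNReal.ofReal ((C * l ^ s * ‖w - w'‖) ^ 2) := by
  obtain ⟨C, hC0, hC⟩ := compBound_self hs h1 hζ R hg
  refine ⟨Real.sqrt C, Real.sqrt_nonneg _, fun l hl w w' hw hw' => ?_⟩
  have hl0 : 0 < l := by linarith
  have e : (Real.sqrt C * l ^ s) ^ 2 = C * l ^ (2 * s) := by
    rw [mul_pow, Real.sq_sqrt hC0, ← Real.rpow_natCast (l ^ s), ← Real.rpow_mul hl0.le, mul_comm s]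
    norm_num
  have hT : ∀ w : Sobolev d s,
      Tendsto (fun n => l • ζ + truncate n w) atTop (𝓝 (l • ζ + w)) := fun w =>
    (tendsto_truncate w).const_add _
  have hn : ∀ n, _ := fun n => hC l hl (truncate n w) (truncate n w') (isTrig_truncate n w)
    (isTrig_truncate n w') ((norm_truncate_le n w).trans hw) ((norm_truncate_le n w').trans hw')
  rw [mul_pow (Real.sqrt C * l ^ s), e]
  constructor
  · exact sqNorm_le_of_tendsto (l := atTop) (fun k => tendsto_compCoeff hs hg (hT w) k)
      (Eventually.of_forall fun n => (hn n).1)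
  · refine sqNorm_le_of_tendsto (l := atTop)
      (a := fun n => compCoeff g (l • ζ + truncate n w) - compCoeff g (l • ζ + truncate n w'))
      (fun k => (tendsto_compCoeff hs hg (hT w) k).sub (tendsto_compCoeff hs hg (hT w') k))
      (Eventually.of_forall fun n => (hn n).2.trans (ENNReal.ofReal_le_ofReal ?_))
    gcongr
    rw [← truncate_sub]
    exact norm_truncate_le n _

end

end Sobolev

/-! ### The nonlinear operator -/

namespace Sobolev

variable {s : ℝ}

/-- The properties of the superposition operator of `f` on which the control argument rests. The
operator is split as `F₁ + F₂`, where `F₁` acts in `H^s` with leading part `c uᵖ` and with growth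
and Lipschitz constant `O(λ^θ)`, `θ < p`, up to the leading part, near a large multiple `λζ` of a
trigonometric polynomial, while `F₂ : H^s → H^{s-1}` is bounded and globally Lipschitz. -/
structure IsNonlinearity (hs : (d : ℝ) / 2 < s) (f : ℝ → ℝ) (c : ℝ) (p : ℕ)
    (F₁ : Sobolev d s → Sobolev d s) (F₂ : Sobolev d s → Sobolev d (s - 1)) : Prop where
  coeff_eq : ∀ u k, fourierCoefficient (fun x => f (toFun u x)) k = coeff (F₁ u) k + coeff (F₂ u) k
  lipschitz₂ : ∃ L : ℝ, 0 ≤ L ∧ (∀ u, ‖F₂ u‖ ≤ L) ∧ ∀ u v, ‖F₂ u - F₂ v‖ ≤ L * ‖u - v‖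
  lipschitz₁ : ∃ θ : ℝ, θ < p ∧ ∀ ζ : Sobolev d s, IsTrig ζ → ∀ R : ℝ, ∃ C : ℝ, 0 ≤ C ∧
    ∀ l : ℝ, 1 ≤ l →
      ‖F₁ (l • ζ) - (c * l ^ p) • pow hs p ζ‖ ≤ C * l ^ θ ∧
      ∀ w w' : Sobolev d s, ‖w‖ ≤ R → ‖w'‖ ≤ R →
        ‖F₁ (l • ζ + w) - F₁ (l • ζ + w')‖ ≤ C * l ^ θ * ‖w - w'‖

theorem fourierCoefficient_polynomial_add (hs : (d : ℝ) / 2 < s) (P : Polynomial ℝ) {g : ℝ → ℝ}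
    (hg : BddSmooth g) (u : Sobolev d s) :
    fourierCoefficient (fun x => P.eval (toFun u x) + g (toFun u x))
      = coeff (polyComp hs P u) + compCoeff g u := by
  have h : ∀ x, P.eval (toFun u x) = toFun (polyComp hs P u) x := fun x =>
    (toFun_polyComp hs P u x).symm
  have hc : Continuous fun x => ((toFun (polyComp hs P u) x : ℝ) : ℂ) :=
    Complex.continuous_ofReal.comp (continuous_toFun hs _)
  rw [fourierCoefficient_eq_fcoef]
  simp only [h, Complex.ofReal_add]
  rw [fcoef_add hc (continuous_comp_toFun hs hg u), ← fourierCoefficient_toFun hs, fourierCoefficient_eq_fcoef]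
  rfl

theorem rpow_natCast_sub_one {p : ℕ} (hp : 2 ≤ p) (l : ℝ) :
    l ^ (p - 1) = l ^ ((p : ℝ) - 1) := by
  rw [← Real.rpow_natCast]
  congr 1
  rw [Nat.cast_sub (by omega)]
  simp

theorem isNonlinearity_polynomial (hs : (d : ℝ) / 2 < s) (P : Polynomial ℝ)
    (hP : 2 ≤ P.natDegree) :
    IsNonlinearity hs (fun y => P.eval y) P.leadingCoeff P.natDegree (polyComp hs P)
      (fun _ => 0) where
  coeff_eq u k := by
    have h : (fun x => P.eval (toFun u x)) = toFun (polyComp hs P u) := by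
      funext x; exact (toFun_polyComp hs P u x).symm
    rw [h, fourierCoefficient_toFun hs]
    simp
  lipschitz₂ := ⟨0, le_rfl, by simp, by simp⟩
  lipschitz₁ := by
    refine ⟨(P.natDegree : ℝ) - 1, by linarith, fun ζ _ R => ?_⟩
    obtain ⟨C, hC0, hC⟩ := exists_polyComp_lipschitz hs P (by omega) ζ R
    obtain ⟨C', hC0', hC'⟩ := exists_polyComp_leading hs P (by omega) ζ
    refine ⟨C + C', by positivity, fun l hl => ⟨?_, fun w w' hw hw' => ?_⟩⟩
    · rw [← rpow_natCast_sub_one hP]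
      refine (hC' l hl).trans ?_
      gcongr
      linarith
    · rw [← rpow_natCast_sub_one hP]
      refine (hC l hl w w' hw hw').trans ?_
      gcongr
      linarith

/-- The superposition operator of a bounded smooth function in `H^s`, `s ≥ 1`. -/
noncomputable def bddComp (hs : (d : ℝ) / 2 < s) (h1 : 1 ≤ s) {g : ℝ → ℝ} (hg : BddSmooth g)
    (u : Sobolev d s) : Sobolev d s :=
  ofCoeff (compCoeff g u) (compCoeff_neg u) (by
    obtain ⟨C, -, hC⟩ := exists_compCoeff_bound hs h1 isTrig_zero ‖u‖ hg
    have := (hC 1 le_rfl u u le_rfl le_rfl).1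
    rw [smul_zero, zero_add] at this
    exact ne_top_of_le_ne_top ENNReal.ofReal_ne_top this)

/-- For `s ≥ 1` the whole of `f` acts on `H^s`, with a growth exponent `max (p - 1) s < p` for everything
beyond the leading term. -/
theorem isNonlinearity_of_one_le (hs : (d : ℝ) / 2 < s) (h1 : 1 ≤ s) (P : Polynomial ℝ)
    (hP : 2 ≤ P.natDegree) {g : ℝ → ℝ} (hg : BddSmooth g) (hps : s < P.natDegree) :
    IsNonlinearity hs (fun y => P.eval y + g y) P.leadingCoeff P.natDegree
      (fun u => polyComp hs P u + bddComp hs h1 hg u) (fun _ => 0) where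
  coeff_eq u k := by
    rw [fourierCoefficient_polynomial_add hs P hg, map_add, bddComp, coeff_ofCoeff]
    simp
  lipschitz₂ := ⟨0, le_rfl, by simp, by simp⟩
  lipschitz₁ := by
    refine ⟨max ((P.natDegree : ℝ) - 1) s, max_lt (by linarith) hps, fun ζ hζ R => ?_⟩
    obtain ⟨C, hC0, hC⟩ := exists_polyComp_lipschitz hs P (by omega) ζ R
    obtain ⟨C', hC0', hC'⟩ := exists_polyComp_leading hs P (by omega) ζ
    obtain ⟨D, hD0, hD⟩ := exists_compCoeff_bound hs h1 hζ |R| hg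
    refine ⟨C + C' + D, by positivity, fun l hl => ?_⟩
    have hl0 : 0 < l := by linarith
    have p1 : l ^ ((P.natDegree : ℝ) - 1) ≤ l ^ max ((P.natDegree : ℝ) - 1) s :=
      Real.rpow_le_rpow_of_exponent_le hl (le_max_left _ _)
    have p2 : l ^ s ≤ l ^ max ((P.natDegree : ℝ) - 1) s :=
      Real.rpow_le_rpow_of_exponent_le hl (le_max_right _ _)
    set m := l ^ max ((P.natDegree : ℝ) - 1) s
    have hm : 0 ≤ m := by positivity
    refine ⟨?_, fun w w' hw hw' => ?_⟩
    · have a1 := hC' l hl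
      rw [rpow_natCast_sub_one hP] at a1
      have a2 : ‖bddComp hs h1 hg (l • ζ)‖ ≤ D * l ^ s := by
        refine norm_le_of_sqNorm_le (by positivity) ?_
        have := (hD l hl 0 0 (by simp) (by simp)).1
        rw [add_zero] at this
        rwa [bddComp, coeff_ofCoeff]
      rw [add_sub_right_comm]
      calc _ ≤ _ := norm_add_le _ _
        _ ≤ C' * l ^ ((P.natDegree : ℝ) - 1) + D * l ^ s := add_le_add a1 a2
        _ ≤ C' * m + D * m := by gcongr
        _ ≤ (C + C' + D) * m := by nlinarith
    · have a1 := hC l hl w w' hw hw'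
      rw [rpow_natCast_sub_one hP] at a1
      have a2 : ‖bddComp hs h1 hg (l • ζ + w) - bddComp hs h1 hg (l • ζ + w')‖
          ≤ D * l ^ s * ‖w - w'‖ := by
        refine norm_le_of_sqNorm_le (by positivity) ?_
        have := (hD l hl w w' (hw.trans (le_abs_self R)) (hw'.trans (le_abs_self R))).2
        rwa [map_sub, bddComp, coeff_ofCoeff, bddComp, coeff_ofCoeff]
      rw [add_sub_add_comm]
      calc _ ≤ _ := norm_add_le _ _
        _ ≤ C * l ^ ((P.natDegree : ℝ) - 1) * ‖w - w'‖ + D * l ^ s * ‖w - w'‖ := add_le_add a1 a2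
        _ ≤ C * m * ‖w - w'‖ + D * m * ‖w - w'‖ := by gcongr
        _ = (C + D) * m * ‖w - w'‖ := by ring
        _ ≤ _ := by gcongr; linarith

/-- The superposition operator of a bounded smooth function from `H^s` to `H^{s-1} ⊃ L²`,
`s ≤ 1`. -/
noncomputable def bddCompLow (hs : (d : ℝ) / 2 < s) (h1 : s ≤ 1) {g : ℝ → ℝ} (hg : BddSmooth g)
    (u : Sobolev d s) : Sobolev d (s - 1) :=
  ofCoeff (compCoeff g u) (compCoeff_neg u) (by
    obtain ⟨M, -, hM, -⟩ := exists_sqNorm_zero_compCoeff_le (d := d) hs hg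
    exact ne_top_of_le_ne_top ENNReal.ofReal_ne_top
      ((sqNorm_mono_exp (by linarith) _).trans (hM u)))

/-- For `s ≤ 1` composition with `g` is a bounded Lipschitz map into `L² ⊂ H^{s-1}`, where the heat flow
regains the missing derivative; only the polynomial part is kept in `H^s`. -/
theorem isNonlinearity_of_le_one (hs : (d : ℝ) / 2 < s) (h1 : s ≤ 1) (P : Polynomial ℝ)
    (hP : 2 ≤ P.natDegree) {g : ℝ → ℝ} (hg : BddSmooth g) :
    IsNonlinearity hs (fun y => P.eval y + g y) P.leadingCoeff P.natDegree
      (polyComp hs P) (bddCompLow hs h1 hg) where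
  coeff_eq u k := by
    rw [fourierCoefficient_polynomial_add hs P hg, bddCompLow, coeff_ofCoeff]
    simp
  lipschitz₂ := by
    obtain ⟨M, hM0, hM, hM'⟩ := exists_sqNorm_zero_compCoeff_le (d := d) hs hg
    refine ⟨Real.sqrt M, Real.sqrt_nonneg _, fun u => ?_, fun u v => ?_⟩
    · refine norm_le_of_sqNorm_le (Real.sqrt_nonneg _) ?_
      rw [Real.sq_sqrt hM0, bddCompLow, coeff_ofCoeff]
      exact (sqNorm_mono_exp (by linarith) _).trans (hM u)
    · refine norm_le_of_sqNorm_le (by positivity) ?_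
      rw [mul_pow, Real.sq_sqrt hM0, map_sub, bddCompLow, bddCompLow, coeff_ofCoeff, coeff_ofCoeff]
      exact (sqNorm_mono_exp (by linarith) _).trans (hM' u v)
  lipschitz₁ := (isNonlinearity_polynomial hs P hP).lipschitz₁

/-- `P + g` is admissible if `g = 0` or if `s` is smaller than the degree of `P`. -/
theorem exists_isNonlinearity (hs : (d : ℝ) / 2 < s) (P : Polynomial ℝ) (hP : 2 ≤ P.natDegree)
    {g : ℝ → ℝ} (hg : BddSmooth g) (hab : (∀ y, g y = 0) ∨ s < P.natDegree) :
    ∃ F₁ F₂, IsNonlinearity (d := d) hs (fun y => P.eval y + g y) P.leadingCoeff P.natDegree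
      F₁ F₂ := by
  rcases hab with h0 | hps
  · refine ⟨polyComp hs P, fun _ => 0, ?_⟩
    simpa only [h0, add_zero] using isNonlinearity_polynomial hs P hP
  · rcases le_total s 1 with h1 | h1
    · exact ⟨_, _, isNonlinearity_of_le_one hs h1 P hP hg⟩
    · exact ⟨_, _, isNonlinearity_of_one_le hs h1 P hP hg hps⟩

end Sobolev

/-! ### The heat semigroup and the Duhamel operator -/

/-- The multiplier `e^{-ν|k|²t}` of the heat semigroup. -/
noncomputable def heatKernel (ν : ℝ) (k : Fin d → ℤ) (t : ℝ) : ℝ := Real.exp (-(ν * freqSq k * t))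

section heatKernel

variable {ν : ℝ} (k : Fin d → ℤ)

theorem heatKernel_pos (t : ℝ) : 0 < heatKernel ν k t := Real.exp_pos _

theorem continuous_heatKernel : Continuous (heatKernel ν k) := by
  unfold heatKernel; fun_prop

@[simp] theorem heatKernel_zero : heatKernel ν k 0 = 1 := by simp [heatKernel]

theorem heatKernel_add (t t' : ℝ) :
    heatKernel ν k (t + t') = heatKernel ν k t * heatKernel ν k t' := by
  rw [heatKernel, heatKernel, heatKernel, ← Real.exp_add]; ring_nf

@[simp] theorem heatKernel_neg (t : ℝ) : heatKernel ν (-k) t = heatKernel ν k t := by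
  simp [heatKernel, freqSq]

theorem heatKernel_le_one (hν : 0 < ν) {t : ℝ} (ht : 0 ≤ t) : heatKernel ν k t ≤ 1 := by
  rw [heatKernel, Real.exp_le_one_iff]
  have := freqSq_nonneg k
  have : 0 ≤ ν * freqSq k * t := by positivity
  linarith

theorem one_sub_heatKernel_le (t : ℝ) : 1 - heatKernel ν k t ≤ ν * freqSq k * t := by
  have := Real.add_one_le_exp (-(ν * freqSq k * t))
  rw [heatKernel]
  linarith

/-- The integral of the heat multiplier is bounded by the length of the interval, and gains two
derivatives. -/
theorem lintegral_heatKernel_le (hν : 0 < ν) {a t : ℝ} (hat : a ≤ t) :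
    ENNReal.ofReal (1 + freqSq k) * ∫⁻ τ in Set.Icc a t, ENNReal.ofReal (heatKernel ν k (t - τ))
      ≤ ENNReal.ofReal (t - a + ν⁻¹) := by
  have hint : IntegrableOn (fun τ => heatKernel ν k (t - τ)) (Set.Icc a t) :=
    (((continuous_heatKernel k).comp (continuous_const.sub continuous_id)).integrableOn_Icc)
  rw [← ofReal_integral_eq_lintegral_ofReal hint
      (Eventually.of_forall fun τ => (heatKernel_pos k _).le),
    ← ENNReal.ofReal_mul (one_add_freqSq_pos k).le]
  refine ENNReal.ofReal_le_ofReal ?_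
  rw [integral_Icc_eq_integral_Ioc, ← intervalIntegral.integral_of_le hat]
  have h1 : ∫ τ in a..t, heatKernel ν k (t - τ) ≤ t - a := by
    have hi : IntervalIntegrable (fun τ => heatKernel ν k (t - τ)) volume a t :=
      ((continuous_heatKernel k).comp (continuous_const.sub continuous_id)).intervalIntegrable a t
    have := intervalIntegral.integral_mono_on hat hi (intervalIntegrable_const (c := (1 : ℝ)))
      (fun τ hτ => heatKernel_le_one k hν (sub_nonneg.2 hτ.2))
    simpa using this
  have h2 : freqSq k * ∫ τ in a..t, heatKernel ν k (t - τ) ≤ ν⁻¹ := by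
    have hderiv : ∀ τ ∈ Set.uIcc a t, HasDerivAt (fun τ => heatKernel ν k (t - τ))
        (ν * freqSq k * heatKernel ν k (t - τ)) τ := by
      intro τ _
      have h0 : HasDerivAt (fun τ : ℝ => -(ν * freqSq k * (t - τ))) (ν * freqSq k) τ := by
        have := (((hasDerivAt_id τ).const_sub t).const_mul (ν * freqSq k)).fun_neg
        simpa using this
      have := h0.exp
      simpa [heatKernel, mul_comm] using this
    have hi : IntervalIntegrable (fun τ => ν * freqSq k * heatKernel ν k (t - τ)) volume a t :=
      (continuous_const.mul ((continuous_heatKernel k).comp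
        (continuous_const.sub continuous_id))).intervalIntegrable a t
    have h3 := intervalIntegral.integral_eq_sub_of_hasDerivAt hderiv hi
    rw [intervalIntegral.integral_const_mul, sub_self, heatKernel_zero] at h3
    have h4 := heatKernel_pos (ν := ν) k (t - a)
    rw [← mul_le_mul_iff_right₀ hν, mul_inv_cancel₀ hν.ne', ← mul_assoc, h3]
    linarith
  linarith [add_mul 1 (freqSq k) (∫ τ in a..t, heatKernel ν k (t - τ))]

theorem lintegral_heatKernel_le_length (hν : 0 < ν) {a t : ℝ} :
    ∫⁻ τ in Set.Icc a t, ENNReal.ofReal (heatKernel ν k (t - τ)) ≤ ENNReal.ofReal (t - a) := by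
  calc _ ≤ ∫⁻ τ in Set.Icc a t, 1 := by
        refine setLIntegral_mono measurable_const fun τ hτ => ?_
        rw [ENNReal.ofReal_le_one]
        exact heatKernel_le_one k hν (sub_nonneg.2 hτ.2)
    _ = _ := by simp

end heatKernel

/-- Cauchy–Schwarz for integrals in `[0, ∞]`. -/
theorem lintegral_mul_sq_le {α : Type*} [MeasurableSpace α] {μ : Measure α} {f g : α → ℝ≥0∞}
    (hf : AEMeasurable f μ) (hg : AEMeasurable g μ) :
    (∫⁻ x, f x * g x ∂μ) ^ 2 ≤ (∫⁻ x, f x ^ 2 ∂μ) * ∫⁻ x, g x ^ 2 ∂μ := by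
  have h := ENNReal.lintegral_mul_le_Lp_mul_Lq μ Real.HolderConjugate.two_two hf hg
  refine (pow_le_pow_left' h 2).trans_eq ?_
  rw [mul_pow, ← ENNReal.rpow_natCast, ← ENNReal.rpow_mul, ← ENNReal.rpow_natCast,
    ← ENNReal.rpow_mul]
  norm_num

/-- The Fourier coefficients of the Duhamel integral `∫_a^t e^{ν(t-τ)Δ} φ(τ) dτ`. -/
noncomputable def duhamelSeq {r : ℝ} (ν a t : ℝ) (φ : ℝ → Sobolev d r) (k : Fin d → ℤ) : ℂ :=
  ∫ τ in a..t, (heatKernel ν k (t - τ) : ℂ) * Sobolev.coeff (φ τ) k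

/-- Young's inequality for the convolution with the heat multiplier, before integrating in `t`. -/
theorem enorm_integral_heatKernel_sq_le {ν : ℝ} (k : Fin d → ℤ) {a t : ℝ} (hat : a ≤ t)
    {ψ : ℝ → ℂ} (hψ : AEStronglyMeasurable ψ (volume.restrict (Set.Icc a t))) :
    ‖∫ τ in a..t, (heatKernel ν k (t - τ) : ℂ) * ψ τ‖ₑ ^ 2
      ≤ (∫⁻ τ in Set.Icc a t, ENNReal.ofReal (heatKernel ν k (t - τ)))
        * ∫⁻ τ in Set.Icc a t, ENNReal.ofReal (heatKernel ν k (t - τ)) * ‖ψ τ‖ₑ ^ 2 := by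
  have hK : Measurable fun τ => ENNReal.ofReal (heatKernel ν k (t - τ)) :=
    ((continuous_heatKernel k).comp (continuous_const.sub continuous_id)).measurable.ennreal_ofReal
  have e : ∀ x : ℝ≥0∞, (x ^ (1 / 2 : ℝ)) ^ 2 = x := fun x => by
    rw [← ENNReal.rpow_natCast, ← ENNReal.rpow_mul]; norm_num
  have h1 : ‖∫ τ in a..t, (heatKernel ν k (t - τ) : ℂ) * ψ τ‖ₑ
      ≤ ∫⁻ τ in Set.Icc a t, ENNReal.ofReal (heatKernel ν k (t - τ)) ^ (1 / 2 : ℝ)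
        * (ENNReal.ofReal (heatKernel ν k (t - τ)) ^ (1 / 2 : ℝ) * ‖ψ τ‖ₑ) := by
    rw [intervalIntegral.integral_of_le hat, ← integral_Icc_eq_integral_Ioc]
    refine (enorm_integral_le_lintegral_enorm _).trans_eq ?_
    refine lintegral_congr fun τ => ?_
    rw [← mul_assoc, ← pow_two, e, enorm_mul, ← ofReal_norm, Complex.norm_real,
      Real.norm_of_nonneg (heatKernel_pos k _).le]
  refine (pow_le_pow_left' h1 2).trans ((lintegral_mul_sq_le (hK.pow_const _).aemeasurable
    ((hK.pow_const _).aemeasurable.mul hψ.enorm)).trans_eq ?_)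
  simp only [Pi.mul_apply, mul_pow, e]

theorem enorm_integral_heatKernel_sq_le' {ν : ℝ} (hν : 0 < ν) (k : Fin d → ℤ) {a t : ℝ}
    (hat : a ≤ t) {ψ : ℝ → ℂ} (hψ : AEStronglyMeasurable ψ (volume.restrict (Set.Icc a t))) :
    ‖∫ τ in a..t, (heatKernel ν k (t - τ) : ℂ) * ψ τ‖ₑ ^ 2
      ≤ (∫⁻ τ in Set.Icc a t, ENNReal.ofReal (heatKernel ν k (t - τ)))
        * ∫⁻ τ in Set.Icc a t, ‖ψ τ‖ₑ ^ 2 := by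
  refine (enorm_integral_heatKernel_sq_le k hat hψ).trans (mul_le_mul_right ?_ _)
  refine lintegral_mono_ae ?_
  filter_upwards [ae_restrict_mem measurableSet_Icc] with τ hτ
  refine mul_le_of_le_one_left' ?_
  rw [ENNReal.ofReal_le_one]
  exact heatKernel_le_one k hν (sub_nonneg.2 hτ.2)

namespace Sobolev

variable {r s ν : ℝ}

theorem aestronglyMeasurable_coeff {φ : ℝ → Sobolev d r} {μ : Measure ℝ}
    (hφ : AEStronglyMeasurable φ μ) (k : Fin d → ℤ) :
    AEStronglyMeasurable (fun τ => coeff (φ τ) k) μ :=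
  (continuous_coeff k).comp_aestronglyMeasurable hφ

theorem lintegral_sqNorm {φ : ℝ → Sobolev d r} {μ : Measure ℝ}
    (hφ : AEStronglyMeasurable φ μ) :
    ∑' k, ENNReal.ofReal ((1 + freqSq k) ^ r) * ∫⁻ τ, ‖coeff (φ τ) k‖ₑ ^ 2 ∂μ
      = ∫⁻ τ, ‖φ τ‖ₑ ^ 2 ∂μ := by
  simp only [← sqNorm_coeff, sqNorm]
  rw [lintegral_tsum fun k =>
    ((aestronglyMeasurable_coeff hφ k).enorm.pow_const 2).const_mul _]
  refine tsum_congr fun k => ?_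
  rw [lintegral_const_mul'' _ ((aestronglyMeasurable_coeff hφ k).enorm.pow_const 2)]

/-- The Duhamel operator is bounded in `H^r`, with norm the length of the time interval. -/
theorem sqNorm_duhamelSeq_le (hν : 0 < ν) {a t : ℝ} (hat : a ≤ t) {φ : ℝ → Sobolev d r}
    (hφ : AEStronglyMeasurable φ (volume.restrict (Set.Icc a t))) :
    sqNorm r (duhamelSeq ν a t φ)
      ≤ ENNReal.ofReal (t - a) * ∫⁻ τ in Set.Icc a t, ‖φ τ‖ₑ ^ 2 := by
  rw [← lintegral_sqNorm hφ, ← ENNReal.tsum_mul_left]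
  refine ENNReal.tsum_le_tsum fun k => ?_
  rw [mul_left_comm]
  gcongr
  refine (enorm_integral_heatKernel_sq_le' hν k hat (aestronglyMeasurable_coeff hφ k)).trans ?_
  gcongr
  exact lintegral_heatKernel_le_length k hν

/-- One Fourier mode of the smoothing estimate `L²(H^{s-1}) → C(H^s)` for the Duhamel operator:
Cauchy–Schwarz against the heat kernel gains the factor `1 + |k|²`. -/
theorem smoothing_term_le (hν : 0 < ν) {a t : ℝ} (hat : a ≤ t) {φ : ℝ → Sobolev d (s - 1)}
    (hφ : AEStronglyMeasurable φ (volume.restrict (Set.Icc a t))) (k : Fin d → ℤ) :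
    ENNReal.ofReal ((1 + freqSq k) ^ s) * ‖duhamelSeq ν a t φ k‖ₑ ^ 2
      ≤ ENNReal.ofReal (t - a + ν⁻¹) * (ENNReal.ofReal ((1 + freqSq k) ^ (s - 1))
        * ∫⁻ τ in Set.Icc a t, ‖coeff (φ τ) k‖ₑ ^ 2) := by
  have h2 : ENNReal.ofReal ((1 + freqSq k) ^ s)
      = ENNReal.ofReal ((1 + freqSq k) ^ (s - 1)) * ENNReal.ofReal (1 + freqSq k) := by
    rw [← ENNReal.ofReal_mul (Real.rpow_nonneg (one_add_freqSq_pos k).le _),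
      ← Real.rpow_add_one (one_add_freqSq_pos k).ne']
    congr 2; ring
  rw [h2]
  calc _ ≤ ENNReal.ofReal ((1 + freqSq k) ^ (s - 1)) * ENNReal.ofReal (1 + freqSq k) *
        ((∫⁻ τ in Set.Icc a t, ENNReal.ofReal (heatKernel ν k (t - τ)))
        * ∫⁻ τ in Set.Icc a t, ‖coeff (φ τ) k‖ₑ ^ 2) := by
        gcongr
        exact enorm_integral_heatKernel_sq_le' hν k hat (aestronglyMeasurable_coeff hφ k)
    _ = (ENNReal.ofReal (1 + freqSq k) *
        ∫⁻ τ in Set.Icc a t, ENNReal.ofReal (heatKernel ν k (t - τ))) *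
        (ENNReal.ofReal ((1 + freqSq k) ^ (s - 1))
        * ∫⁻ τ in Set.Icc a t, ‖coeff (φ τ) k‖ₑ ^ 2) := by ring
    _ ≤ _ := by
        gcongr
        exact lintegral_heatKernel_le k hν hat

/-- Parabolic smoothing: the Duhamel operator maps `L²(H^{s-1})` into bounded functions with values
in `H^s`. -/
theorem sqNorm_duhamelSeq_smoothing_le (hν : 0 < ν) {a t : ℝ} (hat : a ≤ t)
    {φ : ℝ → Sobolev d (s - 1)}
    (hφ : AEStronglyMeasurable φ (volume.restrict (Set.Icc a t))) :
    sqNorm s (duhamelSeq ν a t φ)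
      ≤ ENNReal.ofReal (t - a + ν⁻¹) * ∫⁻ τ in Set.Icc a t, ‖φ τ‖ₑ ^ 2 := by
  rw [← lintegral_sqNorm hφ, ← ENNReal.tsum_mul_left]
  exact ENNReal.tsum_le_tsum fun k => smoothing_term_le hν hat hφ k

theorem duhamelSeq_neg (a t : ℝ) (φ : ℝ → Sobolev d r) (k : Fin d → ℤ) :
    duhamelSeq ν a t φ (-k) = (starRingEnd ℂ) (duhamelSeq ν a t φ k) := by
  rw [duhamelSeq, duhamelSeq, intervalIntegral, intervalIntegral, map_sub, ← integral_conj,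
    ← integral_conj]
  congr 2 <;> funext τ <;>
  simp only [coeff_neg, heatKernel_neg, map_mul, Complex.conj_ofReal]

open Classical in
/-- The Duhamel integral `∫_a^t e^{ν(t-τ)Δ} φ(τ) dτ` as an element of `H^s`; zero by convention when
its coefficients do not belong to `H^s`. -/
noncomputable def duhamel (s ν a t : ℝ) (φ : ℝ → Sobolev d r) : Sobolev d s :=
  if h : sqNorm s (duhamelSeq ν a t φ) ≠ ⊤ then
    ofCoeff (duhamelSeq ν a t φ) (duhamelSeq_neg a t φ) h else 0

theorem lintegral_enorm_sq_ne_top {φ : ℝ → Sobolev d r} {μ : Measure ℝ} (hφ : MemLp φ 2 μ) :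
    ∫⁻ τ, ‖φ τ‖ₑ ^ 2 ∂μ ≠ ⊤ := by
  have h := hφ.2
  rw [eLpNorm_lt_top_iff_lintegral_rpow_enorm_lt_top (by norm_num) (by norm_num)] at h
  simpa using h.ne

theorem memLp_two_of_lintegral {φ : ℝ → Sobolev d r} {μ : Measure ℝ}
    (hm : AEStronglyMeasurable φ μ) (h : ∫⁻ τ, ‖φ τ‖ₑ ^ 2 ∂μ ≠ ⊤) : MemLp φ 2 μ := by
  refine ⟨hm, ?_⟩
  rw [eLpNorm_lt_top_iff_lintegral_rpow_enorm_lt_top (by norm_num) (by norm_num)]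
  simpa using h.lt_top

theorem MemLp.restrict_Icc {φ : ℝ → Sobolev d r} {a b a' b' : ℝ} (ha : a ≤ a') (hb : b' ≤ b)
    (hφ : MemLp φ 2 (volume.restrict (Set.Icc a b))) :
    MemLp φ 2 (volume.restrict (Set.Icc a' b')) :=
  hφ.mono_measure (Measure.restrict_mono (Set.Icc_subset_Icc ha hb) le_rfl)

variable {a b t : ℝ} {φ ψ : ℝ → Sobolev d (s - 1)}

theorem coeff_duhamel (hν : 0 < ν) (hφ : MemLp φ 2 (volume.restrict (Set.Icc a b)))
    (ht : t ∈ Set.Icc a b) (k : Fin d → ℤ) :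
    coeff (duhamel s ν a t φ) k = duhamelSeq ν a t φ k := by
  have hφ' := MemLp.restrict_Icc le_rfl ht.2 hφ
  have h : sqNorm s (duhamelSeq ν a t φ) ≠ ⊤ :=
    ne_top_of_le_ne_top (ENNReal.mul_ne_top ENNReal.ofReal_ne_top
      (lintegral_enorm_sq_ne_top hφ')) (sqNorm_duhamelSeq_smoothing_le hν ht.1 hφ'.1)
  rw [duhamel, dif_pos h, coeff_ofCoeff]

theorem intervalIntegrable_coeff (hφ : MemLp φ 2 (volume.restrict (Set.Icc a b)))
    (ht : t ∈ Set.Icc a b) (k : Fin d → ℤ) :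
    IntervalIntegrable (fun τ => coeff (φ τ) k) volume a t := by
  have h1 := (hφ.integrable (by norm_num)).norm
  have h2 : Integrable (fun τ => coeff (φ τ) k) (volume.restrict (Set.Icc a b)) :=
    (coeffCLM k).integrable_comp (hφ.integrable (by norm_num))
  rw [intervalIntegrable_iff_integrableOn_Icc_of_le ht.1]
  exact IntegrableOn.mono_set h2 (Set.Icc_subset_Icc le_rfl ht.2)

theorem intervalIntegrable_heat (hφ : MemLp φ 2 (volume.restrict (Set.Icc a b)))
    (ht : t ∈ Set.Icc a b) (k : Fin d → ℤ) :
    IntervalIntegrable (fun τ => (heatKernel ν k (t - τ) : ℂ) * coeff (φ τ) k) volume a t :=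
  (intervalIntegrable_coeff hφ ht k).continuousOn_mul
    (Complex.continuous_ofReal.comp
      ((continuous_heatKernel k).comp (continuous_const.sub continuous_id))).continuousOn

theorem duhamel_add (hν : 0 < ν) (hφ : MemLp φ 2 (volume.restrict (Set.Icc a b)))
    (hψ : MemLp ψ 2 (volume.restrict (Set.Icc a b))) (ht : t ∈ Set.Icc a b) :
    duhamel s ν a t (fun τ => φ τ + ψ τ) = duhamel s ν a t φ + duhamel s ν a t ψ := by
  have hd : MemLp (fun τ => φ τ + ψ τ) 2 (volume.restrict (Set.Icc a b)) := hφ.add hψ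
  ext k
  rw [map_add, Pi.add_apply, coeff_duhamel hν hd ht, coeff_duhamel hν hφ ht,
    coeff_duhamel hν hψ ht, duhamelSeq, duhamelSeq, duhamelSeq,
    ← intervalIntegral.integral_add (intervalIntegrable_heat hφ ht k)
      (intervalIntegrable_heat hψ ht k)]
  refine intervalIntegral.integral_congr fun τ _ => ?_
  simp [mul_add]

theorem duhamel_sub (hν : 0 < ν) (hφ : MemLp φ 2 (volume.restrict (Set.Icc a b)))
    (hψ : MemLp ψ 2 (volume.restrict (Set.Icc a b))) (ht : t ∈ Set.Icc a b) :
    duhamel s ν a t (fun τ => φ τ - ψ τ) = duhamel s ν a t φ - duhamel s ν a t ψ := by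
  have hd : MemLp (fun τ => φ τ - ψ τ) 2 (volume.restrict (Set.Icc a b)) := hφ.sub hψ
  ext k
  rw [map_sub, Pi.sub_apply, coeff_duhamel hν hd ht, coeff_duhamel hν hφ ht,
    coeff_duhamel hν hψ ht, duhamelSeq, duhamelSeq, duhamelSeq,
    ← intervalIntegral.integral_sub (intervalIntegrable_heat hφ ht k)
      (intervalIntegrable_heat hψ ht k)]
  refine intervalIntegral.integral_congr fun τ _ => ?_
  simp [mul_sub]

theorem norm_duhamel_le_of_lintegral (hν : 0 < ν)
    (hφ : MemLp φ 2 (volume.restrict (Set.Icc a b))) (ht : t ∈ Set.Icc a b) {B : ℝ} (hB : 0 ≤ B)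
    (h : ENNReal.ofReal (b - a + ν⁻¹) * ∫⁻ τ in Set.Icc a b, ‖φ τ‖ₑ ^ 2
      ≤ ENNReal.ofReal (B ^ 2)) :
    ‖duhamel s ν a t φ‖ ≤ B := by
  refine norm_le_of_sqNorm_le hB (le_trans ?_ h)
  have e : coeff (duhamel s ν a t φ) = duhamelSeq ν a t φ := funext (coeff_duhamel hν hφ ht)
  rw [e]
  refine (sqNorm_duhamelSeq_smoothing_le hν ht.1
    (MemLp.restrict_Icc le_rfl ht.2 hφ).1).trans ?_
  gcongr
  · exact ht.2
  · exact ht.2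

/-- The `H^{s-1} → H^s` bound for a source which is bounded in `H^{s-1}`. -/
theorem norm_duhamel_le_sqrt (hν : 0 < ν) (hφ : MemLp φ 2 (volume.restrict (Set.Icc a b)))
    (ht : t ∈ Set.Icc a b) {m : ℝ} (hm0 : 0 ≤ m) (hm : ∀ τ ∈ Set.Icc a b, ‖φ τ‖ ≤ m) :
    ‖duhamel s ν a t φ‖ ≤ Real.sqrt ((b - a + ν⁻¹) * (b - a)) * m := by
  have hba : 0 ≤ b - a := sub_nonneg.2 (ht.1.trans ht.2)
  have hν' : 0 < ν⁻¹ := inv_pos.2 hν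
  refine norm_duhamel_le_of_lintegral hν hφ ht (by positivity) ?_
  have h1 : ∫⁻ τ in Set.Icc a b, ‖φ τ‖ₑ ^ 2 ≤ ENNReal.ofReal ((b - a) * m ^ 2) := by
    calc _ ≤ ∫⁻ τ in Set.Icc a b, ENNReal.ofReal (m ^ 2) := by
          refine setLIntegral_mono measurable_const fun τ hτ => ?_
          rw [← ofReal_norm, ← ENNReal.ofReal_pow (norm_nonneg _)]
          have := hm τ hτ
          gcongr
      _ = _ := by
          rw [lintegral_const, Measure.restrict_apply_univ, Real.volume_Icc,
            ← ENNReal.ofReal_mul (by positivity), mul_comm]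
  refine (mul_le_mul_right h1 _).trans_eq ?_
  rw [← ENNReal.ofReal_mul (by positivity), mul_pow, Real.sq_sqrt (by positivity), mul_assoc]

theorem sub_one_le_self : s - 1 ≤ s := by linarith

/-- The `H^s → H^s` bound for a source which is bounded in `H^s`. -/
theorem norm_duhamel_incl_le (hν : 0 < ν) {χ : ℝ → Sobolev d s}
    (hχ : AEStronglyMeasurable χ (volume.restrict (Set.Icc a b)))
    (hχ2 : MemLp (fun τ => incl (r' := s - 1) sub_one_le_self (χ τ)) 2
      (volume.restrict (Set.Icc a b)))
    (ht : t ∈ Set.Icc a b) {m : ℝ} (hm0 : 0 ≤ m) (hm : ∀ τ ∈ Set.Icc a b, ‖χ τ‖ ≤ m) :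
    ‖duhamel s ν a t (fun τ => incl (r' := s - 1) sub_one_le_self (χ τ))‖ ≤ (b - a) * m := by
  have hba : 0 ≤ b - a := sub_nonneg.2 (ht.1.trans ht.2)
  refine norm_le_of_sqNorm_le (by positivity) ?_
  have e : coeff (duhamel s ν a t (fun τ => incl (r' := s - 1) sub_one_le_self (χ τ)))
      = duhamelSeq ν a t χ := by
    funext k
    rw [coeff_duhamel hν hχ2 ht, duhamelSeq, duhamelSeq]
    simp only [coeff_incl]
  rw [e]
  have hχ' : AEStronglyMeasurable χ (volume.restrict (Set.Icc a t)) :=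
    hχ.mono_measure (Measure.restrict_mono (Set.Icc_subset_Icc le_rfl ht.2) le_rfl)
  refine (sqNorm_duhamelSeq_le hν ht.1 hχ').trans ?_
  have h1 : ∫⁻ τ in Set.Icc a t, ‖χ τ‖ₑ ^ 2 ≤ ENNReal.ofReal ((b - a) * m ^ 2) := by
    calc _ ≤ ∫⁻ τ in Set.Icc a t, ENNReal.ofReal (m ^ 2) := by
          refine setLIntegral_mono measurable_const fun τ hτ => ?_
          rw [← ofReal_norm, ← ENNReal.ofReal_pow (norm_nonneg _)]
          have := hm τ ⟨hτ.1, hτ.2.trans ht.2⟩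
          gcongr
      _ ≤ _ := by
          rw [lintegral_const, Measure.restrict_apply_univ, Real.volume_Icc,
            ← ENNReal.ofReal_mul (by positivity), mul_comm]
          gcongr
          exact ht.2
  calc _ ≤ ENNReal.ofReal (b - a) * ENNReal.ofReal ((b - a) * m ^ 2) := by
        gcongr
        exact ht.2
    _ = _ := by
        rw [← ENNReal.ofReal_mul hba]
        congr 1
        ring

theorem continuousOn_duhamelSeq (hφ : MemLp φ 2 (volume.restrict (Set.Icc a b))) (hab : a ≤ b)
    (k : Fin d → ℤ) : ContinuousOn (fun t => duhamelSeq ν a t φ k) (Set.Icc a b) := by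
  have e : ∀ t, duhamelSeq ν a t φ k = (heatKernel ν k t : ℂ) *
      ∫ τ in a..t, (heatKernel ν k (-τ) : ℂ) * coeff (φ τ) k := by
    intro t
    rw [duhamelSeq, ← intervalIntegral.integral_const_mul]
    refine intervalIntegral.integral_congr fun τ _ => ?_
    simp only [sub_eq_add_neg, heatKernel_add]
    push_cast
    ring
  simp only [e]
  refine (Complex.continuous_ofReal.comp (continuous_heatKernel k)).continuousOn.mul ?_
  have hi : IntervalIntegrable (fun τ => (heatKernel ν k (-τ) : ℂ) * coeff (φ τ) k) volume a b :=
    (intervalIntegrable_coeff hφ ⟨hab, le_rfl⟩ k).continuousOn_mul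
      (Complex.continuous_ofReal.comp ((continuous_heatKernel k).comp continuous_neg)).continuousOn
  have := intervalIntegral.continuousOn_primitive_interval' hi Set.left_mem_uIcc
  rwa [Set.uIcc_of_le hab] at this

theorem norm_sub_sq_le (x y : ℂ) : ‖x - y‖ ^ 2 ≤ 2 * ‖x‖ ^ 2 + 2 * ‖y‖ ^ 2 := by
  have := norm_sub_le x y
  have h0 := norm_nonneg (x - y)
  nlinarith [sq_nonneg (‖x‖ - ‖y‖)]

/-- A path in `H^s` with continuous coefficients and a summable majorant is continuous. -/
theorem continuousOn_of_dominated {u : ℝ → Sobolev d s} {S : Set ℝ} {β : (Fin d → ℤ) → ℝ}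
    (hβ : Summable β) (hc : ∀ k, ContinuousOn (fun t => coeff (u t) k) S)
    (hb : ∀ t ∈ S, ∀ k, (1 + freqSq k) ^ s * ‖coeff (u t) k‖ ^ 2 ≤ β k) : ContinuousOn u S := by
  intro t ht
  refine tendsto_of_dominated (b := fun k => 4 * β k) (hβ.mul_left 4) (fun k => hc k t ht) ?_
  filter_upwards [self_mem_nhdsWithin] with t' ht' k
  have h1 := hb t ht k
  have h2 := hb t' ht' k
  have hp := Real.rpow_nonneg (one_add_freqSq_pos k).le s
  have := mul_le_mul_of_nonneg_left (norm_sub_sq_le (coeff (u t') k) (coeff (u t) k)) hp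
  linarith

theorem continuousOn_duhamel (hν : 0 < ν) (hφ : MemLp φ 2 (volume.restrict (Set.Icc a b)))
    (hab : a ≤ b) : ContinuousOn (fun t => duhamel s ν a t φ) (Set.Icc a b) := by
  set M : (Fin d → ℤ) → ℝ≥0∞ := fun k => ENNReal.ofReal (b - a + ν⁻¹) *
    (ENNReal.ofReal ((1 + freqSq k) ^ (s - 1)) * ∫⁻ τ in Set.Icc a b, ‖coeff (φ τ) k‖ₑ ^ 2)
  have hM : ∑' k, M k ≠ ⊤ := by
    rw [ENNReal.tsum_mul_left, lintegral_sqNorm hφ.1]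
    exact ENNReal.mul_ne_top ENNReal.ofReal_ne_top (lintegral_enorm_sq_ne_top hφ)
  refine continuousOn_of_dominated (ENNReal.summable_toReal hM) (fun k => ?_) fun t ht k => ?_
  · exact (continuousOn_duhamelSeq hφ hab k).congr fun t ht => coeff_duhamel hν hφ ht k
  · rw [coeff_duhamel hν hφ ht, ← ENNReal.ofReal_le_iff_le_toReal
      (ENNReal.ne_top_of_tsum_ne_top hM k), ← enorm_coeff_sq]
    refine (smoothing_term_le hν ht.1 (MemLp.restrict_Icc le_rfl ht.2 hφ).1 k).trans ?_
    simp only [M]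
    gcongr
    · exact ht.2
    · exact ht.2

end Sobolev

/-! ### Mild and integrated forms of the equation for one Fourier mode -/

theorem hasDerivAt_integral_of_continuousOn {f : ℝ → ℂ} {a b t : ℝ}
    (hf : ContinuousOn f (Set.Icc a b)) (ht : t ∈ Set.Ioo a b) :
    HasDerivAt (fun t => ∫ τ in a..t, f τ) (f t) t := by
  refine intervalIntegral.integral_hasDerivAt_right ?_ ?_ ?_
  · exact (hf.mono (Set.Icc_subset_Icc le_rfl ht.2.le)).intervalIntegrable_of_Icc ht.1.le
  · exact (hf.mono Set.Ioo_subset_Icc_self).stronglyMeasurableAtFilter isOpen_Ioo t ht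
  · exact hf.continuousAt (Icc_mem_nhds ht.1 ht.2)

/-- Fubini's theorem on a triangle. -/
theorem integral_integral_triangle {φ ψ : ℝ → ℂ} {a t : ℝ} (hat : a ≤ t) (hφ : Continuous φ)
    (hψ : IntervalIntegrable ψ volume a t) :
    ∫ τ in a..t, (∫ σ in τ..t, φ σ) * ψ τ = ∫ σ in a..t, φ σ * ∫ τ in a..σ, ψ τ := by
  have hψ' : Integrable ψ (volume.restrict (Set.Ioc a t)) :=
    (intervalIntegrable_iff_integrableOn_Ioc_of_le hat).1 hψ
  have hφ' : Integrable φ (volume.restrict (Set.Ioc a t)) :=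
    (hφ.integrableOn_Icc).mono_set Set.Ioc_subset_Icc_self
  have hS : MeasurableSet {q : ℝ × ℝ | q.1 < q.2} := measurableSet_lt measurable_fst measurable_snd
  have hint : Integrable (Function.uncurry fun τ σ : ℝ =>
      Set.indicator {q : ℝ × ℝ | q.1 < q.2} (fun q => ψ q.1 * φ q.2) (τ, σ))
      ((volume.restrict (Set.Ioc a t)).prod (volume.restrict (Set.Ioc a t))) :=
    (hψ'.mul_prod hφ').indicator hS
  have h := integral_integral_swap hint
  rw [intervalIntegral.integral_of_le hat, intervalIntegral.integral_of_le hat]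
  refine Eq.trans ?_ (h.trans ?_)
  · refine setIntegral_congr_fun measurableSet_Ioc fun τ hτ => ?_
    have e : (fun σ => Set.indicator {q : ℝ × ℝ | q.1 < q.2} (fun q => ψ q.1 * φ q.2) (τ, σ))
        = Set.indicator (Set.Ioi τ) fun σ => ψ τ * φ σ := by
      funext σ; simp [Set.indicator]
    simp only [e]
    rw [setIntegral_indicator measurableSet_Ioi, integral_const_mul,
      intervalIntegral.integral_of_le hτ.2, mul_comm]
    congr 3
    ext σ
    simp only [Set.mem_Ioc, Set.mem_inter_iff, Set.mem_Ioi]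
    constructor
    · exact fun h => ⟨⟨hτ.1.trans h.1, h.2⟩, h.1⟩
    · exact fun h => ⟨h.2, h.1.2⟩
  · refine setIntegral_congr_fun measurableSet_Ioc fun σ hσ => ?_
    have e : (fun τ => Set.indicator {q : ℝ × ℝ | q.1 < q.2} (fun q => ψ q.1 * φ q.2) (τ, σ))
        = Set.indicator (Set.Iio σ) fun τ => ψ τ * φ σ := by
      funext τ; simp [Set.indicator]
    simp only [e]
    rw [setIntegral_indicator measurableSet_Iio, integral_mul_const,
      intervalIntegral.integral_of_le hσ.1.le, mul_comm, integral_Ioc_eq_integral_Ioo]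
    congr 3
    ext τ
    simp only [Set.mem_Ioo, Set.mem_Ioc, Set.mem_inter_iff, Set.mem_Iio]
    constructor
    · exact fun h => ⟨h.1.1, h.2⟩
    · exact fun h => ⟨⟨h.1, h.2.le.trans hσ.2⟩, h.2⟩

section mode

variable {ν : ℝ} (k : Fin d → ℤ)

theorem hasDerivAt_heatKernel (t : ℝ) :
    HasDerivAt (fun t => (heatKernel ν k t : ℂ)) (-(ν * freqSq k : ℝ) * heatKernel ν k t) t := by
  have h0 : HasDerivAt (fun τ : ℝ => -(ν * freqSq k * τ)) (-(ν * freqSq k)) t := by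
    simpa using ((hasDerivAt_id t).const_mul (ν * freqSq k)).fun_neg
  have := h0.exp.ofReal_comp
  convert! this using 1
  simp only [heatKernel]
  push_cast
  ring

theorem continuous_heatKernel_ofReal : Continuous fun t => (heatKernel ν k t : ℂ) :=
  Complex.continuous_ofReal.comp (continuous_heatKernel k)

theorem heatKernel_sub (t τ : ℝ) :
    heatKernel ν k (t - τ) = heatKernel ν k t * heatKernel ν k (-τ) := by
  rw [sub_eq_add_neg, heatKernel_add]

theorem heatKernel_mul_neg (t : ℝ) : (heatKernel ν k t : ℂ) * heatKernel ν k (-t) = 1 := by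
  rw [← Complex.ofReal_mul, ← heatKernel_add, add_neg_cancel, heatKernel_zero, Complex.ofReal_one]

theorem hasDerivAt_heatKernel_neg (t : ℝ) :
    HasDerivAt (fun t => (heatKernel ν k (-t) : ℂ)) ((ν * freqSq k : ℝ) * heatKernel ν k (-t)) t := by
  have := (hasDerivAt_heatKernel (ν := ν) k (-t)).scomp t (hasDerivAt_neg t)
  convert! this using 1
  simp

/-- Integration by parts in the Duhamel integral of an integrable source. -/
theorem integral_heatKernel_mul_eq {ψ : ℝ → ℂ} {a t : ℝ} (hat : a ≤ t)
    (hψ : IntervalIntegrable ψ volume a t) :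
    ∫ τ in a..t, (heatKernel ν k (t - τ) : ℂ) * ψ τ = (∫ τ in a..t, ψ τ)
      - heatKernel ν k t * ∫ σ in a..t, (ν * freqSq k : ℝ) * (heatKernel ν k (-σ) : ℂ)
        * ∫ τ in a..σ, ψ τ := by
  have hc : Continuous fun σ => ((ν * freqSq k : ℝ) : ℂ) * (heatKernel ν k (-σ) : ℂ) :=
    continuous_const.mul ((continuous_heatKernel_ofReal k).comp continuous_neg)
  have h1 : ∀ τ, ∫ σ in τ..t, ((ν * freqSq k : ℝ) : ℂ) * (heatKernel ν k (-σ) : ℂ)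
      = heatKernel ν k (-t) - heatKernel ν k (-τ) := fun τ =>
    intervalIntegral.integral_eq_sub_of_hasDerivAt (fun σ _ => hasDerivAt_heatKernel_neg k σ)
      (hc.intervalIntegrable _ _)
  have h2 := integral_integral_triangle hat hc hψ
  rw [← h2, ← intervalIntegral.integral_const_mul]
  simp only [h1]
  rw [← intervalIntegral.integral_sub hψ]
  · refine intervalIntegral.integral_congr fun τ _ => ?_
    have e := heatKernel_mul_neg (ν := ν) k t
    simp only [heatKernel_sub, Complex.ofReal_mul]
    linear_combination ψ τ * e
  · refine IntervalIntegrable.const_mul ?_ _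
    refine hψ.continuousOn_mul (Continuous.continuousOn ?_)
    exact continuous_const.sub ((continuous_heatKernel_ofReal k).comp continuous_neg)

theorem continuousOn_primitive {ψ : ℝ → ℂ} {a b : ℝ} (hab : a ≤ b)
    (hψ : IntervalIntegrable ψ volume a b) :
    ContinuousOn (fun t => ∫ τ in a..t, ψ τ) (Set.Icc a b) := by
  have := intervalIntegral.continuousOn_primitive_interval' hψ Set.left_mem_uIcc
  rwa [Set.uIcc_of_le hab] at this

theorem intervalIntegrable_mono {ψ : ℝ → ℂ} {a b t : ℝ}
    (hψ : IntervalIntegrable ψ volume a b) (ht : t ∈ Set.Icc a b) :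
    IntervalIntegrable ψ volume a t := by
  refine hψ.mono_set ?_
  rw [Set.uIcc_of_le ht.1, Set.uIcc_of_le (ht.1.trans ht.2)]
  exact Set.Icc_subset_Icc le_rfl ht.2

/-- For an integrable source, the variation of constants formula is equivalent to the equation
integrated in time. -/
theorem mild_iff_integral {c ψ : ℝ → ℂ} {c₀ : ℂ} {a b : ℝ} (hab : a ≤ b)
    (hc : ContinuousOn c (Set.Icc a b)) (hψ : IntervalIntegrable ψ volume a b) :
    (∀ t ∈ Set.Icc a b, c t = heatKernel ν k (t - a) * c₀
      + ∫ τ in a..t, (heatKernel ν k (t - τ) : ℂ) * ψ τ) ↔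
    ∀ t ∈ Set.Icc a b, c t - c₀ = ∫ τ in a..t, (-((ν * freqSq k : ℝ) : ℂ) * c τ + ψ τ) := by
  set α : ℂ := ((ν * freqSq k : ℝ) : ℂ)
  set m : ℝ → ℂ := fun t => ∫ τ in a..t, ψ τ
  have hm : ContinuousOn m (Set.Icc a b) := continuousOn_primitive hab hψ
  have hE : Continuous fun t => (heatKernel ν k (-t) : ℂ) :=
    (continuous_heatKernel_ofReal k).comp continuous_neg
  have hI : ContinuousOn (fun σ => α * heatKernel ν k (-σ) * m σ) (Set.Icc a b) :=
    (continuous_const.mul hE).continuousOn.mul hm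
  set B : ℝ → ℂ := fun t => ∫ σ in a..t, α * (heatKernel ν k (-σ) : ℂ) * m σ
  have hBc : ContinuousOn B (Set.Icc a b) :=
    continuousOn_primitive hab (hI.intervalIntegrable_of_Icc hab)
  have hsum : ∀ t ∈ Set.Icc a b, ∫ τ in a..t, (-α * c τ + ψ τ)
      = (∫ τ in a..t, -α * c τ) + m t := fun t ht =>
    intervalIntegral.integral_add
      (intervalIntegrable_mono ((continuousOn_const.mul hc).intervalIntegrable_of_Icc hab) ht)
      (intervalIntegrable_mono hψ ht)
  have hpart : ∀ t ∈ Set.Icc a b, ∫ τ in a..t, (heatKernel ν k (t - τ) : ℂ) * ψ τ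
      = m t - heatKernel ν k t * B t := fun t ht =>
    integral_heatKernel_mul_eq k ht.1 (intervalIntegrable_mono hψ ht)
  constructor
  · intro h t ht
    have hca : ∀ t ∈ Set.Icc a b, c t - m t
        = heatKernel ν k t * (heatKernel ν k (-a) * c₀ - B t) := fun t ht => by
      rw [h t ht, hpart t ht, heatKernel_sub]
      push_cast
      ring
    have hd : ∀ σ ∈ Set.Ioo a t, HasDerivAt
        (fun σ => (heatKernel ν k σ : ℂ) * (heatKernel ν k (-a) * c₀ - B σ)) (-α * c σ) σ := by
      intro σ hσ
      have hσ' : σ ∈ Set.Ioo a b := ⟨hσ.1, hσ.2.trans_le ht.2⟩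
      have h1 := (hasDerivAt_heatKernel (ν := ν) k σ).fun_mul
        ((hasDerivAt_integral_of_continuousOn hI hσ').const_sub (heatKernel ν k (-a) * c₀))
      convert! h1 using 1
      have h2 := hca σ (Set.Ioo_subset_Icc_self hσ')
      have h3 := heatKernel_mul_neg (ν := ν) k σ
      linear_combination (-α) * h2 + α * m σ * h3
    have hcont : ContinuousOn (fun σ => (heatKernel ν k σ : ℂ) * (heatKernel ν k (-a) * c₀ - B σ))
        (Set.Icc a t) := by
      refine (continuous_heatKernel_ofReal k).continuousOn.mul (continuousOn_const.sub ?_)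
      exact hBc.mono (Set.Icc_subset_Icc le_rfl ht.2)
    have h4 := intervalIntegral.integral_eq_sub_of_hasDerivAt_of_le ht.1 hcont hd
      (intervalIntegrable_mono ((continuousOn_const.mul hc).intervalIntegrable_of_Icc hab) ht)
    have h5 : B a = 0 := intervalIntegral.integral_same
    rw [hsum t ht, h4, ← hca t ht, h5]
    have h6 := heatKernel_mul_neg (ν := ν) k a
    linear_combination c₀ * h6
  · intro h t ht
    set b' : ℝ → ℂ := fun t => c₀ + ∫ τ in a..t, -α * c τ
    have hb' : ∀ t ∈ Set.Icc a b, c t - m t = b' t := fun t ht => by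
      have := h t ht
      rw [hsum t ht] at this
      linear_combination this
    have hac : ContinuousOn (fun τ => -α * c τ) (Set.Icc a b) := continuousOn_const.mul hc
    have hd : ∀ σ ∈ Set.Ioo a t, HasDerivAt (fun σ => (heatKernel ν k (-σ) : ℂ) * b' σ)
        (-(α * heatKernel ν k (-σ) * m σ)) σ := by
      intro σ hσ
      have hσ' : σ ∈ Set.Ioo a b := ⟨hσ.1, hσ.2.trans_le ht.2⟩
      have h1 := (hasDerivAt_heatKernel_neg (ν := ν) k σ).fun_mul
        ((hasDerivAt_integral_of_continuousOn hac hσ').const_add c₀)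
      convert! h1 using 1
      have h2 := hb' σ (Set.Ioo_subset_Icc_self hσ')
      linear_combination α * (heatKernel ν k (-σ) : ℂ) * h2
    have hcont : ContinuousOn (fun σ => (heatKernel ν k (-σ) : ℂ) * b' σ) (Set.Icc a t) := by
      refine hE.continuousOn.mul (continuousOn_const.add ?_)
      exact (continuousOn_primitive hab (hac.intervalIntegrable_of_Icc hab)).mono
        (Set.Icc_subset_Icc le_rfl ht.2)
    have h4 := intervalIntegral.integral_eq_sub_of_hasDerivAt_of_le ht.1 hcont hd
      (intervalIntegrable_mono (hI.neg.intervalIntegrable_of_Icc hab) ht)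
    rw [intervalIntegral.integral_neg] at h4
    have h5 : b' a = c₀ := by simp [b']
    have h6 := heatKernel_mul_neg (ν := ν) k t
    rw [h5, ← hb' t ht] at h4
    have h7 : -B t = heatKernel ν k (-t) * (c t - m t) - heatKernel ν k (-a) * c₀ := h4
    rw [hpart t ht, heatKernel_sub]
    push_cast
    linear_combination (-(heatKernel ν k t : ℂ)) * h7 - (c t - m t) * h6

end mode

/-! ### The heat semigroup on Sobolev spaces -/

namespace Sobolev

variable {r s ν : ℝ}

theorem norm_min_heatKernel_mul_le (k : Fin d → ℤ) (t : ℝ) (z : ℂ) :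
    ‖((min (heatKernel ν k t) 1 : ℝ) : ℂ) * z‖ ≤ ‖z‖ := by
  rw [norm_mul, Complex.norm_real,
    Real.norm_of_nonneg (le_min (heatKernel_pos k t).le zero_le_one)]
  exact mul_le_of_le_one_left (norm_nonneg _) (min_le_right _ _)

/-- The heat semigroup `e^{νtΔ}` on `H^r`. The multiplier is cut off at `1`, which makes the operator
bounded for all values of the parameters and changes nothing when `ν` and `t` are nonnegative. -/
noncomputable def heat (ν t : ℝ) (u : Sobolev d r) : Sobolev d r :=
  ofCoeff (fun k => ((min (heatKernel ν k t) 1 : ℝ) : ℂ) * coeff u k)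
    (fun k => by rw [heatKernel_neg, coeff_neg, map_mul, Complex.conj_ofReal])
    (ne_top_of_le_ne_top (sqNorm_coeff_ne_top u)
      (sqNorm_mono fun k => norm_min_heatKernel_mul_le k t _))

theorem coeff_heat_eq_min (t : ℝ) (u : Sobolev d r) (k : Fin d → ℤ) :
    coeff (heat ν t u) k = ((min (heatKernel ν k t) 1 : ℝ) : ℂ) * coeff u k := by
  rw [heat, coeff_ofCoeff]

theorem coeff_heat (hν : 0 < ν) {t : ℝ} (ht : 0 ≤ t) (u : Sobolev d r) (k : Fin d → ℤ) :
    coeff (heat ν t u) k = (heatKernel ν k t : ℂ) * coeff u k := by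
  rw [coeff_heat_eq_min, min_eq_left (heatKernel_le_one k hν ht)]

theorem norm_heat_le (t : ℝ) (u : Sobolev d r) : ‖heat ν t u‖ ≤ ‖u‖ := by
  refine norm_le_of_sqNorm_le (norm_nonneg _) ?_
  rw [← sqNorm_coeff_eq_ofReal]
  refine sqNorm_mono fun k => ?_
  rw [coeff_heat_eq_min]
  exact norm_min_heatKernel_mul_le k t _

theorem heat_add (t : ℝ) (u v : Sobolev d r) : heat ν t (u + v) = heat ν t u + heat ν t v := by
  ext k
  rw [map_add, Pi.add_apply, coeff_heat_eq_min, coeff_heat_eq_min, coeff_heat_eq_min, map_add,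
    Pi.add_apply, mul_add]

theorem heat_smul (t a : ℝ) (u : Sobolev d r) : heat ν t (a • u) = a • heat ν t u := by
  ext k
  rw [map_smul, Pi.smul_apply, coeff_heat_eq_min, coeff_heat_eq_min, map_smul, Pi.smul_apply,
    mul_smul_comm]

@[simp] theorem heat_zero (u : Sobolev d r) : heat ν 0 u = u := by
  ext k
  rw [coeff_heat_eq_min, heatKernel_zero, min_self, Complex.ofReal_one, one_mul]

theorem continuous_heat (u : Sobolev d r) : Continuous fun t => heat ν t u := by
  rw [← continuousOn_univ]
  refine continuousOn_of_dominated (summable_coeff u) (fun k => ?_) fun t _ k => ?_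
  · simp only [coeff_heat_eq_min]
    refine Continuous.continuousOn (Continuous.mul (Complex.continuous_ofReal.comp ?_)
      continuous_const)
    exact (continuous_heatKernel k).min continuous_const
  · have := norm_min_heatKernel_mul_le (ν := ν) k t (coeff u k)
    have hp := Real.rpow_nonneg (one_add_freqSq_pos k).le r
    rw [coeff_heat_eq_min]
    gcongr

/-- The trigonometric polynomial `-νΔζ`. -/
theorem exists_coeff_eq_freqSq_mul (ν : ℝ) {ζ : Sobolev d r} (hζ : IsTrig ζ) :
    ∃ w : Sobolev d r, ∀ k, coeff w k = ((ν * freqSq k : ℝ) : ℂ) * coeff ζ k := by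
  refine ⟨ofCoeff (fun k => ((ν * freqSq k : ℝ) : ℂ) * coeff ζ k) (fun k => ?_)
    (sqNorm_ne_top_of_finite (hζ.subset fun k hk => ?_)), fun k => by rw [coeff_ofCoeff]⟩
  · have : freqSq (-k) = freqSq k := by simp [freqSq]
    rw [coeff_neg, map_mul, Complex.conj_ofReal, this]
  · exact right_ne_zero_of_mul hk

/-- On trigonometric polynomials the heat semigroup is Lipschitz at time `0`, since `Δζ` is again a
trigonometric polynomial. -/
theorem exists_norm_heat_sub_le (hν : 0 < ν) {ζ : Sobolev d r} (hζ : IsTrig ζ) :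
    ∃ C : ℝ, 0 ≤ C ∧ ∀ t, 0 ≤ t → ‖heat ν t ζ - ζ‖ ≤ C * t := by
  obtain ⟨w, hw⟩ := exists_coeff_eq_freqSq_mul ν hζ
  refine ⟨‖w‖, norm_nonneg _, fun t ht => ?_⟩
  have h : ‖t • w‖ = ‖w‖ * t := by rw [norm_smul, Real.norm_of_nonneg ht, mul_comm]
  rw [← h]
  refine norm_le_of_sqNorm_le (norm_nonneg _) ?_
  rw [← sqNorm_coeff_eq_ofReal]
  refine sqNorm_mono fun k => ?_
  have h1 := one_sub_heatKernel_le (ν := ν) k t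
  have h2 := heatKernel_le_one k hν ht
  have e1 : coeff (heat ν t ζ - ζ) k = (-(1 - heatKernel ν k t : ℝ) : ℂ) * coeff ζ k := by
    rw [map_sub, Pi.sub_apply, coeff_heat hν ht]
    push_cast
    ring
  have e2 : coeff (t • w) k = ((ν * freqSq k * t : ℝ) : ℂ) * coeff ζ k := by
    rw [map_smul, Pi.smul_apply, hw, Complex.real_smul]
    push_cast
    ring
  rw [e1, e2, norm_mul, norm_mul, norm_neg, Complex.norm_real, Complex.norm_real,
    Real.norm_of_nonneg (sub_nonneg.2 h2), Real.norm_of_nonneg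
      (mul_nonneg (mul_nonneg hν.le (freqSq_nonneg k)) ht)]
  gcongr

/-- A source which is a constant trigonometric polynomial acts over a time `δ` as a shift, up to an
error of order `δ²`. -/
theorem exists_norm_duhamel_const_sub_le (hν : 0 < ν) {q : Sobolev d s} (hq : IsTrig q) :
    ∃ C : ℝ, 0 ≤ C ∧ ∀ a δ : ℝ, 0 ≤ δ →
      ‖duhamel s ν a (a + δ) (fun _ => incl (r' := s - 1) sub_one_le_self q) - δ • q‖
        ≤ C * δ ^ 2 := by
  obtain ⟨w, hw⟩ := exists_coeff_eq_freqSq_mul ν hq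
  refine ⟨‖w‖, norm_nonneg _, fun a δ hδ => ?_⟩
  have h : ‖(δ ^ 2) • w‖ = ‖w‖ * δ ^ 2 := by
    rw [norm_smul, Real.norm_of_nonneg (sq_nonneg δ), mul_comm]
  rw [← h]
  refine norm_le_of_sqNorm_le (norm_nonneg _) ?_
  rw [← sqNorm_coeff_eq_ofReal]
  refine sqNorm_mono fun k => ?_
  have hm : MemLp (fun _ : ℝ => incl (r' := s - 1) sub_one_le_self q) 2
      (volume.restrict (Set.Icc a (a + δ))) := memLp_const _
  have hint : IntervalIntegrable (fun τ => (heatKernel ν k (a + δ - τ) : ℂ)) volume a (a + δ) :=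
    ((continuous_heatKernel_ofReal k).comp (continuous_const.sub continuous_id)).intervalIntegrable
      _ _
  have e1 : coeff (duhamel s ν a (a + δ) (fun _ => incl (r' := s - 1) sub_one_le_self q) - δ • q) k
      = (∫ τ in a..a + δ, ((heatKernel ν k (a + δ - τ) : ℂ) - 1)) * coeff q k := by
    rw [map_sub, Pi.sub_apply, coeff_duhamel hν hm ⟨by linarith, le_rfl⟩, duhamelSeq,
      map_smul, Pi.smul_apply, coeff_incl, intervalIntegral.integral_mul_const,
      intervalIntegral.integral_sub hint (intervalIntegrable_const), sub_mul,
      intervalIntegral.integral_const]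
    simp
  have e2 : coeff ((δ ^ 2) • w) k = ((ν * freqSq k * δ * δ : ℝ) : ℂ) * coeff q k := by
    rw [map_smul, Pi.smul_apply, hw, Complex.real_smul]
    push_cast
    ring
  have hnn : 0 ≤ ν * freqSq k * δ := mul_nonneg (mul_nonneg hν.le (freqSq_nonneg k)) hδ
  rw [e1, e2, norm_mul, norm_mul, Complex.norm_real, Real.norm_of_nonneg (mul_nonneg hnn hδ)]
  refine mul_le_mul_of_nonneg_right ?_ (norm_nonneg _)
  have h3 := intervalIntegral.norm_integral_le_of_norm_le_const (a := a) (b := a + δ)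
    (f := fun τ => (heatKernel ν k (a + δ - τ) : ℂ) - 1) (C := ν * freqSq k * δ) fun τ hτ => by
      rw [Set.uIoc_of_le (by linarith)] at hτ
      have h1 := one_sub_heatKernel_le (ν := ν) k (a + δ - τ)
      have h2 := heatKernel_le_one (t := a + δ - τ) k hν (by linarith [hτ.2])
      have h4 : ν * freqSq k * (a + δ - τ) ≤ ν * freqSq k * δ :=
        mul_le_mul_of_nonneg_left (by linarith [hτ.1]) (mul_nonneg hν.le (freqSq_nonneg k))
      rw [← Complex.ofReal_one, ← Complex.ofReal_sub, Complex.norm_real, Real.norm_eq_abs,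
        abs_sub_comm, abs_of_nonneg (sub_nonneg.2 h2)]
      linarith
  rwa [add_sub_cancel_left, abs_of_nonneg hδ] at h3

theorem lintegral_heatKernel_left_le (hν : 0 < ν) (k : Fin d → ℤ) {τ b : ℝ} (hτ : τ ≤ b) :
    ENNReal.ofReal (1 + freqSq k) * ∫⁻ t in Set.Icc τ b, ENNReal.ofReal (heatKernel ν k (t - τ))
      ≤ ENNReal.ofReal (b - τ + ν⁻¹) := by
  -- reflection `t ↦ τ + b - t` of the interval `[τ, b]`
  have e : ∫⁻ t in Set.Icc τ b, ENNReal.ofReal (heatKernel ν k (t - τ))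
      = ∫⁻ t in Set.Icc τ b, ENNReal.ofReal (heatKernel ν k (b - t)) := by
    have hp := (Measure.measurePreserving_sub_left (volume : Measure ℝ) (τ + b)).restrict_preimage
      (s := Set.Icc τ b) measurableSet_Icc
    have hpre : (fun x => τ + b - x) ⁻¹' Set.Icc τ b = Set.Icc τ b := by
      ext x
      simp only [Set.mem_preimage, Set.mem_Icc]
      constructor <;> intro h <;> constructor <;> linarith [h.1, h.2]
    rw [hpre] at hp
    have := hp.lintegral_comp (f := fun t => ENNReal.ofReal (heatKernel ν k (t - τ)))
      (((continuous_heatKernel k).comp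
        (continuous_id.sub continuous_const)).measurable.ennreal_ofReal)
    rw [← this]
    refine lintegral_congr fun x => ?_
    congr 2
    ring
  rw [e]
  exact lintegral_heatKernel_le k hν hτ

theorem enorm_add_sq_le (x y : ℂ) : ‖x + y‖ₑ ^ 2 ≤ 2 * ‖x‖ₑ ^ 2 + 2 * ‖y‖ₑ ^ 2 := by
  have e : (2 : ℝ≥0∞) = ENNReal.ofReal 2 := by norm_num
  rw [← ofReal_norm, ← ofReal_norm, ← ofReal_norm, ← ENNReal.ofReal_pow (norm_nonneg _),
    ← ENNReal.ofReal_pow (norm_nonneg _), ← ENNReal.ofReal_pow (norm_nonneg _), e,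
    ← ENNReal.ofReal_mul (by norm_num), ← ENNReal.ofReal_mul (by norm_num),
    ← ENNReal.ofReal_add (by positivity) (by positivity)]
  refine ENNReal.ofReal_le_ofReal ?_
  simpa using norm_sub_sq_le x (-y)

/-- The `L²(H^{s+1})` bound for one Fourier mode of the Duhamel integral. -/
theorem lintegral_duhamelSeq_le (hν : 0 < ν) {a b : ℝ} (k : Fin d → ℤ) {ψ : ℝ → ℂ}
    (hψ : AEStronglyMeasurable ψ (volume.restrict (Set.Icc a b))) :
    ENNReal.ofReal (1 + freqSq k) ^ 2 * ∫⁻ t in Set.Icc a b,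
        ‖∫ τ in a..t, (heatKernel ν k (t - τ) : ℂ) * ψ τ‖ₑ ^ 2
      ≤ ENNReal.ofReal (b - a + ν⁻¹) ^ 2 * ∫⁻ τ in Set.Icc a b, ‖ψ τ‖ₑ ^ 2 := by
  set μ := (volume : Measure ℝ).restrict (Set.Icc a b)
  set J := ENNReal.ofReal (1 + freqSq k)
  set B := ENNReal.ofReal (b - a + ν⁻¹)
  have hJ : J ≠ ⊤ := ENNReal.ofReal_ne_top
  have hK : Measurable fun q : ℝ × ℝ => ENNReal.ofReal (heatKernel ν k (q.1 - q.2)) :=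
    ((continuous_heatKernel k).comp
      (continuous_fst.sub continuous_snd)).measurable.ennreal_ofReal
  have hS : MeasurableSet {q : ℝ × ℝ | q.2 ≤ q.1} := measurableSet_le measurable_snd measurable_fst
  -- the kernel of the integral operator, cut off to the triangle `τ ≤ t`
  set N : ℝ × ℝ → ℝ≥0∞ := Set.indicator {q : ℝ × ℝ | q.2 ≤ q.1}
    fun q => ENNReal.ofReal (heatKernel ν k (q.1 - q.2))
  have hN : Measurable N := hK.indicator hS
  have hNle : ∀ τ ∈ Set.Icc a b, J * ∫⁻ t, N (t, τ) ∂μ ≤ B := by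
    intro τ hτ
    have e1 : ∫⁻ t, N (t, τ) ∂μ = ∫⁻ t in Set.Icc τ b, ENNReal.ofReal (heatKernel ν k (t - τ)) := by
      have e : (fun t => N (t, τ)) = Set.indicator (Set.Ici τ)
          fun t => ENNReal.ofReal (heatKernel ν k (t - τ)) := by
        funext t; simp [N, Set.indicator]
      rw [e, lintegral_indicator measurableSet_Ici, Measure.restrict_restrict measurableSet_Ici]
      congr 2
      ext t
      simp only [Set.mem_inter_iff, Set.mem_Ici, Set.mem_Icc]
      exact ⟨fun h => ⟨h.1, h.2.2⟩, fun h => ⟨h.1, hτ.1.trans h.1, h.2⟩⟩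
    rw [e1]
    refine (lintegral_heatKernel_left_le hν k hτ.2).trans (ENNReal.ofReal_le_ofReal ?_)
    linarith [hτ.1]
  have hstep : ∀ t ∈ Set.Icc a b, J * ‖∫ τ in a..t, (heatKernel ν k (t - τ) : ℂ) * ψ τ‖ₑ ^ 2
      ≤ B * ∫⁻ τ, N (t, τ) * ‖ψ τ‖ₑ ^ 2 ∂μ := by
    intro t ht
    have hψt : AEStronglyMeasurable ψ (volume.restrict (Set.Icc a t)) :=
      hψ.mono_measure (Measure.restrict_mono (Set.Icc_subset_Icc le_rfl ht.2) le_rfl)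
    have e : ∫⁻ τ, N (t, τ) * ‖ψ τ‖ₑ ^ 2 ∂μ
        = ∫⁻ τ in Set.Icc a t, ENNReal.ofReal (heatKernel ν k (t - τ)) * ‖ψ τ‖ₑ ^ 2 := by
      have e : (fun τ => N (t, τ) * ‖ψ τ‖ₑ ^ 2) = Set.indicator (Set.Iic t)
          fun τ => ENNReal.ofReal (heatKernel ν k (t - τ)) * ‖ψ τ‖ₑ ^ 2 := by
        funext τ; simp [N, Set.indicator, ite_mul]
      rw [e, lintegral_indicator measurableSet_Iic, Measure.restrict_restrict measurableSet_Iic]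
      congr 2
      ext τ
      simp only [Set.mem_inter_iff, Set.mem_Iic, Set.mem_Icc]
      exact ⟨fun h => ⟨h.2.1, h.1⟩, fun h => ⟨h.2, h.1, h.2.trans ht.2⟩⟩
    rw [e]
    calc _ ≤ J * ((∫⁻ τ in Set.Icc a t, ENNReal.ofReal (heatKernel ν k (t - τ))) *
          ∫⁻ τ in Set.Icc a t, ENNReal.ofReal (heatKernel ν k (t - τ)) * ‖ψ τ‖ₑ ^ 2) := by
          gcongr
          exact enorm_integral_heatKernel_sq_le k ht.1 hψt
      _ ≤ _ := by
          rw [← mul_assoc]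
          gcongr
          refine (lintegral_heatKernel_le k hν ht.1).trans (ENNReal.ofReal_le_ofReal ?_)
          linarith [ht.2]
  have hψe : AEMeasurable (fun τ => ‖ψ τ‖ₑ ^ 2) μ := hψ.enorm.pow_const 2
  have hprod : AEMeasurable (fun q : ℝ × ℝ => N q * ‖ψ q.2‖ₑ ^ 2) (μ.prod μ) :=
    hN.aemeasurable.mul (hψe.comp_quasiMeasurePreserving Measure.quasiMeasurePreserving_snd)
  calc J ^ 2 * ∫⁻ t, ‖∫ τ in a..t, (heatKernel ν k (t - τ) : ℂ) * ψ τ‖ₑ ^ 2 ∂μ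
      = J * ∫⁻ t, J * ‖∫ τ in a..t, (heatKernel ν k (t - τ) : ℂ) * ψ τ‖ₑ ^ 2 ∂μ := by
        rw [lintegral_const_mul' _ _ hJ, pow_two, mul_assoc]
    _ ≤ J * ∫⁻ t, B * ∫⁻ τ, N (t, τ) * ‖ψ τ‖ₑ ^ 2 ∂μ ∂μ := by
        refine mul_le_mul_right (lintegral_mono_ae ?_) _
        filter_upwards [ae_restrict_mem measurableSet_Icc] with t ht using hstep t ht
    _ = J * (B * ∫⁻ τ, ∫⁻ t, N (t, τ) * ‖ψ τ‖ₑ ^ 2 ∂μ ∂μ) := by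
        rw [lintegral_const_mul' _ _ ENNReal.ofReal_ne_top, lintegral_lintegral_swap hprod]
    _ = B * ∫⁻ τ, J * (∫⁻ t, N (t, τ) ∂μ) * ‖ψ τ‖ₑ ^ 2 ∂μ := by
        rw [mul_left_comm, ← lintegral_const_mul' _ _ hJ]
        congr 1
        refine lintegral_congr fun τ => ?_
        have hNτ : Measurable fun t => N (t, τ) := hN.comp (measurable_id.prodMk measurable_const)
        rw [lintegral_mul_const _ hNτ, mul_assoc]
    _ ≤ B * ∫⁻ τ, B * ‖ψ τ‖ₑ ^ 2 ∂μ := by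
        refine mul_le_mul_right (lintegral_mono_ae ?_) _
        filter_upwards [ae_restrict_mem measurableSet_Icc] with τ hτ
        gcongr
        exact hNle τ hτ
    _ = _ := by
        rw [lintegral_const_mul' _ _ ENNReal.ofReal_ne_top, pow_two, mul_assoc]

/-- The function `∑_{|kᵢ| ≤ n} c_k e^{i⟨x,k⟩}` in `H^r`, written with cosines and sines. -/
noncomputable def modeSum (r : ℝ) (n : ℕ) (c : (Fin d → ℤ) → ℂ) : Sobolev d r :=
  ∑ k ∈ (finite_abs_le n).toFinset, ((c k).re • cosMode r k - (c k).im • sinMode r k)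

theorem coeff_modeSum (r : ℝ) (n : ℕ) {c : (Fin d → ℤ) → ℂ}
    (hc : ∀ k, c (-k) = (starRingEnd ℂ) (c k)) (m : Fin d → ℤ) :
    coeff (modeSum r n c) m = if ∀ i, |m i| ≤ (n : ℤ) then c m else 0 := by
  have hmem : ∀ k, k ∈ (finite_abs_le (d := d) n).toFinset ↔ ∀ i, |k i| ≤ (n : ℤ) := by
    intro k; simp
  have hneg : ∀ k : Fin d → ℤ, m = -k ↔ k = -m := fun k => by
    constructor <;> rintro rfl <;> simp
  have hre : (c (-m)).re = (c m).re := by rw [hc, Complex.conj_re]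
  have him : (c (-m)).im = -(c m).im := by rw [hc, Complex.conj_im]
  have hterm : ∀ k, coeff ((c k).re • cosMode r k - (c k).im • sinMode r k) m
      = (if k = m then c m / 2 else 0) + (if k = -m then c m / 2 else 0) := by
    intro k
    rw [map_sub, map_smul, map_smul, Pi.sub_apply, Pi.smul_apply, Pi.smul_apply, coeff_cosMode,
      coeff_sinMode, Complex.real_smul, Complex.real_smul]
    have hm := Complex.re_add_im (c m)
    have hI : (2 * Complex.I)⁻¹ = -Complex.I / 2 := by
      rw [mul_inv, Complex.inv_I]; ring
    rw [div_eq_mul_inv _ (2 * Complex.I), hI]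
    by_cases h1 : k = m
    · subst h1
      by_cases h2 : k = -k
      · have h0 : (c k).im = 0 := by
          rw [← h2] at him
          linarith
        simp only [← h2, if_true, h0, Complex.ofReal_zero]
        rw [h0, Complex.ofReal_zero] at hm
        linear_combination hm
      · simp only [if_true, if_neg h2]
        linear_combination hm / 2
    · by_cases h2 : k = -m
      · have h3 : m ≠ k := fun h => h1 h.symm
        simp only [if_neg h1, if_neg h3, if_pos h2, if_pos ((hneg k).2 h2)]
        rw [h2, hre, him]
        push_cast
        linear_combination hm / 2
      · have h3 : m ≠ k := fun h => h1 h.symm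
        have h4 : m ≠ -k := fun h => h2 ((hneg k).1 h)
        simp only [if_neg h1, if_neg h3, if_neg h2, if_neg h4]
        ring
  rw [modeSum, map_sum, Finset.sum_apply, Finset.sum_congr rfl fun k _ => hterm k,
    Finset.sum_add_distrib, Finset.sum_ite_eq', Finset.sum_ite_eq']
  simp only [hmem, Pi.neg_apply, abs_neg]
  split_ifs <;> ring

/-- A mild solution with initial value in `H^s` and source in `L²(H^{s-1})` belongs to
`L²(H^{s+1})`. -/
theorem exists_memLp_of_mild (hν : 0 < ν) {a b : ℝ} (hab : a ≤ b) {φ : ℝ → Sobolev d (s - 1)}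
    (hφ : MemLp φ 2 (volume.restrict (Set.Icc a b))) {y : Sobolev d s} {u : ℝ → Sobolev d s}
    (hu : ContinuousOn u (Set.Icc a b))
    (h : ∀ t ∈ Set.Icc a b, u t = heat ν (t - a) y + duhamel s ν a t φ) :
    ∃ v : ℝ → Sobolev d (s + 1), MemLp v 2 (volume.restrict (Set.Icc a b)) ∧
      ∀ᵐ t ∂(volume.restrict (Set.Icc a b)), coeff (v t) = coeff (u t) := by
  set μ := (volume : Measure ℝ).restrict (Set.Icc a b)
  have hum : AEStronglyMeasurable u μ := hu.aestronglyMeasurable measurableSet_Icc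
  have hck : ∀ k, AEMeasurable (fun t => ‖coeff (u t) k‖ₑ ^ 2) μ := fun k =>
    (aestronglyMeasurable_coeff hum k).enorm.pow_const 2
  set J : (Fin d → ℤ) → ℝ≥0∞ := fun k => ENNReal.ofReal (1 + freqSq k)
  set B := ENNReal.ofReal (b - a + ν⁻¹)
  have hJs : ∀ k, ENNReal.ofReal ((1 + freqSq k) ^ (s + 1))
      = ENNReal.ofReal ((1 + freqSq k) ^ s) * J k := fun k => by
    rw [← ENNReal.ofReal_mul (Real.rpow_nonneg (one_add_freqSq_pos k).le _),
      ← Real.rpow_add_one (one_add_freqSq_pos k).ne']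
  have hJs' : ∀ k, ENNReal.ofReal ((1 + freqSq k) ^ (s + 1))
      = ENNReal.ofReal ((1 + freqSq k) ^ (s - 1)) * J k ^ 2 := fun k => by
    rw [← ENNReal.ofReal_pow (one_add_freqSq_pos k).le,
      ← ENNReal.ofReal_mul (Real.rpow_nonneg (one_add_freqSq_pos k).le _),
      ← Real.rpow_add_natCast (one_add_freqSq_pos k).ne']
    congr 2
    push_cast
    ring
  -- the initial value: the multiplier is integrable, with a gain of two derivatives
  have h1 : ∀ k, J k * ∫⁻ t, ‖(heatKernel ν k (t - a) : ℂ) * coeff y k‖ₑ ^ 2 ∂μ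
      ≤ B * ‖coeff y k‖ₑ ^ 2 := by
    intro k
    have e : ∀ t ∈ Set.Icc a b, ‖(heatKernel ν k (t - a) : ℂ) * coeff y k‖ₑ ^ 2
        ≤ ENNReal.ofReal (heatKernel ν k (t - a)) * ‖coeff y k‖ₑ ^ 2 := by
      intro t ht
      rw [enorm_mul, mul_pow, ← ofReal_norm, Complex.norm_real,
        Real.norm_of_nonneg (heatKernel_pos k _).le]
      refine mul_le_mul_left ?_ _
      rw [pow_two]
      refine mul_le_of_le_one_left' ?_
      rw [ENNReal.ofReal_le_one]
      exact heatKernel_le_one k hν (sub_nonneg.2 ht.1)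
    calc _ ≤ J k * ∫⁻ t, ENNReal.ofReal (heatKernel ν k (t - a)) * ‖coeff y k‖ₑ ^ 2 ∂μ := by
          refine mul_le_mul_right (lintegral_mono_ae ?_) _
          filter_upwards [ae_restrict_mem measurableSet_Icc] with t ht using e t ht
      _ = (J k * ∫⁻ t, ENNReal.ofReal (heatKernel ν k (t - a)) ∂μ) * ‖coeff y k‖ₑ ^ 2 := by
          rw [lintegral_mul_const' _ _ (ENNReal.pow_ne_top enorm_ne_top), mul_assoc]
      _ ≤ _ := mul_le_mul_left (lintegral_heatKernel_left_le hν k hab) _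
  have h2 : ∀ k, J k ^ 2 * ∫⁻ t, ‖duhamelSeq ν a t φ k‖ₑ ^ 2 ∂μ
      ≤ B ^ 2 * ∫⁻ τ, ‖coeff (φ τ) k‖ₑ ^ 2 ∂μ := fun k =>
    lintegral_duhamelSeq_le hν k (aestronglyMeasurable_coeff hφ.1 k)
  have h3 : ∀ k, ENNReal.ofReal ((1 + freqSq k) ^ (s + 1)) * ∫⁻ t, ‖coeff (u t) k‖ₑ ^ 2 ∂μ
      ≤ 2 * B * (ENNReal.ofReal ((1 + freqSq k) ^ s) * ‖coeff y k‖ₑ ^ 2)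
        + 2 * B ^ 2 * (ENNReal.ofReal ((1 + freqSq k) ^ (s - 1))
          * ∫⁻ τ, ‖coeff (φ τ) k‖ₑ ^ 2 ∂μ) := by
    intro k
    have hm : AEMeasurable (fun t => ‖(heatKernel ν k (t - a) : ℂ) * coeff y k‖ₑ ^ 2) μ :=
      (((continuous_heatKernel_ofReal k).comp (continuous_id.sub continuous_const)).mul
        continuous_const).enorm.measurable.aemeasurable.pow_const 2
    have h4 : ∫⁻ t, ‖coeff (u t) k‖ₑ ^ 2 ∂μ
        ≤ 2 * (∫⁻ t, ‖(heatKernel ν k (t - a) : ℂ) * coeff y k‖ₑ ^ 2 ∂μ)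
          + 2 * ∫⁻ t, ‖duhamelSeq ν a t φ k‖ₑ ^ 2 ∂μ := by
      rw [← lintegral_const_mul' _ _ (by norm_num), ← lintegral_const_mul' _ _ (by norm_num),
        ← lintegral_add_left' (hm.const_mul 2)]
      refine lintegral_mono_ae ?_
      filter_upwards [ae_restrict_mem measurableSet_Icc] with t ht
      rw [h t ht, map_add, Pi.add_apply, coeff_heat hν (sub_nonneg.2 ht.1), coeff_duhamel hν hφ ht]
      exact enorm_add_sq_le _ _
    calc _ ≤ ENNReal.ofReal ((1 + freqSq k) ^ (s + 1)) *
          (2 * (∫⁻ t, ‖(heatKernel ν k (t - a) : ℂ) * coeff y k‖ₑ ^ 2 ∂μ)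
          + 2 * ∫⁻ t, ‖duhamelSeq ν a t φ k‖ₑ ^ 2 ∂μ) := by gcongr
      _ = 2 * (ENNReal.ofReal ((1 + freqSq k) ^ s) * (J k *
            ∫⁻ t, ‖(heatKernel ν k (t - a) : ℂ) * coeff y k‖ₑ ^ 2 ∂μ))
          + 2 * (ENNReal.ofReal ((1 + freqSq k) ^ (s - 1)) * (J k ^ 2 *
            ∫⁻ t, ‖duhamelSeq ν a t φ k‖ₑ ^ 2 ∂μ)) := by
          rw [mul_add]
          nth_rewrite 1 [hJs]
          rw [hJs']
          ring
      _ ≤ 2 * (ENNReal.ofReal ((1 + freqSq k) ^ s) * (B * ‖coeff y k‖ₑ ^ 2))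
          + 2 * (ENNReal.ofReal ((1 + freqSq k) ^ (s - 1)) *
            (B ^ 2 * ∫⁻ τ, ‖coeff (φ τ) k‖ₑ ^ 2 ∂μ)) := by
          exact add_le_add (mul_le_mul_right (mul_le_mul_right (h1 k) _) _)
            (mul_le_mul_right (mul_le_mul_right (h2 k) _) _)
      _ = _ := by ring
  have hfin : ∫⁻ t, sqNorm (s + 1) (coeff (u t)) ∂μ ≠ ⊤ := by
    have e : ∫⁻ t, sqNorm (s + 1) (coeff (u t)) ∂μ
        = ∑' k, ENNReal.ofReal ((1 + freqSq k) ^ (s + 1)) * ∫⁻ t, ‖coeff (u t) k‖ₑ ^ 2 ∂μ := by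
      simp only [sqNorm]
      rw [lintegral_tsum fun k => (hck k).const_mul _]
      exact tsum_congr fun k => lintegral_const_mul' _ _ ENNReal.ofReal_ne_top
    rw [e]
    refine ne_top_of_le_ne_top ?_ (ENNReal.tsum_le_tsum h3)
    rw [ENNReal.tsum_add, ENNReal.tsum_mul_left, ENNReal.tsum_mul_left, lintegral_sqNorm hφ.1]
    refine ENNReal.add_ne_top.2 ⟨ENNReal.mul_ne_top ?_ (sqNorm_coeff_ne_top y),
      ENNReal.mul_ne_top ?_ (lintegral_enorm_sq_ne_top hφ)⟩
    · exact ENNReal.mul_ne_top (by norm_num) ENNReal.ofReal_ne_top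
    · exact ENNReal.mul_ne_top (by norm_num) (ENNReal.pow_ne_top ENNReal.ofReal_ne_top)
  have hmeas : AEMeasurable (fun t => sqNorm (s + 1) (coeff (u t))) μ :=
    AEMeasurable.tsum fun k => (hck k).const_mul _
  have hae : ∀ᵐ t ∂μ, sqNorm (s + 1) (coeff (u t)) ≠ ⊤ := by
    filter_upwards [ae_lt_top' hmeas hfin] with t ht using ht.ne
  have hex : ∀ t, ∃ w : Sobolev d (s + 1),
      sqNorm (s + 1) (coeff (u t)) ≠ ⊤ → coeff w = coeff (u t) := by
    intro t
    by_cases ht : sqNorm (s + 1) (coeff (u t)) ≠ ⊤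
    · exact ⟨ofCoeff (coeff (u t)) (coeff_neg (u t)) ht, fun _ => coeff_ofCoeff _ _ _⟩
    · exact ⟨0, fun h => absurd h ht⟩
  choose v hv' using hex
  have hv : ∀ᵐ t ∂μ, coeff (v t) = coeff (u t) := by
    filter_upwards [hae] with t ht using hv' t ht
  have hvm : AEStronglyMeasurable v μ := by
    refine aestronglyMeasurable_of_tendsto_ae atTop (f := fun n t => modeSum (s + 1) n (coeff (u t)))
      (fun n => ?_) ?_
    · unfold modeSum
      refine Finset.aestronglyMeasurable_fun_sum _ fun k _ => ?_
      have hk := aestronglyMeasurable_coeff hum k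
      exact ((Complex.continuous_re.comp_aestronglyMeasurable hk).smul_const _).sub
        ((Complex.continuous_im.comp_aestronglyMeasurable hk).smul_const _)
    · filter_upwards [hv] with t ht
      have e : ∀ n, modeSum (s + 1) n (coeff (u t)) = truncate n (v t) := by
        intro n
        ext k
        rw [coeff_modeSum _ _ (coeff_neg (u t)), coeff_truncate, ht]
      simp only [e]
      exact tendsto_truncate (v t)
  refine ⟨v, memLp_two_of_lintegral hvm ?_, hv⟩
  have e : ∫⁻ t, ‖v t‖ₑ ^ 2 ∂μ = ∫⁻ t, sqNorm (s + 1) (coeff (u t)) ∂μ := by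
    refine lintegral_congr_ae ?_
    filter_upwards [hv] with t ht
    rw [← sqNorm_coeff, ht]
  rwa [e]

end Sobolev

/-! ### Mild solutions -/

theorem memLp_of_continuousOn {E : Type*} [NormedAddCommGroup E] {u : ℝ → E} {a b : ℝ}
    (hu : ContinuousOn u (Set.Icc a b)) : MemLp u 2 (volume.restrict (Set.Icc a b)) := by
  obtain ⟨C, hC⟩ := isCompact_Icc.exists_bound_of_continuousOn hu
  refine MemLp.of_bound (hu.aestronglyMeasurable_of_isCompact isCompact_Icc measurableSet_Icc) C ?_
  filter_upwards [ae_restrict_mem measurableSet_Icc] with t ht using hC t ht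

/-- Gronwall's lemma in integral form, for a vanishing initial value. -/
theorem le_zero_of_le_mul_integral {w : ℝ → ℝ} {a b C : ℝ} (hw : Continuous w)
    (hw0 : ∀ t, 0 ≤ w t) (h : ∀ t ∈ Set.Icc a b, w t ≤ C * ∫ τ in a..t, w τ) :
    ∀ t ∈ Set.Icc a b, w t ≤ 0 := by
  have hd : ∀ t, HasDerivAt (fun t => ∫ τ in a..t, w τ) (w t) t := fun t =>
    intervalIntegral.integral_hasDerivAt_right (hw.intervalIntegrable _ _)
      (hw.stronglyMeasurableAtFilter _ _) hw.continuousAt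
  have hg := norm_le_gronwallBound_of_norm_deriv_right_le (f := fun t => ∫ τ in a..t, w τ)
    (f' := w) (δ := 0) (K := C) (ε := 0) (a := a) (b := b)
    (fun t _ => (hd t).continuousAt.continuousWithinAt) (fun t _ => (hd t).hasDerivWithinAt)
    (by simp) (fun t ht => by
      have h1 := h t ⟨ht.1, ht.2.le⟩
      have h2 : 0 ≤ ∫ τ in a..t, w τ :=
        intervalIntegral.integral_nonneg ht.1 fun τ _ => hw0 τ
      rw [Real.norm_of_nonneg (hw0 t), Real.norm_of_nonneg h2, add_zero]
      exact h1)
  intro t ht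
  have h1 := hg t ht
  rw [gronwallBound_ε0_δ0] at h1
  have h2 : ∫ τ in a..t, w τ = 0 := norm_le_zero_iff.1 h1
  simpa [h2] using h t ht

namespace Sobolev

variable {r s ν : ℝ} {a b t : ℝ}

theorem duhamel_congr {φ ψ : ℝ → Sobolev d r} (hat : a ≤ t)
    (h : ∀ τ ∈ Set.Ioc a t, φ τ = ψ τ) : duhamel s ν a t φ = duhamel s ν a t ψ := by
  have e : duhamelSeq ν a t φ = duhamelSeq ν a t ψ := by
    funext k
    rw [duhamelSeq, duhamelSeq, intervalIntegral.integral_of_le hat,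
      intervalIntegral.integral_of_le hat]
    refine setIntegral_congr_fun measurableSet_Ioc fun τ hτ => ?_
    simp only [h τ hτ]
  simp only [duhamel, e]

@[simp] theorem duhamel_self {φ : ℝ → Sobolev d r} : duhamel s ν a a φ = 0 := by
  have e : duhamelSeq ν a a φ = 0 := by
    funext k
    rw [duhamelSeq, intervalIntegral.integral_same, Pi.zero_apply]
  have h : sqNorm s (duhamelSeq ν a a φ) ≠ ⊤ := by rw [e, sqNorm_zero]; exact ENNReal.zero_ne_top
  refine ext fun k => ?_
  rw [duhamel, dif_pos h, coeff_ofCoeff, e, map_zero]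

theorem heat_heat (hν : 0 < ν) {t t' : ℝ} (ht : 0 ≤ t) (ht' : 0 ≤ t') (u : Sobolev d r) :
    heat ν t (heat ν t' u) = heat ν (t + t') u := by
  ext k
  rw [coeff_heat hν ht, coeff_heat hν ht', coeff_heat hν (add_nonneg ht ht'), heatKernel_add]
  push_cast
  ring

/-- The Duhamel operator restarted at an intermediate time `b`. -/
theorem duhamel_eq_heat_add (hν : 0 < ν) {c : ℝ} {φ : ℝ → Sobolev d (s - 1)}
    (hφ : MemLp φ 2 (volume.restrict (Set.Icc a c))) (hb : b ∈ Set.Icc a c)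
    (ht : t ∈ Set.Icc b c) :
    duhamel s ν a t φ = heat ν (t - b) (duhamel s ν a b φ) + duhamel s ν b t φ := by
  have hat : t ∈ Set.Icc a c := ⟨hb.1.trans ht.1, ht.2⟩
  ext k
  have hi := intervalIntegrable_heat (ν := ν) (t := t)
    (MemLp.restrict_Icc le_rfl ht.2 hφ) ⟨hat.1, le_rfl⟩ k
  have hi1 : IntervalIntegrable (fun τ => (heatKernel ν k (t - τ) : ℂ) * coeff (φ τ) k)
      volume a b := intervalIntegrable_mono hi ⟨hb.1, ht.1⟩
  have hi2 := intervalIntegrable_heat (ν := ν) (t := t)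
    (MemLp.restrict_Icc hb.1 le_rfl hφ) ht k
  rw [map_add, Pi.add_apply, coeff_duhamel hν hφ hat, coeff_heat hν (sub_nonneg.2 ht.1),
    coeff_duhamel hν hφ hb, coeff_duhamel hν (MemLp.restrict_Icc hb.1 le_rfl hφ) ht, duhamelSeq,
    duhamelSeq, duhamelSeq, ← intervalIntegral.integral_add_adjacent_intervals hi1 hi2,
    ← intervalIntegral.integral_const_mul]
  congr 1
  refine intervalIntegral.integral_congr fun τ _ => ?_
  have e : heatKernel ν k (t - τ) = heatKernel ν k (t - b) * heatKernel ν k (b - τ) := by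
    rw [← heatKernel_add]; congr 1; ring
  simp only [e]
  push_cast
  ring

/-- The bound of the Duhamel integral of a source split into an `H^s` and an `H^{s-1}` part. -/
theorem norm_duhamel_incl_add_le (hν : 0 < ν) {χ₁ : ℝ → Sobolev d s} {χ₂ : ℝ → Sobolev d (s - 1)}
    (h₁ : ContinuousOn χ₁ (Set.Icc a b)) (h₂ : ContinuousOn χ₂ (Set.Icc a b))
    (ht : t ∈ Set.Icc a b) {m₁ m₂ : ℝ} (hm₁ : 0 ≤ m₁) (hm₂ : 0 ≤ m₂)
    (hb₁ : ∀ τ ∈ Set.Icc a b, ‖χ₁ τ‖ ≤ m₁) (hb₂ : ∀ τ ∈ Set.Icc a b, ‖χ₂ τ‖ ≤ m₂) :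
    ‖duhamel s ν a t (fun τ => incl (r' := s - 1) sub_one_le_self (χ₁ τ) + χ₂ τ)‖
      ≤ (b - a) * m₁ + Real.sqrt ((b - a + ν⁻¹) * (b - a)) * m₂ := by
  have hi : ContinuousOn (fun τ => incl (r' := s - 1) sub_one_le_self (χ₁ τ)) (Set.Icc a b) :=
    (incl (d := d) (r := s) (r' := s - 1) sub_one_le_self).continuous.comp_continuousOn h₁
  rw [duhamel_add hν (memLp_of_continuousOn hi) (memLp_of_continuousOn h₂) ht]
  refine (norm_add_le _ _).trans (add_le_add ?_ ?_)
  · exact norm_duhamel_incl_le hν (memLp_of_continuousOn h₁).1 (memLp_of_continuousOn hi) ht hm₁ hb₁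
  · exact norm_duhamel_le_sqrt hν (memLp_of_continuousOn h₂) ht hm₂ hb₂

/-- `u` solves `∂ₜu - νΔu + G(u) = φ` on `[a, b]` with `u(a) = y`, in the mild sense. -/
structure IsMild (ν : ℝ) (G : Sobolev d s → Sobolev d (s - 1)) (φ : ℝ → Sobolev d (s - 1))
    (a b : ℝ) (y : Sobolev d s) (u : ℝ → Sobolev d s) : Prop where
  continuousOn : ContinuousOn u (Set.Icc a b)
  eq : ∀ t ∈ Set.Icc a b,
    u t = heat ν (t - a) y + duhamel s ν a t (fun τ => φ τ - G (u τ))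

variable {G : Sobolev d s → Sobolev d (s - 1)} {φ ψ : ℝ → Sobolev d (s - 1)}

theorem IsMild.memLp_source {y : Sobolev d s} {u : ℝ → Sobolev d s} (hG : Continuous G)
    (hφ : MemLp φ 2 (volume.restrict (Set.Icc a b))) (hu : IsMild ν G φ a b y u) :
    MemLp (fun τ => φ τ - G (u τ)) 2 (volume.restrict (Set.Icc a b)) :=
  hφ.sub (memLp_of_continuousOn (hG.comp_continuousOn hu.continuousOn))

theorem IsMild.left {y : Sobolev d s} {u : ℝ → Sobolev d s} (hab : a ≤ b)
    (hu : IsMild ν G φ a b y u) : u a = y := by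
  rw [hu.eq a ⟨le_rfl, hab⟩, sub_self, heat_zero, duhamel_self, add_zero]

theorem continuousOn_heat_add_duhamel (hν : 0 < ν) (hab : a ≤ b) (y : Sobolev d s)
    (hφ : MemLp φ 2 (volume.restrict (Set.Icc a b))) :
    ContinuousOn (fun t => heat ν (t - a) y + duhamel s ν a t φ) (Set.Icc a b) :=
  ((continuous_heat y).comp (continuous_id.sub continuous_const)).continuousOn.add
    (continuousOn_duhamel hν hφ hab)

/-- Concatenation of mild solutions. -/
theorem IsMild.concat (hν : 0 < ν) {c : ℝ} (hab : a ≤ b) (hbc : b ≤ c) (hG : Continuous G)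
    (hφ : MemLp φ 2 (volume.restrict (Set.Icc a b)))
    (hψ : MemLp ψ 2 (volume.restrict (Set.Icc b c))) {y : Sobolev d s} {u v : ℝ → Sobolev d s}
    (hu : IsMild ν G φ a b y u) (hv : IsMild ν G ψ b c (u b) v) :
    IsMild ν G (fun t => if t ≤ b then φ t else ψ t) a c y (fun t => if t ≤ b then u t else v t) := by
  classical
  set χ : ℝ → Sobolev d (s - 1) := fun τ => (if τ ≤ b then φ τ else ψ τ)
    - G (if τ ≤ b then u τ else v τ)
  have hχ : MemLp χ 2 (volume.restrict (Set.Icc a c)) := by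
    have e : χ = Set.piecewise (Set.Iic b) (fun τ => φ τ - G (u τ)) (fun τ => ψ τ - G (v τ)) := by
      funext τ
      by_cases h : τ ≤ b <;> simp [χ, Set.piecewise, h]
    rw [e]
    refine MemLp.piecewise measurableSet_Iic ?_ ?_
    · refine (hu.memLp_source hG hφ).mono_measure ?_
      rw [Measure.restrict_restrict measurableSet_Iic]
      refine Measure.restrict_mono (fun τ hτ => ?_) le_rfl
      exact Set.mem_Icc.2 ⟨hτ.2.1, hτ.1⟩
    · refine (hv.memLp_source hG hψ).mono_measure ?_
      rw [Measure.restrict_restrict measurableSet_Iic.compl]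
      refine Measure.restrict_mono (fun τ hτ => ?_) le_rfl
      exact Set.mem_Icc.2 ⟨(not_le.1 (Set.notMem_of_mem_compl hτ.1)).le, hτ.2.2⟩
  have heq : ∀ t ∈ Set.Icc a c, (if t ≤ b then u t else v t)
      = heat ν (t - a) y + duhamel s ν a t χ := by
    intro t ht
    have h1 : ∀ t ∈ Set.Icc a b, duhamel s ν a t χ = duhamel s ν a t (fun τ => φ τ - G (u τ)) :=
      fun t ht => duhamel_congr ht.1 fun τ hτ => by
        have : τ ≤ b := hτ.2.trans ht.2
        simp only [χ, if_pos this]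
    by_cases htb : t ≤ b
    · rw [if_pos htb, h1 t ⟨ht.1, htb⟩, ← hu.eq t ⟨ht.1, htb⟩]
    · have htb' : b ≤ t := (not_le.1 htb).le
      have h2 : duhamel s ν b t χ = duhamel s ν b t (fun τ => ψ τ - G (v τ)) :=
        duhamel_congr htb' fun τ hτ => by
          have : ¬ τ ≤ b := not_le.2 hτ.1
          simp only [χ, if_neg this]
      have h3 : heat ν (t - a) y = heat ν (t - b) (heat ν (b - a) y) := by
        rw [heat_heat hν (sub_nonneg.2 htb') (sub_nonneg.2 hab)]
        congr 1
        ring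
      rw [if_neg htb, hv.eq t ⟨htb', ht.2⟩, hu.eq b ⟨hab, le_rfl⟩,
        duhamel_eq_heat_add hν hχ ⟨hab, hbc⟩ ⟨htb', ht.2⟩, h1 b ⟨hab, le_rfl⟩, h2, h3, heat_add,
        add_assoc]
  exact ⟨(continuousOn_heat_add_duhamel hν (hab.trans hbc) y hχ).congr heq, heq⟩

/-- Two mild solutions with the same data coincide. -/
theorem IsMild.eqOn (hν : 0 < ν) (hG : Continuous G)
    (hL : ∀ R : ℝ, ∃ L : ℝ, ∀ x x' : Sobolev d s, ‖x‖ ≤ R → ‖x'‖ ≤ R → ‖G x - G x'‖ ≤ L * ‖x - x'‖)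
    (hφ : MemLp φ 2 (volume.restrict (Set.Icc a b))) {y : Sobolev d s} {u v : ℝ → Sobolev d s}
    (hu : IsMild ν G φ a b y u) (hv : IsMild ν G φ a b y v) : Set.EqOn u v (Set.Icc a b) := by
  intro t₁ ht₁
  have hab : a ≤ b := ht₁.1.trans ht₁.2
  obtain ⟨R₁, hR₁⟩ := isCompact_Icc.exists_bound_of_continuousOn hu.continuousOn
  obtain ⟨R₂, hR₂⟩ := isCompact_Icc.exists_bound_of_continuousOn hv.continuousOn
  obtain ⟨L, hL⟩ := hL (max R₁ R₂)
  have hw : ContinuousOn (fun t => ‖u t - v t‖ ^ 2) (Set.Icc a b) :=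
    (hu.continuousOn.sub hv.continuousOn).norm.pow 2
  set w : ℝ → ℝ := Set.IccExtend hab ((Set.Icc a b).domRestrict fun t => ‖u t - v t‖ ^ 2)
  have hwc : Continuous w := (continuousOn_iff_continuous_domRestrict.1 hw).Icc_extend'
  have hwe : ∀ t ∈ Set.Icc a b, w t = ‖u t - v t‖ ^ 2 := fun t ht =>
    Set.IccExtend_of_mem hab _ ht
  have hw0 : ∀ t, 0 ≤ w t := fun t => sq_nonneg _
  have hν' : 0 < ν⁻¹ := inv_pos.2 hν
  set C := (b - a + ν⁻¹) * L ^ 2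
  have hC0 : 0 ≤ C := mul_nonneg (by linarith) (sq_nonneg L)
  have key : ∀ t ∈ Set.Icc a b, w t ≤ C * ∫ τ in a..t, w τ := by
    intro t ht
    have hI : 0 ≤ ∫ τ in a..t, w τ := intervalIntegral.integral_nonneg ht.1 fun τ _ => hw0 τ
    have e1 : u t - v t = duhamel s ν a t (fun τ => G (v τ) - G (u τ)) := by
      rw [hu.eq t ht, hv.eq t ht, add_sub_add_left_eq_sub,
        ← duhamel_sub hν (hu.memLp_source hG hφ) (hv.memLp_source hG hφ) ht]
      congr 1
      funext τ
      abel
    have hm : MemLp (fun τ => G (v τ) - G (u τ)) 2 (volume.restrict (Set.Icc a t)) := by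
      refine MemLp.restrict_Icc le_rfl ht.2 ?_
      exact memLp_of_continuousOn ((hG.comp_continuousOn hv.continuousOn).sub
        (hG.comp_continuousOn hu.continuousOn))
    rw [hwe t ht, e1, ← Real.sq_sqrt (mul_nonneg hC0 hI)]
    refine pow_le_pow_left₀ (norm_nonneg _) (norm_duhamel_le_of_lintegral hν hm ⟨ht.1, le_rfl⟩
      (Real.sqrt_nonneg _) ?_) 2
    rw [Real.sq_sqrt (mul_nonneg hC0 hI)]
    have h1 : ∫⁻ τ in Set.Icc a t, ‖G (v τ) - G (u τ)‖ₑ ^ 2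
        ≤ ENNReal.ofReal (L ^ 2 * ∫ τ in a..t, w τ) := by
      have hint : Integrable (fun τ => L ^ 2 * w τ) (volume.restrict (Set.Icc a t)) :=
        (continuous_const.mul hwc).integrableOn_Icc
      rw [intervalIntegral.integral_of_le ht.1, ← integral_Icc_eq_integral_Ioc,
        ← integral_const_mul, ofReal_integral_eq_lintegral_ofReal hint
          (Eventually.of_forall fun τ => mul_nonneg (sq_nonneg L) (hw0 τ))]
      refine lintegral_mono_ae ?_
      filter_upwards [ae_restrict_mem measurableSet_Icc] with τ hτ
      have hτ' : τ ∈ Set.Icc a b := ⟨hτ.1, hτ.2.trans ht.2⟩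
      rw [← ofReal_norm, ← ENNReal.ofReal_pow (norm_nonneg _), hwe τ hτ']
      refine ENNReal.ofReal_le_ofReal ?_
      rw [← mul_pow]
      refine pow_le_pow_left₀ (norm_nonneg _) ?_ 2
      rw [norm_sub_rev (u τ)]
      exact hL _ _ ((hR₂ τ hτ').trans (le_max_right _ _)) ((hR₁ τ hτ').trans (le_max_left _ _))
    refine (mul_le_mul_right h1 _).trans ?_
    rw [← ENNReal.ofReal_mul (by linarith [ht.1])]
    refine ENNReal.ofReal_le_ofReal ?_
    rw [← mul_assoc]
    refine mul_le_mul_of_nonneg_right ?_ hI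
    exact mul_le_mul_of_nonneg_right (by linarith [ht.2]) (sq_nonneg L)
  have h0 := le_zero_of_le_mul_integral hwc hw0 key t₁ ht₁
  rw [hwe t₁ ht₁] at h0
  have h2 : ‖u t₁ - v t₁‖ = 0 := pow_eq_zero_iff (two_ne_zero) |>.1 (le_antisymm h0 (sq_nonneg _))
  exact sub_eq_zero.1 (norm_eq_zero.1 h2)

/-- A mild solution near a given path `w`, by contraction in the tube of radius `ρ` about `w`. -/
theorem exists_isMild_near (hν : 0 < ν) (hab : a ≤ b) {F₁ : Sobolev d s → Sobolev d s}
    {F₂ : Sobolev d s → Sobolev d (s - 1)} (hF₁ : Continuous F₁) (hF₂ : Continuous F₂)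
    (hφ : MemLp φ 2 (volume.restrict (Set.Icc a b))) {y : Sobolev d s} {w : ℝ → Sobolev d s}
    (hw : ContinuousOn w (Set.Icc a b)) {ρ L₁ L₂ : ℝ} (hρ : 0 ≤ ρ) (hL₁ : 0 ≤ L₁) (hL₂ : 0 ≤ L₂)
    (h₁ : ∀ t ∈ Set.Icc a b, ∀ x x', ‖x - w t‖ ≤ ρ → ‖x' - w t‖ ≤ ρ →
      ‖F₁ x - F₁ x'‖ ≤ L₁ * ‖x - x'‖)
    (h₂ : ∀ x x', ‖F₂ x - F₂ x'‖ ≤ L₂ * ‖x - x'‖)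
    (hκ : (b - a) * L₁ + Real.sqrt ((b - a + ν⁻¹) * (b - a)) * L₂ ≤ 1 / 2)
    (hres : ∀ t ∈ Set.Icc a b, ‖heat ν (t - a) y + duhamel s ν a t
      (fun τ => φ τ - (incl (r' := s - 1) sub_one_le_self (F₁ (w τ)) + F₂ (w τ))) - w t‖ ≤ ρ / 2) :
    ∃ u, IsMild ν (fun x => incl (r' := s - 1) sub_one_le_self (F₁ x) + F₂ x) φ a b y u ∧
      ∀ t ∈ Set.Icc a b, ‖u t - w t‖ ≤ ρ := by
  set G : Sobolev d s → Sobolev d (s - 1) :=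
    fun x => incl (r' := s - 1) sub_one_le_self (F₁ x) + F₂ x
  have hG : Continuous G :=
    ((incl (d := d) (r := s) (r' := s - 1) sub_one_le_self).continuous.comp hF₁).add hF₂
  have hmem : ∀ x : C(Set.Icc a b, Sobolev d s),
      MemLp (fun τ => φ τ - G (Set.IccExtend hab x τ)) 2 (volume.restrict (Set.Icc a b)) :=
    fun x => hφ.sub (memLp_of_continuousOn (hG.comp x.continuous.Icc_extend').continuousOn)
  set W : C(Set.Icc a b, Sobolev d s) :=
    ⟨(Set.Icc a b).domRestrict w, continuousOn_iff_continuous_domRestrict.1 hw⟩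
  set Ψ : C(Set.Icc a b, Sobolev d s) → C(Set.Icc a b, Sobolev d s) := fun x =>
    ⟨(Set.Icc a b).domRestrict fun t => heat ν (t - a) y
      + duhamel s ν a t (fun τ => φ τ - G (Set.IccExtend hab x τ)),
      continuousOn_iff_continuous_domRestrict.1 (continuousOn_heat_add_duhamel hν hab y (hmem x))⟩
  have hball : ∀ x ∈ Metric.closedBall W ρ, ∀ τ (hτ : τ ∈ Set.Icc a b), ‖x ⟨τ, hτ⟩ - w τ‖ ≤ ρ := by
    intro x hx τ hτ
    have := (ContinuousMap.dist_apply_le_dist (f := x) (g := W) ⟨τ, hτ⟩).trans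
      (Metric.mem_closedBall.1 hx)
    rwa [dist_eq_norm] at this
  have hdist : ∀ x ∈ Metric.closedBall W ρ, ∀ x' ∈ Metric.closedBall W ρ,
      dist (Ψ x) (Ψ x') ≤ 1 / 2 * dist x x' := by
    intro x hx x' hx'
    rw [ContinuousMap.dist_le (by positivity)]
    rintro ⟨t, ht⟩
    have hxx : ∀ τ (hτ : τ ∈ Set.Icc a b), ‖x' ⟨τ, hτ⟩ - x ⟨τ, hτ⟩‖ ≤ dist x x' := by
      intro τ hτ
      rw [← dist_eq_norm, dist_comm]
      exact ContinuousMap.dist_apply_le_dist _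
    have e : Ψ x ⟨t, ht⟩ - Ψ x' ⟨t, ht⟩ = duhamel s ν a t (fun τ =>
        incl (r' := s - 1) sub_one_le_self
          (F₁ (Set.IccExtend hab x' τ) - F₁ (Set.IccExtend hab x τ))
        + (F₂ (Set.IccExtend hab x' τ) - F₂ (Set.IccExtend hab x τ))) := by
      have e1 : ∀ x, Ψ x ⟨t, ht⟩ = heat ν (t - a) y
        + duhamel s ν a t (fun τ => φ τ - G (Set.IccExtend hab x τ)) := fun x => rfl
      rw [e1, e1, add_sub_add_left_eq_sub, ← duhamel_sub hν (hmem x) (hmem x') ht]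
      congr 1
      funext τ
      simp only [G, map_sub]
      abel
    have hc : ∀ x : C(Set.Icc a b, Sobolev d s), Continuous (Set.IccExtend hab x) :=
      fun x => x.continuous.Icc_extend'
    rw [dist_eq_norm, e]
    refine (norm_duhamel_incl_add_le hν
      ((hF₁.comp (hc x')).sub (hF₁.comp (hc x))).continuousOn
      ((hF₂.comp (hc x')).sub (hF₂.comp (hc x))).continuousOn ht
      (m₁ := L₁ * dist x x') (m₂ := L₂ * dist x x') (by positivity) (by positivity)
      (fun τ hτ => ?_) (fun τ hτ => ?_)).trans ?_
    · rw [Pi.sub_apply, Function.comp_apply, Function.comp_apply, Set.IccExtend_of_mem hab x' hτ,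
        Set.IccExtend_of_mem hab x hτ]
      refine (h₁ τ hτ _ _ (hball x' hx' τ hτ) (hball x hx τ hτ)).trans ?_
      gcongr
      exact hxx τ hτ
    · rw [Pi.sub_apply, Function.comp_apply, Function.comp_apply, Set.IccExtend_of_mem hab x' hτ,
        Set.IccExtend_of_mem hab x hτ]
      refine (h₂ _ _).trans ?_
      gcongr
      exact hxx τ hτ
    · rw [← mul_assoc, ← mul_assoc, ← add_mul]
      gcongr
  have hΨW : dist (Ψ W) W ≤ ρ / 2 := by
    rw [ContinuousMap.dist_le (by positivity)]
    rintro ⟨t, ht⟩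
    rw [dist_eq_norm]
    refine le_trans (le_of_eq ?_) (hres t ht)
    have e : duhamel s ν a t (fun τ => φ τ - G (Set.IccExtend hab W τ))
        = duhamel s ν a t (fun τ => φ τ - G (w τ)) := duhamel_congr ht.1 fun τ hτ => by
      have hτ' : τ ∈ Set.Icc a b := ⟨hτ.1.le, hτ.2.trans ht.2⟩
      rw [Set.IccExtend_of_mem hab _ hτ']
      rfl
    change ‖heat ν (t - a) y + duhamel s ν a t (fun τ => φ τ - G (Set.IccExtend hab W τ)) - w t‖ = _
    rw [e]
  have hW : W ∈ Metric.closedBall W ρ := Metric.mem_closedBall_self hρ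
  have hmaps : Set.MapsTo Ψ (Metric.closedBall W ρ) (Metric.closedBall W ρ) := by
    intro x hx
    rw [Metric.mem_closedBall]
    have h1 := hdist x hx W hW
    have h2 := Metric.mem_closedBall.1 hx
    calc dist (Ψ x) W ≤ dist (Ψ x) (Ψ W) + dist (Ψ W) W := dist_triangle _ _ _
      _ ≤ 1 / 2 * ρ + ρ / 2 := add_le_add (h1.trans (by gcongr)) hΨW
      _ = ρ := by ring
  have hcontr : ContractingWith (1 / 2 : NNReal)
      (hmaps.restrict Ψ (Metric.closedBall W ρ) (Metric.closedBall W ρ)) := by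
    refine ⟨by rw [← NNReal.coe_lt_coe]; norm_num, LipschitzWith.of_dist_le_mul fun x x' => ?_⟩
    have := hdist x x.2 x' x'.2
    rw [NNReal.coe_div, NNReal.coe_one, NNReal.coe_ofNat]
    exact this
  obtain ⟨x, hx, hfix, -⟩ := hcontr.exists_fixedPoint' Metric.isClosed_closedBall.isComplete hmaps
    hW (edist_ne_top _ _)
  refine ⟨Set.IccExtend hab x, ⟨x.continuous.Icc_extend'.continuousOn, fun t ht => ?_⟩,
    fun t ht => ?_⟩
  · have h3 := congrArg (fun z : C(Set.Icc a b, Sobolev d s) => z ⟨t, ht⟩) hfix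
    rw [Set.IccExtend_of_mem hab _ ht]
    exact h3.symm
  · rw [Set.IccExtend_of_mem hab _ ht]
    exact hball x hx t ht

end Sobolev

/-! ### The effect of a large control over a short time -/

theorem continuous_of_lipschitz_on_balls {E F : Type*} [NormedAddCommGroup E]
    [NormedAddCommGroup F] {G : E → F}
    (h : ∀ R : ℝ, ∃ L : ℝ, ∀ x x', ‖x‖ ≤ R → ‖x'‖ ≤ R → ‖G x - G x'‖ ≤ L * ‖x - x'‖) :
    Continuous G := by
  rw [continuous_iff_continuousAt]
  intro x
  obtain ⟨L, hL⟩ := h (‖x‖ + 1)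
  rw [ContinuousAt, tendsto_iff_norm_sub_tendsto_zero]
  have h1 : Tendsto (fun x' => L * ‖x' - x‖) (𝓝 x) (𝓝 0) := by
    have : Continuous fun x' : E => L * ‖x' - x‖ := by fun_prop
    simpa using this.tendsto x
  refine squeeze_zero' (Eventually.of_forall fun _ => norm_nonneg _) ?_ h1
  filter_upwards [Metric.ball_mem_nhds x one_pos] with x' hx'
  refine hL _ _ ?_ (by linarith)
  have h2 : ‖x' - x‖ < 1 := by rwa [Metric.mem_ball, dist_eq_norm] at hx'
  have h3 := norm_sub_norm_le x' x
  linarith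

namespace Sobolev

variable {s ν : ℝ} {a b t : ℝ}

/-- The nonlinear term `F₁ + F₂` as a map from `H^s` to `H^{s-1}`. -/
noncomputable def nonlinearTerm (F₁ : Sobolev d s → Sobolev d s)
    (F₂ : Sobolev d s → Sobolev d (s - 1)) (x : Sobolev d s) : Sobolev d (s - 1) :=
  incl (r' := s - 1) sub_one_le_self (F₁ x) + F₂ x

namespace IsNonlinearity

variable {hs : (d : ℝ) / 2 < s} {f : ℝ → ℝ} {c : ℝ} {p : ℕ} {F₁ : Sobolev d s → Sobolev d s}
  {F₂ : Sobolev d s → Sobolev d (s - 1)}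

theorem lipschitz_on_balls₁ (hF : IsNonlinearity hs f c p F₁ F₂) (R : ℝ) :
    ∃ L : ℝ, ∀ x x', ‖x‖ ≤ R → ‖x'‖ ≤ R → ‖F₁ x - F₁ x'‖ ≤ L * ‖x - x'‖ := by
  obtain ⟨θ, -, h⟩ := hF.lipschitz₁
  obtain ⟨C, -, hC⟩ := h 0 isTrig_zero R
  refine ⟨C, fun x x' hx hx' => ?_⟩
  simpa using (hC 1 le_rfl).2 x x' hx hx'

theorem continuous₁ (hF : IsNonlinearity hs f c p F₁ F₂) : Continuous F₁ :=
  continuous_of_lipschitz_on_balls hF.lipschitz_on_balls₁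

theorem continuous₂ (hF : IsNonlinearity hs f c p F₁ F₂) : Continuous F₂ := by
  obtain ⟨L, -, -, hL⟩ := hF.lipschitz₂
  exact continuous_of_lipschitz_on_balls fun _ => ⟨L, fun x x' _ _ => hL x x'⟩

theorem continuous_nonlinearTerm (hF : IsNonlinearity hs f c p F₁ F₂) :
    Continuous (nonlinearTerm F₁ F₂) :=
  ((incl (d := d) (r := s) (r' := s - 1) sub_one_le_self).continuous.comp hF.continuous₁).add
    hF.continuous₂

theorem lipschitz_on_balls (hF : IsNonlinearity hs f c p F₁ F₂) (R : ℝ) :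
    ∃ L : ℝ, ∀ x x', ‖x‖ ≤ R → ‖x'‖ ≤ R →
      ‖nonlinearTerm F₁ F₂ x - nonlinearTerm F₁ F₂ x'‖ ≤ L * ‖x - x'‖ := by
  obtain ⟨L₁, h₁⟩ := hF.lipschitz_on_balls₁ R
  obtain ⟨L₂, -, -, h₂⟩ := hF.lipschitz₂
  refine ⟨L₁ + L₂, fun x x' hx hx' => ?_⟩
  rw [nonlinearTerm, nonlinearTerm, add_sub_add_comm, ← map_sub, add_mul]
  refine (norm_add_le _ _).trans (add_le_add ?_ (h₂ x x'))
  exact (norm_incl_le _ _).trans (h₁ x x' hx hx')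

end IsNonlinearity

/-- `x` is reached at time `b` from `y` at time `a` by the mild solution of
`∂ₜu - νΔu + G(u) = h + η` for some bounded measurable control `η` with values in `H`. -/
def Reach (ν : ℝ) (G : Sobolev d s → Sobolev d (s - 1)) (h : ℝ → Sobolev d (s - 1))
    (H : Submodule ℝ (Sobolev d (s - 1))) (a : ℝ) (y : Sobolev d s) (b : ℝ) (x : Sobolev d s) :
    Prop :=
  ∃ (η : ℝ → Sobolev d (s - 1)) (u : ℝ → Sobolev d s), StronglyMeasurable η ∧
    (∃ C : ℝ, ∀ t, ‖η t‖ ≤ C) ∧ (∀ t, η t ∈ H) ∧ IsMild ν G (fun t => h t + η t) a b y u ∧ u b = x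

variable {G : Sobolev d s → Sobolev d (s - 1)} {h : ℝ → Sobolev d (s - 1)}
  {H : Submodule ℝ (Sobolev d (s - 1))}

theorem memLp_add_control {η : ℝ → Sobolev d (s - 1)}
    (hh : MemLp h 2 (volume.restrict (Set.Icc a b))) (hη : StronglyMeasurable η)
    (hb : ∃ C : ℝ, ∀ t, ‖η t‖ ≤ C) :
    MemLp (fun t => h t + η t) 2 (volume.restrict (Set.Icc a b)) := by
  obtain ⟨C, hC⟩ := hb
  exact hh.add (MemLp.of_bound hη.aestronglyMeasurable C (Eventually.of_forall hC))

/-- Controls are concatenated at the time `t₂`. -/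
theorem Reach.trans (hν : 0 < ν) {t₁ t₂ t₃ : ℝ} (h12 : t₁ ≤ t₂) (h23 : t₂ ≤ t₃)
    (hG : Continuous G) (hh : MemLp h 2 (volume.restrict (Set.Icc t₁ t₃))) {x y z : Sobolev d s}
    (hxy : Reach ν G h H t₁ x t₂ y) (hyz : Reach ν G h H t₂ y t₃ z) : Reach ν G h H t₁ x t₃ z := by
  obtain ⟨η, u, hη, ⟨C, hC⟩, hηH, hu, rfl⟩ := hxy
  obtain ⟨η', v, hη', ⟨C', hC'⟩, hηH', hv, rfl⟩ := hyz
  refine ⟨fun t => if t ≤ t₂ then η t else η' t, fun t => if t ≤ t₂ then u t else v t,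
    StronglyMeasurable.ite measurableSet_Iic hη hη', ⟨max C C', fun t => ?_⟩, fun t => ?_, ?_, ?_⟩
  · dsimp only
    split_ifs
    · exact (hC t).trans (le_max_left _ _)
    · exact (hC' t).trans (le_max_right _ _)
  · dsimp only
    split_ifs
    · exact hηH t
    · exact hηH' t
  · have hc := hu.concat hν h12 h23 hG
      (memLp_add_control (MemLp.restrict_Icc le_rfl h23 hh) hη ⟨C, hC⟩)
      (memLp_add_control (MemLp.restrict_Icc h12 le_rfl hh) hη' ⟨C', hC'⟩) hv
    have e : (fun t => h t + if t ≤ t₂ then η t else η' t)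
        = fun t => if t ≤ t₂ then h t + η t else h t + η' t := by
      funext t
      split_ifs <;> rfl
    rwa [← e] at hc
  · dsimp only
    split_ifs with h32
    · obtain rfl := le_antisymm h23 h32
      exact (hv.left le_rfl).symm
    · rfl

theorem duhamel_const_smul (hν : 0 < ν) (m : ℝ) (q : Sobolev d (s - 1)) (hat : a ≤ t) :
    duhamel s ν a t (fun _ => m • q) = m • duhamel s ν a t (fun _ => q) := by
  have hm : ∀ q : Sobolev d (s - 1),
      MemLp (fun _ : ℝ => q) 2 (volume.restrict (Set.Icc a t)) := fun q => memLp_const _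
  ext k
  rw [map_smul, Pi.smul_apply, coeff_duhamel hν (hm _) ⟨hat, le_rfl⟩,
    coeff_duhamel hν (hm _) ⟨hat, le_rfl⟩, duhamelSeq, duhamelSeq,
    intervalIntegral.integral_mul_const, intervalIntegral.integral_mul_const, map_smul,
    Pi.smul_apply, mul_smul_comm]

/-- The contribution of the fixed source `h` over a short time is uniformly small. -/
theorem exists_norm_duhamel_le (hν : 0 < ν) {T : ℝ}
    (hh : MemLp h 2 (volume.restrict (Set.Icc 0 T))) {B : ℝ} (hB : 0 < B) :
    ∃ δ₀ : ℝ, 0 < δ₀ ∧ ∀ a δ : ℝ, 0 ≤ a → δ < δ₀ → a + δ ≤ T →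
      ∀ t ∈ Set.Icc a (a + δ), ‖duhamel s ν a t h‖ ≤ B := by
  have hν' : 0 < ν⁻¹ := inv_pos.2 hν
  have hA : ENNReal.ofReal (1 + ν⁻¹) ≠ 0 := by
    rw [Ne, ENNReal.ofReal_eq_zero]; linarith
  obtain ⟨δ₁, hδ₁, hs⟩ := exists_pos_setLIntegral_lt_of_measure_lt (lintegral_enorm_sq_ne_top hh)
    (ε := ENNReal.ofReal (B ^ 2) / ENNReal.ofReal (1 + ν⁻¹))
    (ENNReal.div_pos (by rw [Ne, ENNReal.ofReal_eq_zero, not_le]; positivity)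
      ENNReal.ofReal_ne_top).ne'
  obtain ⟨δ₂, hδ₂, hlt⟩ : ∃ δ₂ : ℝ, 0 < δ₂ ∧ ∀ δ < δ₂, ENNReal.ofReal δ < δ₁ := by
    by_cases htop : δ₁ = ⊤
    · exact ⟨1, one_pos, fun δ _ => htop ▸ ENNReal.ofReal_lt_top⟩
    · refine ⟨δ₁.toReal, ENNReal.toReal_pos hδ₁.ne' htop, fun δ hδ => ?_⟩
      rcases le_or_gt δ 0 with h0 | h0
      · rwa [ENNReal.ofReal_of_nonpos h0]
      · rwa [ENNReal.ofReal_lt_iff_lt_toReal h0.le htop]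
  refine ⟨min δ₂ 1, lt_min hδ₂ one_pos, fun a δ ha hδ hT t ht => ?_⟩
  have hsub : Set.Icc a (a + δ) ⊆ Set.Icc 0 T := Set.Icc_subset_Icc ha hT
  refine norm_duhamel_le_of_lintegral hν (MemLp.restrict_Icc ha hT hh) ht hB.le ?_
  have h1 := hs (Set.Icc a (a + δ)) (by
    refine (Measure.restrict_apply_le _ _).trans_lt ?_
    rw [Real.volume_Icc, add_sub_cancel_left]
    exact hlt δ (hδ.trans_le (min_le_left _ _)))
  rw [Measure.restrict_restrict measurableSet_Icc, Set.inter_eq_left.2 hsub] at h1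
  calc _ ≤ ENNReal.ofReal (1 + ν⁻¹) * (ENNReal.ofReal (B ^ 2) / ENNReal.ofReal (1 + ν⁻¹)) := by
        refine mul_le_mul' (ENNReal.ofReal_le_ofReal ?_) h1.le
        have := hδ.le.trans (min_le_right δ₂ 1)
        linarith
    _ = _ := ENNReal.mul_div_cancel hA ENNReal.ofReal_ne_top

theorem tendsto_inv_pow_atTop {p : ℕ} (hp : 2 ≤ p) :
    Tendsto (fun l : ℝ => (l ^ p)⁻¹) atTop (𝓝 0) :=
  tendsto_inv_atTop_zero.comp (tendsto_pow_atTop (by omega))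

theorem tendsto_mul_inv_pow_atTop {p : ℕ} (hp : 2 ≤ p) :
    Tendsto (fun l : ℝ => l * (l ^ p)⁻¹) atTop (𝓝 0) := by
  have h : Tendsto (fun l : ℝ => (l ^ (p - 1))⁻¹) atTop (𝓝 0) :=
    tendsto_inv_atTop_zero.comp (tendsto_pow_atTop (by omega))
  refine h.congr' ?_
  filter_upwards [eventually_gt_atTop 0] with l hl
  have e : l ^ p = l ^ (p - 1) * l := by rw [← pow_succ]; congr 1; omega
  rw [e, mul_inv, mul_comm, mul_assoc, inv_mul_cancel₀ hl.ne', mul_one]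

theorem tendsto_inv_pow_mul_rpow_atTop {p : ℕ} {θ : ℝ} (hθ : θ < p) :
    Tendsto (fun l : ℝ => (l ^ p)⁻¹ * l ^ θ) atTop (𝓝 0) := by
  refine (tendsto_rpow_neg_atTop (sub_pos.2 hθ)).congr' ?_
  filter_upwards [eventually_gt_atTop 0] with l hl
  rw [neg_sub, Real.rpow_sub hl, Real.rpow_natCast, div_eq_mul_inv, mul_comm]

variable {hs : (d : ℝ) / 2 < s} {f : ℝ → ℝ} {c : ℝ} {p : ℕ} {F₁ : Sobolev d s → Sobolev d s}
  {F₂ : Sobolev d s → Sobolev d (s - 1)}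

/-- The errors over the time `δ = l^{-p}`: lower-order terms of size `l^θ` act for a time `δ`, and a source
bounded in `H^{s-1}` enters through the smoothing estimate. -/
theorem tendsto_error (hp : 2 ≤ p) {θ : ℝ} (hθ : θ < p) (ν A L : ℝ) :
    Tendsto (fun l : ℝ => (l ^ p)⁻¹ * (A * l ^ θ)
      + Real.sqrt (((l ^ p)⁻¹ + ν⁻¹) * (l ^ p)⁻¹) * L) atTop (𝓝 0) := by
  have h1 : Tendsto (fun l : ℝ => (l ^ p)⁻¹ * (A * l ^ θ)) atTop (𝓝 0) := by
    have := (tendsto_inv_pow_mul_rpow_atTop hθ).const_mul A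
    rw [mul_zero] at this
    refine this.congr fun l => ?_
    ring
  have hδ := tendsto_inv_pow_atTop hp
  have h2 := (((hδ.add_const ν⁻¹).mul hδ).sqrt).mul_const L
  have h3 := h1.add h2
  simpa using h3

/-- The asymptotic property. Over a time `δ = λ⁻ᵖ`, the constant control `δ⁻¹η` moves a state close
to `u₀ + λζ` to one close to `u₀ + λζ + η - cζᵖ`: the leading part `cλᵖζᵖ` of the nonlinear term,
of size `δ⁻¹`, is the only other term which matters. -/
theorem IsNonlinearity.exists_reach_near (hF : IsNonlinearity hs f c p F₁ F₂) (hν : 0 < ν)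
    (hp : 2 ≤ p) {T : ℝ} (hh : MemLp h 2 (volume.restrict (Set.Icc 0 T))) {ζ η : Sobolev d s}
    (hζ : IsTrig ζ) (hη : IsTrig η) (hηH : incl (r' := s - 1) sub_one_le_self η ∈ H)
    (u₀ : Sobolev d s) {ε : ℝ} (hε : 0 < ε) :
    ∃ ρ : ℝ, 0 < ρ ∧ ∀ᶠ l : ℝ in atTop, ∀ (a : ℝ) (y : Sobolev d s), 0 ≤ a → a + (l ^ p)⁻¹ ≤ T →
      ‖y - (u₀ + l • ζ)‖ ≤ ρ → ∃ x, Reach ν (nonlinearTerm F₁ F₂) h H a y (a + (l ^ p)⁻¹) x ∧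
        ‖x - (u₀ + l • ζ + (η - c • pow hs p ζ))‖ < ε := by
  set q := η - c • pow hs p ζ
  have hq : IsTrig q := hη.sub ((hζ.pow hs p).smul c)
  obtain ⟨Cζ, hCζ0, hCζ⟩ := exists_norm_heat_sub_le hν hζ
  obtain ⟨Cq, hCq0, hCq⟩ := exists_norm_duhamel_const_sub_le hν hq
  obtain ⟨L, hL0, hLb, hL⟩ := hF.lipschitz₂
  obtain ⟨θ, hθ, hF₁⟩ := hF.lipschitz₁
  set R := 1 + ‖u₀‖ + Cζ + ‖q‖
  have hR0 : 0 ≤ R := by positivity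
  obtain ⟨C, hC0, hC⟩ := hF₁ ζ hζ (R + 1)
  set r := min (ε / 4) 1
  have hr0 : 0 < r := lt_min (by positivity) one_pos
  have hr1 : r ≤ 1 := min_le_right _ _
  have hrε : r ≤ ε / 4 := min_le_left _ _
  obtain ⟨δ₀, hδ₀, hsmall⟩ := exists_norm_duhamel_le (s := s) hν hh (B := r / 4) (by positivity)
  have hheat : Tendsto (fun l : ℝ => ‖heat ν (l ^ p)⁻¹ u₀ - u₀‖) atTop (𝓝 0) := by
    have h1 := (continuous_heat (ν := ν) u₀).tendsto 0
    rw [heat_zero] at h1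
    simpa using ((h1.comp (tendsto_inv_pow_atTop hp)).sub_const u₀).norm
  refine ⟨r, hr0, ?_⟩
  have h8 : 0 < ε / 8 := by positivity
  have hE0 : 0 < min (r / 4) (1 / 2) := lt_min (by positivity) (by norm_num)
  have hζt : Tendsto (fun l : ℝ => Cζ * (l * (l ^ p)⁻¹)) atTop (𝓝 0) := by
    simpa using (tendsto_mul_inv_pow_atTop hp).const_mul Cζ
  have hqt : Tendsto (fun l : ℝ => Cq * (l ^ p)⁻¹) atTop (𝓝 0) := by
    simpa using (tendsto_inv_pow_atTop hp).const_mul Cq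
  filter_upwards [eventually_ge_atTop 1, (tendsto_inv_pow_atTop hp).eventually (gt_mem_nhds hδ₀),
    hheat.eventually (gt_mem_nhds h8), hζt.eventually (gt_mem_nhds h8),
    hqt.eventually (gt_mem_nhds h8),
    (tendsto_mul_inv_pow_atTop hp).eventually (gt_mem_nhds (zero_lt_one' ℝ)),
    (tendsto_error hp hθ ν (C * (1 + R)) L).eventually (gt_mem_nhds hE0)]
    with l hl hlδ hlheat hlζ hlq hl1 hlE a y ha haT hy
  set δ := (l ^ p)⁻¹
  have hlp : 0 < l ^ p := by positivity
  have hδ : 0 < δ := inv_pos.2 hlp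
  have hδl : δ * l ^ p = 1 := inv_mul_cancel₀ hlp.ne'
  have hab : a ≤ a + δ := by linarith
  have hhab : MemLp h 2 (volume.restrict (Set.Icc a (a + δ))) := MemLp.restrict_Icc ha haT hh
  have hm : 0 ≤ C * l ^ θ := by positivity
  set Q : Sobolev d (s - 1) := incl (r' := s - 1) sub_one_le_self (l ^ p • q)
  have hQ : MemLp (fun _ : ℝ => Q) 2 (volume.restrict (Set.Icc a (a + δ))) := memLp_const _
  -- the reference path, along which the nonlinear term is replaced by its leading part
  set w : ℝ → Sobolev d s := fun t => heat ν (t - a) y + duhamel s ν a t fun _ => Q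
  have hwc : ContinuousOn w (Set.Icc a (a + δ)) := continuousOn_heat_add_duhamel hν hab y hQ
  have hyd : y = (y - (u₀ + l • ζ)) + u₀ + l • ζ := by abel
  have hheaty : ∀ t, heat ν t y = heat ν t (y - (u₀ + l • ζ)) + heat ν t u₀ + l • heat ν t ζ :=
    fun t => by
      conv_lhs => rw [hyd]
      rw [heat_add, heat_add, heat_smul]
  have hwR : ∀ t ∈ Set.Icc a (a + δ), ‖w t - l • ζ‖ ≤ R := by
    intro t ht
    have e : w t - l • ζ = heat ν (t - a) (y - (u₀ + l • ζ)) + heat ν (t - a) u₀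
        + l • (heat ν (t - a) ζ - ζ) + duhamel s ν a t fun _ => Q := by
      simp only [w]
      rw [hheaty, smul_sub]
      abel
    have b1 : ‖l • (heat ν (t - a) ζ - ζ)‖ ≤ Cζ := by
      rw [norm_smul, Real.norm_of_nonneg (by linarith)]
      calc l * ‖heat ν (t - a) ζ - ζ‖ ≤ l * (Cζ * (t - a)) := by
            gcongr
            exact hCζ _ (sub_nonneg.2 ht.1)
        _ ≤ l * (Cζ * δ) := by
            gcongr
            linarith [ht.2]
        _ = Cζ * (l * δ) := by ring
        _ ≤ Cζ * 1 := by gcongr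
        _ = Cζ := mul_one _
    have b2 : ‖duhamel s ν a t fun _ => Q‖ ≤ ‖q‖ := by
      refine (norm_duhamel_incl_le hν (χ := fun _ => l ^ p • q) (memLp_of_continuousOn
        continuousOn_const).1 hQ ht (m := l ^ p * ‖q‖) (by positivity) fun τ _ => ?_).trans ?_
      · rw [norm_smul, Real.norm_of_nonneg hlp.le]
      · rw [add_sub_cancel_left, ← mul_assoc, hδl, one_mul]
    rw [e]
    calc _ ≤ ‖heat ν (t - a) (y - (u₀ + l • ζ))‖ + ‖heat ν (t - a) u₀‖
          + ‖l • (heat ν (t - a) ζ - ζ)‖ + ‖duhamel s ν a t fun _ => Q‖ := norm_add₄_le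
      _ ≤ 1 + ‖u₀‖ + Cζ + ‖q‖ := by
          gcongr
          · exact (norm_heat_le _ _).trans (hy.trans hr1)
          · exact norm_heat_le _ _
  have hφ : MemLp (fun t => h t + incl (r' := s - 1) sub_one_le_self (l ^ p • η)) 2
      (volume.restrict (Set.Icc a (a + δ))) := hhab.add (memLp_const _)
  have hlip : ∀ x x' : Sobolev d s, ‖x - l • ζ‖ ≤ R + 1 → ‖x' - l • ζ‖ ≤ R + 1 →
      ‖F₁ x - F₁ x'‖ ≤ C * l ^ θ * ‖x - x'‖ := by
    intro x x' hx hx'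
    have := (hC l hl).2 (x - l • ζ) (x' - l • ζ) hx hx'
    rwa [add_sub_cancel, add_sub_cancel, sub_sub_sub_cancel_right] at this
  have hκ' : δ * (C * l ^ θ) + Real.sqrt ((δ + ν⁻¹) * δ) * L
      ≤ δ * (C * (1 + R) * l ^ θ) + Real.sqrt ((δ + ν⁻¹) * δ) * L := by
    gcongr
    nlinarith
  obtain ⟨u, hu, huw⟩ := exists_isMild_near hν hab hF.continuous₁ hF.continuous₂ hφ (y := y) hwc
    hr0.le (L₁ := C * l ^ θ) (L₂ := L) hm hL0
    (fun t ht x x' hx hx' => hlip x x'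
      (by
        have := norm_add_le (x - w t) (w t - l • ζ)
        rw [sub_add_sub_cancel] at this
        linarith [hwR t ht])
      (by
        have := norm_add_le (x' - w t) (w t - l • ζ)
        rw [sub_add_sub_cancel] at this
        linarith [hwR t ht]))
    hL
    (by
      rw [add_sub_cancel_left]
      exact hκ'.trans (hlE.le.trans (min_le_right _ _)))
    (by
      intro t ht
      have hFw : ContinuousOn (fun τ => F₁ (w τ)) (Set.Icc a (a + δ)) :=
        hF.continuous₁.comp_continuousOn hwc
      have hFw₂ : ContinuousOn (fun τ => F₂ (w τ)) (Set.Icc a (a + δ)) :=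
        hF.continuous₂.comp_continuousOn hwc
      have hc₁ : ContinuousOn (fun τ => (c * l ^ p) • pow hs p ζ - F₁ (w τ)) (Set.Icc a (a + δ)) :=
        continuousOn_const.sub hFw
      have hc₂ : ContinuousOn (fun τ => -F₂ (w τ)) (Set.Icc a (a + δ)) := hFw₂.neg
      have hi : ContinuousOn (fun τ => incl (r' := s - 1) sub_one_le_self
          ((c * l ^ p) • pow hs p ζ - F₁ (w τ)) + -F₂ (w τ)) (Set.Icc a (a + δ)) :=
        ((incl (d := d) (r := s) (r' := s - 1) sub_one_le_self).continuous.comp_continuousOn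
          hc₁).add hc₂
      have hsrc : MemLp (fun τ => h τ + incl (r' := s - 1) sub_one_le_self (l ^ p • η)
          - (incl (r' := s - 1) sub_one_le_self (F₁ (w τ)) + F₂ (w τ))) 2
          (volume.restrict (Set.Icc a (a + δ))) := by
        refine hφ.sub (memLp_of_continuousOn ?_)
        exact ((incl (d := d) (r := s) (r' := s - 1)
          sub_one_le_self).continuous.comp_continuousOn hFw).add hFw₂
      have e : heat ν (t - a) y + duhamel s ν a t (fun τ =>
          h τ + incl (r' := s - 1) sub_one_le_self (l ^ p • η)
            - (incl (r' := s - 1) sub_one_le_self (F₁ (w τ)) + F₂ (w τ))) - w t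
          = duhamel s ν a t h + duhamel s ν a t (fun τ => incl (r' := s - 1) sub_one_le_self
            ((c * l ^ p) • pow hs p ζ - F₁ (w τ)) + -F₂ (w τ)) := by
        rw [← duhamel_add hν hhab (memLp_of_continuousOn hi) ht, add_sub_add_left_eq_sub,
          ← duhamel_sub hν hsrc hQ ht]
        congr 1
        funext τ
        simp only [Q, q, map_sub, map_smul, smul_sub, smul_smul]
        rw [mul_comm (l ^ p) c]
        abel
      rw [e]
      have hm₁ : 0 ≤ C * (1 + R) * l ^ θ := by positivity
      have b1 := hsmall a δ ha hlδ haT t ht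
      have b2 := norm_duhamel_incl_add_le hν hc₁ hc₂ ht (m₁ := C * (1 + R) * l ^ θ) (m₂ := L)
        hm₁ hL0 (fun τ hτ => by
          have h1 := (hC l hl).1
          have h2 := hlip (w τ) (l • ζ) (by linarith [hwR τ hτ]) (by simp; linarith)
          have h3 := hwR τ hτ
          rw [← norm_neg, neg_sub]
          calc ‖F₁ (w τ) - (c * l ^ p) • pow hs p ζ‖
              ≤ ‖F₁ (w τ) - F₁ (l • ζ)‖ + ‖F₁ (l • ζ) - (c * l ^ p) • pow hs p ζ‖ :=
                norm_sub_le_norm_sub_add_norm_sub _ _ _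
            _ ≤ C * l ^ θ * R + C * l ^ θ := by
                refine add_le_add (h2.trans ?_) h1
                gcongr
            _ = C * (1 + R) * l ^ θ := by ring)
        (fun τ _ => by rw [norm_neg]; exact hLb _)
      rw [add_sub_cancel_left] at b2
      have b3 := hlE.le.trans (min_le_left (r / 4) (1 / 2))
      refine (norm_add_le _ _).trans ?_
      linarith)
  have hη' : StronglyMeasurable fun _ : ℝ => incl (r' := s - 1) sub_one_le_self (l ^ p • η) :=
    stronglyMeasurable_const
  refine ⟨u (a + δ), ⟨_, u, hη', ⟨_, fun _ => le_rfl⟩, fun _ => ?_, hu, rfl⟩, ?_⟩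
  · rw [map_smul]
    exact H.smul_mem _ hηH
  · have hb : a + δ ∈ Set.Icc a (a + δ) := ⟨hab, le_rfl⟩
    have e : u (a + δ) - (u₀ + l • ζ + q) = (u (a + δ) - w (a + δ))
        + heat ν δ (y - (u₀ + l • ζ)) + (heat ν δ u₀ - u₀) + l • (heat ν δ ζ - ζ)
        + (duhamel s ν a (a + δ) (fun _ => Q) - q) := by
      simp only [w]
      rw [add_sub_cancel_left, hheaty, smul_sub]
      abel
    have b1 : ‖l • (heat ν δ ζ - ζ)‖ ≤ Cζ * (l * δ) := by
      rw [norm_smul, Real.norm_of_nonneg (by linarith)]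
      calc l * ‖heat ν δ ζ - ζ‖ ≤ l * (Cζ * δ) := by
            gcongr
            exact hCζ _ hδ.le
        _ = Cζ * (l * δ) := by ring
    have b2 : ‖duhamel s ν a (a + δ) (fun _ => Q) - q‖ ≤ Cq * δ := by
      have e1 : duhamel s ν a (a + δ) (fun _ => Q) - q
          = l ^ p • (duhamel s ν a (a + δ) (fun _ => incl (r' := s - 1) sub_one_le_self q)
            - δ • q) := by
        rw [smul_sub, smul_smul, mul_comm (l ^ p) δ, hδl, one_smul, ← duhamel_const_smul hν _ _ hab]
        simp only [Q, map_smul]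
      rw [e1, norm_smul, Real.norm_of_nonneg hlp.le]
      calc l ^ p * _ ≤ l ^ p * (Cq * δ ^ 2) := by
            gcongr
            exact hCq a δ hδ.le
        _ = Cq * δ * (δ * l ^ p) := by ring
        _ = Cq * δ := by rw [hδl, mul_one]
    rw [e]
    calc _ ≤ ‖u (a + δ) - w (a + δ)‖ + ‖heat ν δ (y - (u₀ + l • ζ))‖ + ‖heat ν δ u₀ - u₀‖
          + ‖l • (heat ν δ ζ - ζ)‖ + ‖duhamel s ν a (a + δ) (fun _ => Q) - q‖ :=
          (norm_add_le _ _).trans (add_le_add_left norm_add₄_le _)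
      _ ≤ r + r + ‖heat ν δ u₀ - u₀‖ + Cζ * (l * δ) + Cq * δ := by
          gcongr
          · exact huw _ hb
          · exact (norm_heat_le _ _).trans hy
      _ < ε := by linarith

end Sobolev

/-! ### The algebraic saturation property -/

namespace Sobolev

variable {s : ℝ}

section algebra

variable (hs : (d : ℝ) / 2 < s)

theorem pow_smul (n : ℕ) (a : ℝ) (u : Sobolev d s) : pow hs n (a • u) = a ^ n • pow hs n u := by
  apply toFun_injective hs
  funext x
  simp only [toFun_pow, toFun_smul, mul_pow]

theorem pow_two_eq (u : Sobolev d s) : pow hs 2 u = mul hs u u := by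
  apply toFun_injective hs
  funext x
  simp only [toFun_pow, toFun_mul, pow_two]

theorem pow_one_add (n : ℕ) (u : Sobolev d s) :
    pow hs n (cosMode s 0 + u) = ∑ j ∈ Finset.range (n + 1), (n.choose j : ℝ) • pow hs j u := by
  apply toFun_injective hs
  funext x
  simp only [toFun_pow, toFun_add hs, toFun_sum hs, toFun_smul, toFun_one]
  rw [add_comm, add_pow]
  simp [mul_comm]

/-- The Taylor expansion of the power `n + 2` at the constant function `1`. -/
theorem pow_one_add_smul (n : ℕ) (e : ℝ) (u : Sobolev d s) :
    pow hs (n + 2) (cosMode s 0 + e • u) = cosMode s 0 + ((n + 2 : ℕ) * e) • u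
      + e ^ 2 • ∑ i ∈ Finset.range (n + 1),
        (((n + 2).choose (i + 2) : ℝ) * e ^ i) • pow hs (i + 2) u := by
  rw [pow_one_add, Finset.sum_range_succ', Finset.sum_range_succ', Finset.smul_sum]
  have h0 : pow hs 0 (e • u) = cosMode s 0 := rfl
  have h1 : pow hs 1 (e • u) = e • u := by
    apply toFun_injective hs
    funext x
    simp only [toFun_pow, pow_one]
  have h2 : ∀ i, (((n + 2).choose (i + 1 + 1) : ℕ) : ℝ) • pow hs (i + 1 + 1) (e • u)
      = e ^ 2 • (((n + 2).choose (i + 2) : ℝ) * e ^ i) • pow hs (i + 2) u := by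
    intro i
    rw [pow_smul, smul_smul, smul_smul]
    congr 1
    ring
  rw [Finset.sum_congr rfl fun i _ => h2 i, zero_add, h1, h0, Nat.choose_zero_right,
    Nat.choose_one_right, Nat.cast_one, one_smul, smul_smul]
  abel

theorem mul_cosMode_self_add (k : Fin d → ℤ) :
    mul hs (cosMode s k) (cosMode s k) + mul hs (sinMode s k) (sinMode s k) = cosMode s 0 := by
  apply toFun_injective hs
  funext x
  rw [toFun_one]
  simp only [toFun_add hs, toFun_mul, toFun_cosMode, toFun_sinMode]
  linarith [Real.sin_sq_add_cos_sq (pairing x k)]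

theorem cosMode_add (k l : Fin d → ℤ) : cosMode s (k + l)
    = mul hs (cosMode s k) (cosMode s l) - mul hs (sinMode s k) (sinMode s l) := by
  apply toFun_injective hs
  funext x
  simp only [toFun_sub hs, toFun_mul, toFun_cosMode, toFun_sinMode, pairing_add_right, Real.cos_add]

theorem sinMode_add (k l : Fin d → ℤ) : sinMode s (k + l)
    = mul hs (sinMode s k) (cosMode s l) + mul hs (cosMode s k) (sinMode s l) := by
  apply toFun_injective hs
  funext x
  simp only [toFun_add hs, toFun_mul, toFun_cosMode, toFun_sinMode, pairing_add_right, Real.sin_add]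

theorem cosMode_neg (k : Fin d → ℤ) : cosMode s (-k) = cosMode s k := by
  ext m
  rw [coeff_cosMode, coeff_cosMode, neg_neg, add_comm]

theorem sinMode_neg (k : Fin d → ℤ) : sinMode s (-k) = -sinMode s k := by
  ext m
  rw [map_neg, Pi.neg_apply, coeff_sinMode, coeff_sinMode, neg_neg, ← neg_div, neg_sub]

theorem sinMode_zero : sinMode s (0 : Fin d → ℤ) = 0 := by
  ext m
  rw [coeff_sinMode, neg_zero, sub_self, zero_div, map_zero, Pi.zero_apply]

end algebra

/-- The set of all `q` such that the line through `q` is contained in a set closed under addition. -/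
def linealitySpace (S : Set (Sobolev d s)) (h0 : 0 ∈ S) (hadd : ∀ q ∈ S, ∀ q' ∈ S, q + q' ∈ S) :
    Submodule ℝ (Sobolev d s) where
  carrier := {q | ∀ a : ℝ, a • q ∈ S}
  add_mem' hq hq' a := by
    rw [smul_add]
    exact hadd _ (hq a) _ (hq' a)
  zero_mem' a := by rwa [smul_zero]
  smul_mem' b q hq a := by
    rw [smul_smul]
    exact hq _

section saturation

variable (hs : (d : ℝ) / 2 < s) {S : Set (Sobolev d s)} {h0 : 0 ∈ S}
  {hadd : ∀ q ∈ S, ∀ q' ∈ S, q + q' ∈ S} {c : ℝ} {p : ℕ}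

/-- The second-order term of `(1 + eζ)ᵖ` at `e = 0` yields the squares, up to a sign. -/
theorem smul_mul_self_mem (hcl : IsClosed S) (hp : 2 ≤ p) (hc : c ≠ 0)
    (h1 : cosMode s 0 ∈ linealitySpace S h0 hadd)
    (hpow : ∀ ζ, IsTrig ζ → ζ ∈ linealitySpace S h0 hadd → -(c • pow hs p ζ) ∈ S)
    {ζ : Sobolev d s} (hζ : IsTrig ζ) (hζS : ζ ∈ linealitySpace S h0 hadd) {b : ℝ}
    (hb : b * c ≤ 0) : b • mul hs ζ ζ ∈ S := by
  obtain ⟨n, rfl⟩ : ∃ n, p = n + 2 := ⟨p - 2, by omega⟩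
  set N : ℝ := (((n + 2).choose 2 : ℕ) : ℝ)
  have hN : 0 < N := by
    have : 0 < (n + 2).choose 2 := Nat.choose_pos (by omega)
    exact Nat.cast_pos.2 this
  set Q : ℝ → Sobolev d s := fun e => ∑ i ∈ Finset.range (n + 1),
    (((n + 2).choose (i + 2) : ℝ) * e ^ i) • pow hs (i + 2) ζ
  have hQc : Continuous Q := by
    refine continuous_finsetSum _ fun i _ => ?_
    exact (continuous_const.mul (continuous_pow i)).smul continuous_const
  have hQ0 : Q 0 = N • mul hs ζ ζ := by
    simp only [Q]
    rw [Finset.sum_eq_single_of_mem 0 (by simp)]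
    · rw [pow_zero, mul_one, zero_add, pow_two_eq]
    · intro i _ hi
      rw [zero_pow hi, mul_zero, zero_smul]
  have hlim : Tendsto (fun e => (b / N) • Q e) (𝓝[>] 0) (𝓝 (b • mul hs ζ ζ)) := by
    have hc' : Continuous fun e => (b / N) • Q e := by fun_prop
    have := (hc'.tendsto 0).mono_left (nhdsWithin_le_nhds (s := Set.Ioi 0))
    rwa [hQ0, smul_smul, div_mul_cancel₀ _ hN.ne'] at this
  refine hcl.mem_of_tendsto hlim ?_
  filter_upwards [self_mem_nhdsWithin] with e he
  have he0 : (0 : ℝ) < e := he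
  have hA : 0 ≤ -b / c / (N * e ^ 2) := by
    have : 0 ≤ -b / c := by
      rw [← mul_div_mul_right (-b) c hc]
      exact div_nonneg (by linarith) (mul_self_nonneg c)
    positivity
  -- `m` is chosen so that the coefficient of the quadratic term becomes `b / N`
  set m : ℝ := (-b / c / (N * e ^ 2)) ^ (((n + 2 : ℕ) : ℝ)⁻¹)
  have hm : m ^ (n + 2) = -b / c / (N * e ^ 2) := Real.rpow_inv_natCast_pow hA (by omega)
  have hu := hpow (m • (cosMode s 0 + e • ζ)) (((isTrig_cosMode 0).add (hζ.smul e)).smul m)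
    (Submodule.smul_mem _ _ (Submodule.add_mem _ h1 (Submodule.smul_mem _ _ hζS)))
  have hv : (c * m ^ (n + 2)) • (cosMode s 0 + ((n + 2 : ℕ) * e) • ζ) ∈ S :=
    Submodule.add_mem _ h1 (Submodule.smul_mem _ ((n + 2 : ℕ) * e : ℝ) hζS) _
  have hsum := hadd _ hu _ hv
  have e1 : -(c • pow hs (n + 2) (m • (cosMode s 0 + e • ζ)))
      + (c * m ^ (n + 2)) • (cosMode s 0 + ((n + 2 : ℕ) * e) • ζ) = (b / N) • Q e := by
    have e2 : b / N = -(c * m ^ (n + 2) * e ^ 2) := by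
      rw [hm]
      field_simp
    rw [pow_smul, pow_one_add_smul, e2, smul_smul, smul_add (c * m ^ (n + 2)) _ (e ^ 2 • _),
      smul_smul _ (e ^ 2), neg_smul]
    abel
  rwa [e1] at hsum

/-- A closed additive semigroup of directions which contains the lines spanned by the modes in a
set of generators, and the value of `-cζᵖ` on the trigonometric polynomials of its lineality space,
is the whole space. -/
theorem eq_univ_of_saturation (hcl : IsClosed S) (hadd : ∀ q ∈ S, ∀ q' ∈ S, q + q' ∈ S)
    (hp : 2 ≤ p) (hc : c ≠ 0) {I : Set (Fin d → ℤ)} (hI0 : 0 ∈ I)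
    (hgen : Submodule.span ℤ I = ⊤)
    (hmodes : ∀ k ∈ I, ∀ a : ℝ, a • cosMode s k ∈ S ∧ a • sinMode s k ∈ S)
    (hpow : ∀ ζ, IsTrig ζ → (∀ a : ℝ, a • ζ ∈ S) → -(c • pow hs p ζ) ∈ S) : S = Set.univ := by
  have h0 : 0 ∈ S := by
    have := (hmodes 0 hI0 0).1
    rwa [zero_smul] at this
  set L := linealitySpace S h0 hadd
  have h1 : cosMode s 0 ∈ L := fun a => (hmodes 0 hI0 a).1
  have hsq : ∀ ζ, IsTrig ζ → ζ ∈ L → ∀ b : ℝ, b * c ≤ 0 → b • mul hs ζ ζ ∈ S :=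
    fun ζ hζ hζS b hb => smul_mul_self_mem hs hcl hp hc h1 hpow hζ hζS hb
  have hcos : ∀ k, cosMode s k ∈ L → sinMode s k ∈ L →
      mul hs (cosMode s k) (cosMode s k) ∈ L ∧ mul hs (sinMode s k) (sinMode s k) ∈ L := by
    intro k hck hsk
    have e := mul_cosMode_self_add hs k
    refine ⟨fun b => ?_, fun b => ?_⟩
    · rcases le_total (b * c) 0 with hb | hb
      · exact hsq _ (isTrig_cosMode k) hck b hb
      · have h2 := hadd _ (h1 b) _ (hsq _ (isTrig_sinMode k) hsk (-b) (by linarith))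
        rwa [← e, smul_add, neg_smul, add_neg_cancel_right] at h2
    · rcases le_total (b * c) 0 with hb | hb
      · exact hsq _ (isTrig_sinMode k) hsk b hb
      · have h2 := hadd _ (h1 b) _ (hsq _ (isTrig_cosMode k) hck (-b) (by linarith))
        rwa [← e, smul_add, neg_smul, add_right_comm, add_neg_cancel, zero_add] at h2
  have hmul : ∀ ζ ξ, IsTrig ζ → IsTrig ξ → ζ ∈ L → ξ ∈ L → mul hs ζ ζ ∈ L → mul hs ξ ξ ∈ L →
      mul hs ζ ξ ∈ L := by
    intro ζ ξ hζ hξ hζL hξL hζ2 hξ2 b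
    rcases le_total (b * c) 0 with hb | hb
    · have h2 := hadd _ (hsq _ (hζ.add hξ) (L.add_mem hζL hξL) (b / 2) (by linarith)) _
        (L.add_mem hζ2 hξ2 (-(b / 2)))
      convert! h2 using 1
      apply toFun_injective hs
      funext x
      simp only [toFun_add hs, toFun_smul, toFun_mul]
      ring
    · have h2 := hadd _ (hsq _ (hζ.sub hξ) (L.sub_mem hζL hξL) (-(b / 2)) (by linarith)) _
        (L.add_mem hζ2 hξ2 (b / 2))
      convert! h2 using 1
      apply toFun_injective hs
      funext x
      simp only [toFun_add hs, toFun_sub hs, toFun_smul, toFun_mul]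
      ring
  let A : AddSubgroup (Fin d → ℤ) :=
    { carrier := {k | cosMode s k ∈ L ∧ sinMode s k ∈ L}
      zero_mem' := ⟨h1, by rw [sinMode_zero]; exact L.zero_mem⟩
      neg_mem' := fun {k} hk => ⟨by rw [cosMode_neg]; exact hk.1,
        by rw [sinMode_neg]; exact L.neg_mem hk.2⟩
      add_mem' := fun {k l} hk hl => by
        obtain ⟨hk1, hk2⟩ := hcos k hk.1 hk.2
        obtain ⟨hl1, hl2⟩ := hcos l hl.1 hl.2
        constructor
        · rw [cosMode_add hs]
          exact L.sub_mem
            (hmul _ _ (isTrig_cosMode k) (isTrig_cosMode l) hk.1 hl.1 hk1 hl1)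
            (hmul _ _ (isTrig_sinMode k) (isTrig_sinMode l) hk.2 hl.2 hk2 hl2)
        · rw [sinMode_add hs]
          exact L.add_mem
            (hmul _ _ (isTrig_sinMode k) (isTrig_cosMode l) hk.2 hl.1 hk2 hl1)
            (hmul _ _ (isTrig_cosMode k) (isTrig_sinMode l) hk.1 hl.2 hk1 hl2) }
  have hA : ∀ k, k ∈ A := by
    have hle : Submodule.span ℤ I ≤ AddSubgroup.toIntSubmodule A :=
      Submodule.span_le.2 fun k hk => ⟨fun a => (hmodes k hk a).1, fun a => (hmodes k hk a).2⟩
    rw [hgen] at hle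
    exact fun k => hle Submodule.mem_top
  refine Set.eq_univ_of_forall fun u => hcl.mem_of_tendsto (tendsto_truncate u) ?_
  refine Eventually.of_forall fun n => ?_
  have e : truncate n u = modeSum s n (coeff u) := by
    ext k
    rw [coeff_modeSum _ _ (coeff_neg u), coeff_truncate]
  have hmem : modeSum s n (coeff u) ∈ L := L.sum_mem fun k _ =>
    L.sub_mem (L.smul_mem _ (hA k).1) (L.smul_mem _ (hA k).2)
  have h2 := hmem 1
  rwa [one_smul, ← e] at h2

end saturation

end Sobolev

/-! ### Steering in arbitrary directions and approximate controllability -/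

namespace Sobolev

variable {s ν T : ℝ} {G : Sobolev d s → Sobolev d (s - 1)} {h : ℝ → Sobolev d (s - 1)}
  {H : Submodule ℝ (Sobolev d (s - 1))}

/-- Any state can be moved approximately by `q`, in an arbitrarily short time, starting at any time
before `T`. -/
def Steer (ν : ℝ) (G : Sobolev d s → Sobolev d (s - 1)) (h : ℝ → Sobolev d (s - 1))
    (H : Submodule ℝ (Sobolev d (s - 1))) (T : ℝ) (q : Sobolev d s) : Prop :=
  ∀ (a : ℝ) (y : Sobolev d s) (ε τ : ℝ), 0 ≤ a → a < τ → τ ≤ T → 0 < ε →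
    ∃ b x, a < b ∧ b < τ ∧ Reach ν G h H a y b x ∧ ‖x - (y + q)‖ < ε

/-- Two steering directions are followed one after the other, each within half of the error and before the
deadline `τ`. -/
theorem Steer.add (hν : 0 < ν) (hG : Continuous G)
    (hh : MemLp h 2 (volume.restrict (Set.Icc 0 T))) {q q' : Sobolev d s}
    (hq : Steer ν G h H T q) (hq' : Steer ν G h H T q') : Steer ν G h H T (q + q') := by
  intro a y ε τ ha haτ hτ hε
  obtain ⟨b, x, hab, hbτ, hr, hx⟩ := hq a y (ε / 2) τ ha haτ hτ (by positivity)
  obtain ⟨b', x', hbb', hb'τ, hr', hx'⟩ := hq' b x (ε / 2) τ (by linarith) hbτ hτ (by positivity)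
  refine ⟨b', x', hab.trans hbb', hb'τ, hr.trans hν hab.le hbb'.le hG
    (MemLp.restrict_Icc ha (by linarith) hh) hr', ?_⟩
  have e : x' - (y + (q + q')) = (x' - (x + q')) + (x - (y + q)) := by abel
  rw [e]
  exact (norm_add_le _ _).trans_lt (by linarith)

theorem isClosed_steer : IsClosed {q | Steer ν G h H T q} := by
  refine isClosed_of_closure_subset fun q hq a y ε τ ha haτ hτ hε => ?_
  obtain ⟨q', hq', hqq'⟩ := Metric.mem_closure_iff.1 hq (ε / 2) (by positivity)
  obtain ⟨b, x, hab, hbτ, hr, hx⟩ := hq' a y (ε / 2) τ ha haτ hτ (by positivity)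
  refine ⟨b, x, hab, hbτ, hr, ?_⟩
  have e : x - (y + q) = (x - (y + q')) + (q' - q) := by abel
  rw [dist_comm, dist_eq_norm] at hqq'
  rw [e]
  exact (norm_add_le _ _).trans_lt (by linarith)

variable {hs : (d : ℝ) / 2 < s} {f : ℝ → ℝ} {c : ℝ} {p : ℕ} {F₁ : Sobolev d s → Sobolev d s}
  {F₂ : Sobolev d s → Sobolev d (s - 1)}

theorem pow_zero_right {n : ℕ} (hn : n ≠ 0) : pow hs n (0 : Sobolev d s) = 0 := by
  have := pow_smul hs n 0 (0 : Sobolev d s)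
  rwa [zero_pow hn, zero_smul, zero_smul] at this

namespace IsNonlinearity

/-- The directions of the control space are reached by a large constant control. -/
theorem steer_control (hF : IsNonlinearity hs f c p F₁ F₂) (hν : 0 < ν) (hp : 2 ≤ p)
    (hh : MemLp h 2 (volume.restrict (Set.Icc 0 T))) {η : Sobolev d s} (hη : IsTrig η)
    (hηH : incl (r' := s - 1) sub_one_le_self η ∈ H) :
    Steer ν (nonlinearTerm F₁ F₂) h H T η := by
  intro a y ε τ ha haτ hτ hε
  obtain ⟨ρ, hρ, hev⟩ := hF.exists_reach_near hν hp hh isTrig_zero hη hηH y hε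
  obtain ⟨l, hl, hlδ, hl1⟩ := (hev.and (((tendsto_inv_pow_atTop hp).eventually
    (gt_mem_nhds (sub_pos.2 haτ))).and (eventually_ge_atTop 1))).exists
  have hδ : 0 < (l ^ p)⁻¹ := by positivity
  obtain ⟨x, hr, hx⟩ := hl a y ha (by linarith) (by simpa using hρ.le)
  refine ⟨a + (l ^ p)⁻¹, x, by linarith, by linarith, hr, ?_⟩
  rwa [pow_zero_right (by omega), smul_zero, smul_zero, add_zero, sub_zero] at hx

/-- Moving far in the direction `ζ`, waiting, and moving back produces the direction `-cζᵖ`. -/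
theorem steer_neg_pow (hF : IsNonlinearity hs f c p F₁ F₂) (hν : 0 < ν) (hp : 2 ≤ p)
    (hh : MemLp h 2 (volume.restrict (Set.Icc 0 T))) {ζ : Sobolev d s} (hζ : IsTrig ζ)
    (hζS : ∀ a : ℝ, Steer ν (nonlinearTerm F₁ F₂) h H T (a • ζ)) :
    Steer ν (nonlinearTerm F₁ F₂) h H T (-(c • pow hs p ζ)) := by
  intro a y ε τ ha haτ hτ hε
  have hG := hF.continuous_nonlinearTerm
  have hη : incl (r' := s - 1) sub_one_le_self (0 : Sobolev d s) ∈ H := by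
    rw [map_zero]; exact H.zero_mem
  obtain ⟨ρ, hρ, hev⟩ := hF.exists_reach_near hν hp hh hζ isTrig_zero hη y (half_pos hε)
  have hτ2 : 0 < (τ - a) / 2 := by linarith
  obtain ⟨l, hl, hlδ, hl1⟩ := (hev.and (((tendsto_inv_pow_atTop hp).eventually
    (gt_mem_nhds hτ2)).and (eventually_ge_atTop 1))).exists
  have hδ : 0 < (l ^ p)⁻¹ := by positivity
  obtain ⟨b₁, x₁, hab₁, hb₁, hr₁, hx₁⟩ := hζS l a y ρ (a + (τ - a) / 2) ha (by linarith)
    (by linarith) hρ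
  obtain ⟨x₂, hr₂, hx₂⟩ := hl b₁ x₁ (by linarith) (by linarith) hx₁.le
  obtain ⟨b₃, x₃, hb₃, hb₃τ, hr₃, hx₃⟩ := hζS (-l) (b₁ + (l ^ p)⁻¹) x₂ (ε / 2) τ (by linarith)
    (by linarith) hτ (half_pos hε)
  refine ⟨b₃, x₃, by linarith, hb₃τ, ?_, ?_⟩
  · have h12 := hr₁.trans hν hab₁.le (by linarith) hG
      (MemLp.restrict_Icc ha (by linarith) hh) hr₂
    exact h12.trans hν (by linarith) hb₃.le hG (MemLp.restrict_Icc ha (by linarith) hh) hr₃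
  · have e : x₃ - (y + -(c • pow hs p ζ))
        = (x₃ - (x₂ + -l • ζ)) + (x₂ - (y + l • ζ + (0 - c • pow hs p ζ))) := by
      rw [neg_smul]; abel
    rw [e]
    exact (norm_add_le _ _).trans_lt (by linarith)

/-- A state near `u₁` can be kept near `u₁` during any sufficiently short time. -/
theorem exists_reach_hold (hF : IsNonlinearity hs f c p F₁ F₂) (hν : 0 < ν) (hp : 2 ≤ p)
    (hh : MemLp h 2 (volume.restrict (Set.Icc 0 T))) (u₁ : Sobolev d s) {ε : ℝ} (hε : 0 < ε) :
    ∃ ρ κ : ℝ, 0 < ρ ∧ 0 < κ ∧ ∀ (a δ : ℝ) (y : Sobolev d s), 0 ≤ a → 0 < δ → δ ≤ κ →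
      a + δ ≤ T → ‖y - u₁‖ ≤ ρ →
      ∃ x, Reach ν (nonlinearTerm F₁ F₂) h H a y (a + δ) x ∧ ‖x - u₁‖ < ε := by
  have hη : incl (r' := s - 1) sub_one_le_self (0 : Sobolev d s) ∈ H := by
    rw [map_zero]; exact H.zero_mem
  obtain ⟨ρ, hρ, hev⟩ := hF.exists_reach_near hν hp hh isTrig_zero isTrig_zero hη u₁ hε
  obtain ⟨l₀, hl₀⟩ := eventually_atTop.1 hev
  have hm : 0 < max l₀ 1 := lt_max_of_lt_right one_pos
  refine ⟨ρ, (max l₀ 1 ^ p)⁻¹, hρ, by positivity, fun a δ y ha hδ hδκ haT hy => ?_⟩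
  -- the parameter `l` for which the length `l⁻ᵖ` of the time interval is `δ`
  set l := δ⁻¹ ^ ((p : ℝ)⁻¹)
  have hl : l ^ p = δ⁻¹ := Real.rpow_inv_natCast_pow (inv_nonneg.2 hδ.le) (by omega)
  have hl0 : 0 ≤ l := Real.rpow_nonneg (inv_nonneg.2 hδ.le) _
  have hle : max l₀ 1 ≤ l := by
    rw [← pow_le_pow_iff_left₀ hm.le hl0 (by omega : p ≠ 0), hl]
    exact (le_inv_comm₀ hδ (by positivity)).1 hδκ
  have h1 := hl₀ l ((le_max_left _ _).trans hle) a y ha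
  rw [hl, inv_inv] at h1
  obtain ⟨x, hr, hx⟩ := h1 haT (by rwa [smul_zero, add_zero])
  refine ⟨x, hr, ?_⟩
  rwa [pow_zero_right (by omega), smul_zero, smul_zero, sub_zero, add_zero, add_zero] at hx

/-- If every direction can be followed, every target is reached approximately at time `T`: the state
is brought back near the target after each time step of a fixed length. -/
theorem exists_reach_final (hF : IsNonlinearity hs f c p F₁ F₂) (hν : 0 < ν) (hp : 2 ≤ p)
    (hT : 0 < T) (hh : MemLp h 2 (volume.restrict (Set.Icc 0 T)))
    (hall : ∀ q, Steer ν (nonlinearTerm F₁ F₂) h H T q) (y u₁ : Sobolev d s) {ε : ℝ} (hε : 0 < ε) :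
    ∃ x, Reach ν (nonlinearTerm F₁ F₂) h H 0 y T x ∧ ‖x - u₁‖ < ε := by
  have hG := hF.continuous_nonlinearTerm
  obtain ⟨ρ, κ, hρ, hκ, hhold⟩ := hF.exists_reach_hold (H := H) hν hp hh u₁ hε
  have key : ∀ n : ℕ, ∀ (a : ℝ) (y : Sobolev d s), 0 ≤ a → a < T → T - a ≤ (n + 1) * κ →
      ∃ x, Reach ν (nonlinearTerm F₁ F₂) h H a y T x ∧ ‖x - u₁‖ < ε := by
    intro n
    induction n with
    | zero =>
      intro a y ha haT hn
      obtain ⟨b, x, hab, hbT, hr, hx⟩ := hall (u₁ - y) a y ρ T ha haT le_rfl hρ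
      rw [add_sub_cancel] at hx
      rw [Nat.cast_zero, zero_add, one_mul] at hn
      obtain ⟨x', hr', hx'⟩ := hhold b (T - b) x (by linarith) (by linarith) (by linarith)
        (by linarith) hx.le
      rw [add_sub_cancel] at hr'
      exact ⟨x', hr.trans hν hab.le hbT.le hG (MemLp.restrict_Icc ha le_rfl hh) hr', hx'⟩
    | succ n ih =>
      intro a y ha haT hn
      by_cases hle : T - a ≤ (n + 1) * κ
      · exact ih a y ha haT hle
      · push Not at hle
        have hκa : κ < T - a := by
          have : 0 ≤ n * κ := by positivity
          linarith
        obtain ⟨b, x, hab, hbT, hr, hx⟩ := hall (u₁ - y) a y ρ (T - κ) ha (by linarith)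
          (by linarith) hρ
        rw [add_sub_cancel] at hx
        obtain ⟨x', hr', -⟩ := hhold b κ x (by linarith) hκ le_rfl (by linarith) hx.le
        push_cast at hn
        obtain ⟨x'', hr'', hx''⟩ := ih (b + κ) x' (by linarith) (by linarith) (by linarith)
        have h12 := hr.trans hν hab.le (by linarith) hG
          (MemLp.restrict_Icc ha (by linarith) hh) hr'
        exact ⟨x'', h12.trans hν (by linarith) (by linarith) hG
          (MemLp.restrict_Icc ha le_rfl hh) hr'', hx''⟩
  obtain ⟨n, hn⟩ := exists_nat_ge (T / κ)
  refine key n 0 y le_rfl hT ?_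
  rw [div_le_iff₀ hκ] at hn
  linarith

theorem coeff_nonlinearTerm (hF : IsNonlinearity hs f c p F₁ F₂) (u : Sobolev d s)
    (k : Fin d → ℤ) :
    coeff (nonlinearTerm F₁ F₂ u) k = fourierCoefficient (fun x => f (toFun u x)) k := by
  rw [nonlinearTerm, map_add, Pi.add_apply, coeff_incl, hF.coeff_eq]

/-- The mild solutions are the solutions in the sense of distributions. -/
theorem isSolution_iff_isMild (hF : IsNonlinearity hs f c p F₁ F₂) (hν : 0 < ν) (hT : 0 ≤ T)
    {φ : ℝ → Sobolev d (s - 1)} (hφ : MemLp φ 2 (volume.restrict (Set.Icc 0 T)))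
    {y : Sobolev d s} {u : ℝ → Sobolev d s} :
    IsSolution T ν f y φ u ↔ IsMild ν (nonlinearTerm F₁ F₂) φ 0 T y u := by
  set G := nonlinearTerm F₁ F₂
  have hG : Continuous G := hF.continuous_nonlinearTerm
  have hsrc : ContinuousOn u (Set.Icc 0 T) →
      MemLp (fun τ => φ τ - G (u τ)) 2 (volume.restrict (Set.Icc 0 T)) :=
    fun hu => hφ.sub (memLp_of_continuousOn (hG.comp_continuousOn hu))
  have hiff : ∀ (hu : ContinuousOn u (Set.Icc 0 T)) (k : Fin d → ℤ),
      (∀ t ∈ Set.Icc 0 T, coeff (u t) k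
        = coeff (heat ν (t - 0) y + duhamel s ν 0 t (fun τ => φ τ - G (u τ))) k) ↔
      ∀ t ∈ Set.Icc 0 T, coeff (u t) k - coeff y k
        = ∫ τ in (0 : ℝ)..t, (-((ν * freqSq k : ℝ) : ℂ) * coeff (u τ) k
          - fourierCoefficient (fun x => f (toFun (u τ) x)) k + coeff (φ τ) k) := by
    intro hu k
    have h1 := mild_iff_integral (ν := ν) k (c := fun t => coeff (u t) k)
      (ψ := fun τ => coeff (φ τ - G (u τ)) k) (c₀ := coeff y k) hT
      ((continuous_coeff k).comp_continuousOn hu)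
      (intervalIntegrable_coeff (hsrc hu) ⟨hT, le_rfl⟩ k)
    have h2 : ∀ τ, -((ν * freqSq k : ℝ) : ℂ) * coeff (u τ) k + coeff (φ τ - G (u τ)) k
        = -((ν * freqSq k : ℝ) : ℂ) * coeff (u τ) k
          - fourierCoefficient (fun x => f (toFun (u τ) x)) k + coeff (φ τ) k := by
      intro τ
      rw [map_sub, Pi.sub_apply, hF.coeff_nonlinearTerm]
      ring
    simp only [h2] at h1
    refine Iff.trans (forall₂_congr fun t ht => ?_) h1
    rw [map_add, Pi.add_apply, coeff_heat hν (by linarith [ht.1]), coeff_duhamel hν (hsrc hu) ht,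
      duhamelSeq]
  constructor
  · intro hu
    exact ⟨hu.continuousOn, fun t ht => ext fun k =>
      (hiff hu.continuousOn k).2 (fun t ht => hu.equation t ht k) t ht⟩
  · intro hu
    refine ⟨hu.continuousOn, exists_memLp_of_mild hν hT (hsrc hu.continuousOn) hu.continuousOn hu.eq,
      hu.left hT, fun t ht k => ?_⟩
    exact (hiff hu.continuousOn k).1 (fun t ht => by rw [← hu.eq t ht]) t ht

end IsNonlinearity

theorem incl_cosMode {r r' : ℝ} (hr : r' ≤ r) (k : Fin d → ℤ) :
    incl hr (cosMode r k) = cosMode r' k := by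
  ext m
  rw [coeff_incl, coeff_cosMode, coeff_cosMode]

theorem incl_sinMode {r r' : ℝ} (hr : r' ≤ r) (k : Fin d → ℤ) :
    incl hr (sinMode r k) = sinMode r' k := by
  ext m
  rw [coeff_incl, coeff_sinMode, coeff_sinMode]

theorem cosMode_mem_trigSpace {r : ℝ} {I : Finset (Fin d → ℤ)} {k : Fin d → ℤ} (hk : k ∈ I) :
    cosMode r k ∈ trigSpace r I :=
  Submodule.subset_span ⟨k, hk, Or.inr (coeff_cosMode_eq_fourierCoefficient k)⟩

theorem sinMode_mem_trigSpace {r : ℝ} {I : Finset (Fin d → ℤ)} {k : Fin d → ℤ} (hk : k ∈ I) :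
    sinMode r k ∈ trigSpace r I :=
  Submodule.subset_span ⟨k, hk, Or.inl (coeff_sinMode_eq_fourierCoefficient k)⟩

theorem IsNonlinearity.approximatelyControllable (hF : IsNonlinearity hs f c p F₁ F₂) (hν : 0 < ν)
    (hT : 0 < T) (hp : 2 ≤ p) (hc : c ≠ 0) (hh : MemLp h 2 (volume.restrict (Set.Icc 0 T)))
    {I : Finset (Fin d → ℤ)} (hI0 : 0 ∈ I)
    (hIgen : Submodule.span ℤ (I : Set (Fin d → ℤ)) = ⊤) :
    ApproximatelyControllable T ν f h (trigSpace (s - 1) I) := by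
  have hG := hF.continuous_nonlinearTerm
  have huniv : {q | Steer ν (nonlinearTerm F₁ F₂) h (trigSpace (s - 1) I) T q} = Set.univ := by
    refine eq_univ_of_saturation hs isClosed_steer (fun q hq q' hq' => hq.add hν hG hh hq') hp hc
      (I := (I : Set (Fin d → ℤ))) hI0 hIgen (fun k hk a => ⟨?_, ?_⟩) fun ζ hζ hζS =>
        hF.steer_neg_pow hν hp hh hζ hζS
    · refine hF.steer_control hν hp hh ((isTrig_cosMode k).smul a) ?_
      rw [map_smul, incl_cosMode]
      exact Submodule.smul_mem _ _ (cosMode_mem_trigSpace hk)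
    · refine hF.steer_control hν hp hh ((isTrig_sinMode k).smul a) ?_
      rw [map_smul, incl_sinMode]
      exact Submodule.smul_mem _ _ (sinMode_mem_trigSpace hk)
  have hall : ∀ q, Steer ν (nonlinearTerm F₁ F₂) h (trigSpace (s - 1) I) T q := fun q => by
    have : q ∈ {q | Steer ν (nonlinearTerm F₁ F₂) h (trigSpace (s - 1) I) T q} := by
      rw [huniv]; exact Set.mem_univ q
    exact this
  intro u₀ u₁ ε hε
  obtain ⟨x, ⟨η, u, hη, ⟨C, hC⟩, hηH, hu, rfl⟩, hx⟩ :=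
    hF.exists_reach_final hν hp hT hh hall u₀ u₁ hε
  have hφ := memLp_add_control hh hη ⟨C, hC⟩
  refine ⟨η, MemLp.of_bound hη.aestronglyMeasurable C (Eventually.of_forall hC),
    fun t _ => hηH t, u, (hF.isSolution_iff_isMild hν hT.le hφ).2 hu, fun v hv => ?_, hx⟩
  exact ((hF.isSolution_iff_isMild hν hT.le hφ).1 hv).eqOn hν hG hF.lipschitz_on_balls hφ hu

end Sobolev

end ParabolicControl

theorem mainTheorem1 (d : ℕ) (hd : 1 ≤ d) (ν : ℝ) (hν : 0 < ν) (T : ℝ) (hT : 0 < T)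
    (s : ℝ) (hs : (d : ℝ) / 2 < s)
    (P : Polynomial ℝ) (hP : 2 ≤ P.natDegree)
    (g : ℝ → ℝ) (hg : ContDiff ℝ ∞ g)
    (hgb : ∀ n : ℕ, ∃ C : ℝ, ∀ y : ℝ, |iteratedDeriv n g y| ≤ C)
    (hab : (∀ y : ℝ, g y = 0) ∨ s < (P.natDegree : ℝ))
    (h : ℝ → ParabolicControl.Sobolev d (s - 1))
    (hh : MemLp h 2 (volume.restrict (Set.Icc 0 T)))
    (I : Finset (Fin d → ℤ)) (hI0 : (0 : Fin d → ℤ) ∈ I) (hIsymm : ∀ k ∈ I, -k ∈ I)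
    (hIgen : Submodule.span ℤ (I : Set (Fin d → ℤ)) = ⊤) :
    ParabolicControl.ApproximatelyControllable T ν (fun y => P.eval y + g y) h
      (ParabolicControl.trigSpace (s - 1) I) := by
  obtain ⟨F₁, F₂, hF⟩ := ParabolicControl.Sobolev.exists_isNonlinearity hs P hP ⟨hg, hgb⟩ hab
  have hc : P.leadingCoeff ≠ 0 := by
    rw [Ne, Polynomial.leadingCoeff_eq_zero]
    rintro rfl
    simp at hP
  exact hF.approximatelyControllable hν hT hP hc hh hI0 hIgen
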